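/- **Conventions.** Let $\eta=\mathrm{diag}(-1,1,\dots,1)$ be the Minkowski metric on $\mathbb{R}^{1,10}$, used to raise and lower the indices $a,b,\ldots\in\{0,\dots,10\}$, let $\epsilon$ be the Levi-Civita symbol with $\epsilon_{0\,1\cdots 10}=+1$, and let repeated indices be summed. Let $\Gamma_0,\dots,\Gamma_{10}$ be real $32\times 32$ matrices with $\Gamma_a\Gamma_b+\Gamma_b\Gamma_a=2\eta_{ab}$ and $\Gamma_0\Gamma_1\cdots\Gamma_{10}=1$, let $(\eta_{\alpha\beta})$ be a skew-symmetric non-degenerate bilinear form on $\mathbb{R}^{32}$ for which every $\Gamma_a$ is skew self-adjoint, write $(\overline{\psi}\,M\,\phi)=\psi^\alpha\,\eta_{\alpha\alpha'}\,M^{\alpha'}{}_{\beta}\,\phi^\beta$ and let $\Gamma_{a_1\cdots a_p}=\Gamma_{[a_1}\cdots\Gamma_{a_p]}$ be the skew-symmetrized product, with weight $1/p!$. For $s\in\mathbb{R}$ the Chevalley–Eilenberg algebra $\mathrm{CE}(\widehat{\mathfrak{M}})$ of the hidden M-algebra is the free bigraded-commutative real algebra on generators $e^a$, $e_{a_1a_2}=e_{[a_1a_2]}$,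 $e_{a_1\cdots a_5}=e_{[a_1\cdots a_5]}$ of bidegree $(1,\mathrm{even})$ and $\psi^\alpha,\phi^\alpha$ ($1\le\alpha\le 32$) of bidegree $(1,\mathrm{odd})$, where elements of bidegrees $(n_1,\sigma_1)$, $(n_2,\sigma_2)$ commute up to the sign $(-1)^{n_1n_2+\sigma_1\sigma_2}$. Its differential $\mathrm{d}$ is the graded derivation of bidegree $(1,\mathrm{even})$ with $$\mathrm{d}\psi=0,\quad \mathrm{d}e^a=(\overline\psi\Gamma^a\psi),\quad \mathrm{d}e_{a_1a_2}=-(\overline\psi\Gamma_{a_1a_2}\psi),\quad \mathrm{d}e_{a_1\cdots a_5}=(\overline\psi\Gamma_{a_1\cdots a_5}\psi),$$ $$\mathrm{d}\phi=2(1+s)\,\Gamma_a\psi\,e^a+\Gamma^{a_1a_2}\psi\,e_{a_1a_2}+2\Big(\tfrac1{5!}+\tfrac{s}{6!}\Big)\Gamma^{a_1\cdots a_5}\psi\,e_{a_1\cdots a_5}.$$ For real coefficients $(\alpha_0,\dots,\alpha_4,\beta_1,\beta_2,\beta_3)\in\mathbb{R}^8$ consider the 3-form (the *ansatz*) $$\begin{aligned}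 &\alpha_0\,e_{a_1a_2}e^{a_1}e^{a_2}+\alpha_1\,e^{a_1}{}_{a_2}e^{a_2}{}_{a_3}e^{a_3}{}_{a_1}+\alpha_2\,e^{a_1\cdots a_4b_1}e_{b_1}{}^{b_2}e_{b_2a_1\cdots a_4}\\ &+\alpha_3\,\epsilon_{a_1\cdots a_5b_1\cdots b_5c}\,e^{a_1\cdots a_5}e^{b_1\cdots b_5}e^{c}+\alpha_4\,\epsilon_{a_1a_2a_3b_1b_2b_3c_1\cdots c_5}\,e^{a_1a_2a_3d_1d_2}e_{d_1d_2}{}^{b_1b_2b_3}e^{c_1\cdots c_5}\\ &+\beta_1\,(\overline\psi\Gamma_a\phi)\,e^a+\beta_2\,(\overline\psi\Gamma_{a_1a_2}\phi)\,e^{a_1a_2}+\beta_3\,(\overline\psi\Gamma_{a_1\cdots a_5}\phi)\,e^{a_1\cdots a_5}. \end{aligned}$$ For $s\neq0$ let $\widehat P_3=\widehat P_3(s)$ be the 3-form of the ansatz with coefficients $$\alpha_0=-\tfrac1{10}\tfrac{6+2s+s^2}{s^2},\quad \alpha_1=\tfrac1{30}\tfrac{6+2s}{s^2},\quad \alpha_2=\tfrac{1}{2\cdot6!}\tfrac{(6+s)^2}{s^2},\quad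 \alpha_3=\tfrac1{10\cdot5!\cdot6!}\tfrac{(6+s)^2}{s^2},\quad \alpha_4=-\tfrac1{18\cdot5!\cdot6!}\tfrac{(6+s)^2}{s^2},$$ $$\beta_1=-\tfrac1{10}\tfrac{3-2s}{s^2},\quad \beta_2=-\tfrac1{20}\tfrac{3+s}{s^2},\quad \beta_3=-\tfrac{3}{10\cdot6!}\tfrac{6+s}{s^2},$$ and let $\Omega_3$ be the 3-form of the ansatz with coefficients $$\alpha_0=-\tfrac35,\quad \alpha_1=\tfrac15,\quad \alpha_2=\tfrac{18}{6!},\quad \alpha_3=\tfrac{18}{5\cdot5!\cdot6!},\quad \alpha_4=-\tfrac{2}{5!\cdot6!},\quad \beta_1=-\tfrac3{10},\quad \beta_2=-\tfrac3{20},\quad \beta_3=-\tfrac{3}{10\cdot5!}.$$ **Proposition (Space of super-Poincaré 3-forms).** 1. For $s\neq0$ the only 3-form of the ansatz that is closed, $\mathrm{d}\,\Omega=0$, is $0$; it arises only from the zero coefficients. 2. For $s=0$ the space of closed 3-forms of the ansatz is 1-dimensional and spanned by $\Omega_3$. Likewise the space of coefficient vectors in $\mathbb{R}^8$ whose 3-form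 is closed is 1-dimensional and spanned by the coefficients of $\Omega_3$. 3. $\Omega_3=\lim_{s\to0}s^2\,\widehat P_3(s)$, as a limit of coefficients in the ansatz. -/

import Mathlib

namespace HiddenM

noncomputable section

open scoped Matrix

/-! ### Minkowski metric, Levi-Civita symbol -/

/-- The diagonal entries of the mostly-plus Minkowski metric on `ℝ^{1,10}`:
`η_{ab} = η^{ab} = diag(-1, 1, …, 1)`. -/
def mink (a : Fin 11) : ℝ := if a = 0 then -1 else 1

/-- The factor by which a tensor component changes when all of the indices `a₁, …, aₚ`
are raised (or lowered) with the (diagonal) Minkowski metric. -/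
def shift {p : ℕ} (a : Fin p → Fin 11) : ℝ := ∏ i, mink (a i)

/-- The Levi-Civita symbol with lower indices, `ε_{0 1 ⋯ 10} = 1`. -/
def levi (a : Fin 11 → Fin 11) : ℝ :=
  Matrix.det (Matrix.of fun i j => if a i = j then (1 : ℝ) else 0)

/-! ### Spinors in eleven dimensions -/

/-- The skew-symmetrized product `Γ_{a₁⋯aₚ} = (1/p!) ∑_σ sgn(σ) Γ_{a_σ(1)} ⋯ Γ_{a_σ(p)}`. -/
def skewProd (Γ : Fin 11 → Matrix (Fin 32) (Fin 32) ℝ) {p : ℕ} (a : Fin p → Fin 11) :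
    Matrix (Fin 32) (Fin 32) ℝ :=
  ((p.factorial : ℝ)⁻¹) •
    ∑ σ : Equiv.Perm (Fin p),
      ((Equiv.Perm.sign σ : ℤ) : ℝ) • (List.ofFn fun i => Γ (a (σ i))).prod

/-- The representation `32` of `Pin⁺(1,10)` together with its spinor metric, in a linear basis:
real `32 × 32` matrices `Γ_a` with lower index `a` (acting as `(Γ_a ψ)^α = ∑_β (Γ_a)^α_β ψ^β`) that
satisfy the Clifford relations for the mostly-plus metric and have Clifford volume form
`Γ_0 Γ_1 ⋯ Γ_10 = 1`, and a skew-symmetric non-degenerate matrix `η_{αβ}` such that each `Γ_a` is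
skew self-adjoint for the pairing `(ψ̄ φ) = ψ^α η_{αβ} φ^β`. Such data exist
(`MajoranaRep.nonempty`), and they are unique up to a change of basis of `ℝ³²` and a rescaling
of `η`. -/
structure MajoranaRep where
  Γ : Fin 11 → Matrix (Fin 32) (Fin 32) ℝ
  η : Matrix (Fin 32) (Fin 32) ℝ
  clifford : ∀ a b, Γ a * Γ b + Γ b * Γ a = if a = b then (2 * mink a) • 1 else 0
  volume : (List.ofFn Γ).prod = 1
  skew : ηᵀ = -η
  nondeg : η.det ≠ 0
  skewAdjoint : ∀ a, (Γ a)ᵀ * η = -(η * Γ a)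

/-- `Γ_{a₁⋯aₚ}` -/
def MajoranaRep.gam (S : MajoranaRep) {p : ℕ} (a : Fin p → Fin 11) :
    Matrix (Fin 32) (Fin 32) ℝ := skewProd S.Γ a

/-- The signed permutation matrix with entry `s i` in the `i`-th row and `q i`-th column. -/
def sperm (q : Fin 32 → Fin 32) (s : Fin 32 → ℤ) : Matrix (Fin 32) (Fin 32) ℝ :=
  Matrix.of fun i j => if j = q i then (s i : ℝ) else 0

theorem sperm_mul (q q' : Fin 32 → Fin 32) (s s' : Fin 32 → ℤ) :
    sperm q s * sperm q' s' = sperm (fun i => q' (q i)) (fun i => s i * s' (q i)) := by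
  ext i j
  simp only [sperm, Matrix.mul_apply, Matrix.of_apply, ite_mul, zero_mul]
  rw [Finset.sum_ite_eq' Finset.univ (q i)]
  simp

theorem sperm_one : sperm id (fun _ => 1) = 1 := by
  ext i j
  simp [sperm, Matrix.one_apply, eq_comm]

theorem sperm_neg (q : Fin 32 → Fin 32) (s : Fin 32 → ℤ) :
    sperm q (fun i => -s i) = -sperm q s := by
  ext i j
  simp only [sperm, Matrix.of_apply, Matrix.neg_apply]
  split_ifs <;> simp

/-- Bit masks of the concrete Clifford generators used in `MajoranaRep.nonempty`. -/
def maskX : Fin 11 → Fin 32 := ![31, 0, 1, 3, 5, 7, 9, 11, 13, 15, 31]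
def maskZ : Fin 11 → Fin 32 := ![21, 1, 0, 3, 7, 13, 15, 9, 11, 21, 5]
def maskS : Fin 11 → ℤ := ![-1, 1, 1, 1, 1, 1, 1, 1, 1, 1, -1]
def bitSign (i : ℕ) : ℤ :=
  (-1) ^ (i % 2 + i / 2 % 2 + i / 4 % 2 + i / 8 % 2 + i / 16 % 2)
def gq (a : Fin 11) (i : Fin 32) : Fin 32 := i ^^^ maskX a
def gs (a : Fin 11) (i : Fin 32) : ℤ := maskS a * bitSign (i.val &&& (maskZ a).val)

set_option maxRecDepth 100000 in
theorem gq_comm : ∀ a b i, gq b (gq a i) = gq a (gq b i) := by decide +kernel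

set_option maxRecDepth 100000 in
theorem gs_anti : ∀ a b, a ≠ b → ∀ i, gs a i * gs b (gq a i) = -(gs b i * gs a (gq b i)) := by
  decide +kernel

set_option maxRecDepth 100000 in
theorem gs_sq : ∀ a i, gq a (gq a i) = i ∧ gs a i * gs a (gq a i) = if a = 0 then -1 else 1 := by
  decide +kernel

theorem sperm_gq_one (c : ℤ) : sperm id (fun _ => c) = (c : ℝ) • 1 := by
  ext i j
  simp [sperm, Matrix.one_apply, eq_comm]

theorem concrete_clifford (a b : Fin 11) :
    sperm (gq a) (gs a) * sperm (gq b) (gs b) + sperm (gq b) (gs b) * sperm (gq a) (gs a)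
      = if a = b then (2 * mink a) • 1 else 0 := by
  split_ifs with h
  · subst h
    rw [sperm_mul]
    have h1 : (fun i => gq a (gq a i)) = id := funext fun i => (gs_sq a i).1
    have h2 : (fun i => gs a i * gs a (gq a i)) = fun _ => if a = 0 then -1 else 1 :=
      funext fun i => (gs_sq a i).2
    rw [h1, h2, sperm_gq_one, ← add_smul]
    congr 1
    unfold mink
    split_ifs <;> norm_num
  · rw [sperm_mul, sperm_mul]
    have h1 : (fun i => gq b (gq a i)) = fun i => gq a (gq b i) := funext (gq_comm a b)
    have h2 : (fun i => gs a i * gs b (gq a i)) = fun i => -(gs b i * gs a (gq b i)) :=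
      funext (gs_anti a b h)
    rw [h1, h2, sperm_neg, neg_add_cancel]

theorem concrete_transpose (a : Fin 11) :
    (sperm (gq a) (gs a))ᵀ = mink a • sperm (gq a) (gs a) := by
  have key : ∀ a i, gs a (gq a i) = (if a = 0 then -1 else 1) * gs a i := by decide +kernel
  have hq : ∀ a i, gq a (gq a i) = i := fun a i => (gs_sq a i).1
  ext i j
  simp only [sperm, Matrix.transpose_apply, Matrix.of_apply, Matrix.smul_apply, smul_eq_mul]
  by_cases h : i = gq a j
  · subst h
    rw [if_pos rfl, hq, if_pos rfl, key]
    unfold mink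
    split_ifs <;> simp
  · have h' : j ≠ gq a i := fun hj => h (by rw [hj, hq])
    rw [if_neg h, if_neg h', mul_zero]

theorem concrete_volume : (List.ofFn fun a => sperm (gq a) (gs a)).prod = 1 := by
  simp only [List.ofFn_succ, List.ofFn_zero, List.prod_cons, List.prod_nil, mul_one, sperm_mul]
  rw [← sperm_one]
  congr 1
  · funext i; revert i; decide +kernel
  · funext i; revert i; decide +kernel

theorem MajoranaRep.nonempty : Nonempty MajoranaRep := by
  have hT := concrete_transpose
  have hsq : sperm (gq 0) (gs 0) * sperm (gq 0) (gs 0) = -1 := by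
    have h := concrete_clifford 0 0
    rw [if_pos rfl, ← two_smul ℝ, mul_smul] at h
    have := smul_right_injective _ (two_ne_zero (α := ℝ)) h
    simpa [mink] using this
  have h0 : (sperm (gq 0) (gs 0))ᵀ = -sperm (gq 0) (gs 0) := by
    rw [hT]; simp [mink]
  refine ⟨⟨fun a => sperm (gq a) (gs a), sperm (gq 0) (gs 0), concrete_clifford,
    concrete_volume, h0, ?_, ?_⟩⟩
  · intro hd
    have := congrArg Matrix.det hsq
    rw [Matrix.det_mul, hd, Matrix.det_neg, Matrix.det_one] at this
    norm_num at this
  · intro a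
    rw [hT]
    by_cases h : a = 0
    · subst h; simp [mink]
    · have := concrete_clifford a 0
      rw [if_neg h] at this
      simp only [mink, if_neg h, one_smul]
      exact eq_neg_of_add_eq_zero_left this

/-! ### The Chevalley-Eilenberg algebra of the hidden M-algebra -/

/-- The generators `e^a`, `e_{a₁a₂}`, `e_{a₁⋯a₅}`, `ψ^α`, `φ^α`. -/
inductive Gen
  | e1 (a : Fin 11)
  | e2 (a : Fin 2 → Fin 11)
  | e5 (a : Fin 5 → Fin 11)
  | psi (α : Fin 32)
  | phi (α : Fin 32)

/-- The super-degree of the generators; their homological degree is `1` throughout. -/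
def Gen.sdeg : Gen → ℕ
  | .e1 _ => 0
  | .e2 _ => 0
  | .e5 _ => 0
  | .psi _ => 1
  | .phi _ => 1

/-- The relations: the sign rule `x y = (-1)^(1·1 + σ_x σ_y) y x` for generators of bidegree
`(1, σ_x)`, `(1, σ_y)`, and the skew-symmetry of `e_{a₁a₂}` and `e_{a₁⋯a₅}`. -/
inductive CERel : FreeAlgebra ℝ Gen → FreeAlgebra ℝ Gen → Prop
  | comm (x y : Gen) :
      CERel (FreeAlgebra.ι ℝ x * FreeAlgebra.ι ℝ y)
        (((-1 : ℝ) ^ (1 * 1 + x.sdeg * y.sdeg)) • (FreeAlgebra.ι ℝ y * FreeAlgebra.ι ℝ x))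
  | skew2 (a : Fin 2 → Fin 11) (τ : Equiv.Perm (Fin 2)) :
      CERel (FreeAlgebra.ι ℝ (Gen.e2 fun i => a (τ i)))
        (((Equiv.Perm.sign τ : ℤ) : ℝ) • FreeAlgebra.ι ℝ (Gen.e2 a))
  | skew5 (a : Fin 5 → Fin 11) (τ : Equiv.Perm (Fin 5)) :
      CERel (FreeAlgebra.ι ℝ (Gen.e5 fun i => a (τ i)))
        (((Equiv.Perm.sign τ : ℤ) : ℝ) • FreeAlgebra.ι ℝ (Gen.e5 a))

/-- The free graded super-commutative algebra underlying the Chevalley-Eilenberg algebra. -/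
def CE : Type := RingQuot CERel

instance : Semiring CE := inferInstanceAs (Semiring (RingQuot CERel))
instance : Algebra ℝ CE := inferInstanceAs (Algebra ℝ (RingQuot CERel))
instance : Ring CE := Algebra.semiringToRing ℝ

/-- The quotient map from the free (tensor) algebra on the generators. -/
def mkCE : FreeAlgebra ℝ Gen →ₐ[ℝ] CE := RingQuot.mkAlgHom ℝ CERel

theorem mkCE_surjective : Function.Surjective mkCE := RingQuot.mkAlgHom_surjective ℝ CERel

theorem mkCE_rel {x y : FreeAlgebra ℝ Gen} (h : CERel x y) : mkCE x = mkCE y :=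
  RingQuot.mkAlgHom_rel ℝ h

/-- The algebra map out of `CE` induced by an assignment on generators that respects the
relations. -/
def liftCE {A : Type} [Semiring A] [Algebra ℝ A] (f : Gen → A)
    (hf : ∀ ⦃x y : FreeAlgebra ℝ Gen⦄, CERel x y →
      FreeAlgebra.lift ℝ f x = FreeAlgebra.lift ℝ f y) : CE →ₐ[ℝ] A :=
  RingQuot.liftAlgHom ℝ ⟨FreeAlgebra.lift ℝ f, hf⟩

theorem liftCE_mk {A : Type} [Semiring A] [Algebra ℝ A] (f : Gen → A)
    (hf : ∀ ⦃x y : FreeAlgebra ℝ Gen⦄, CERel x y →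
      FreeAlgebra.lift ℝ f x = FreeAlgebra.lift ℝ f y) (x : FreeAlgebra ℝ Gen) :
    liftCE f hf (mkCE x) = FreeAlgebra.lift ℝ f x :=
  RingQuot.liftAlgHom_mkAlgHom_apply ℝ _ _ x

/-- A generator, as an element of the algebra. -/
def gen (x : Gen) : CE := mkCE (FreeAlgebra.ι ℝ x)

/-- `e^a` -/
def e1 (a : Fin 11) : CE := gen (.e1 a)
/-- `e_{a₁a₂}` -/
def e2 (a : Fin 2 → Fin 11) : CE := gen (.e2 a)
/-- `e_{a₁⋯a₅}` -/
def e5 (a : Fin 5 → Fin 11) : CE := gen (.e5 a)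
/-- `ψ^α` -/
def psi (α : Fin 32) : CE := gen (.psi α)
/-- `φ^α` -/
def phi (α : Fin 32) : CE := gen (.phi α)

/-- The bilinear `(ψ̄ M ψ) = ψ^α η_{αα'} M^{α'}_β ψ^β`. -/
def psiPsi (S : MajoranaRep) (M : Matrix (Fin 32) (Fin 32) ℝ) : CE :=
  ∑ α, ∑ β, ((S.η * M) α β) • (psi α * psi β)

/-- The bilinear `(ψ̄ M φ) = ψ^α η_{αα'} M^{α'}_β φ^β`. -/
def psiPhi (S : MajoranaRep) (M : Matrix (Fin 32) (Fin 32) ℝ) : CE :=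
  ∑ α, ∑ β, ((S.η * M) α β) • (psi α * phi β)

/-- The `α`-component of `M ψ`. -/
def actPsi (M : Matrix (Fin 32) (Fin 32) ℝ) (α : Fin 32) : CE := ∑ β, M α β • psi β

/-- `δ(s) = 2 (1 + s)` -/
def coefDelta (s : ℝ) : ℝ := 2 * (1 + s)
/-- `γ₁(s) = 1` -/
def coefGamma1 (_s : ℝ) : ℝ := 1
/-- `γ₂(s) = 2 (1/5! + s/6!)` -/
def coefGamma2 (s : ℝ) : ℝ := 2 * (1 / (Nat.factorial 5 : ℝ) + s / (Nat.factorial 6 : ℝ))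

/-- The differential on generators:
`d e^a = (ψ̄ Γ^a ψ)`, `d e_{a₁a₂} = -(ψ̄ Γ_{a₁a₂} ψ)`, `d e_{a₁⋯a₅} = (ψ̄ Γ_{a₁⋯a₅} ψ)`, `d ψ = 0`,
`d φ = δ Γ_a ψ e^a + γ₁ Γ^{a₁a₂} ψ e_{a₁a₂} + γ₂ Γ^{a₁⋯a₅} ψ e_{a₁⋯a₅}`. -/
def dGen (S : MajoranaRep) (s : ℝ) : Gen → CE
  | .e1 a => mink a • psiPsi S (S.Γ a)
  | .e2 a => -psiPsi S (S.gam a)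
  | .e5 a => psiPsi S (S.gam a)
  | .psi _ => 0
  | .phi α =>
      coefDelta s • (∑ a : Fin 11, actPsi (S.Γ a) α * e1 a)
      + coefGamma1 s • (∑ a : Fin 2 → Fin 11, shift a • (actPsi (S.gam a) α * e2 a))
      + coefGamma2 s • (∑ a : Fin 5 → Fin 11, shift a • (actPsi (S.gam a) α * e5 a))

/-! ### Extension of the differential to the whole algebra as a graded derivation -/

theorem gen_comm (x y : Gen) :
    gen x * gen y = ((-1 : ℝ) ^ (1 * 1 + x.sdeg * y.sdeg)) • (gen y * gen x) := by
  have h := mkCE_rel (CERel.comm x y)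
  simpa [gen] using h

theorem gen_skew2 (a : Fin 2 → Fin 11) (τ : Equiv.Perm (Fin 2)) :
    gen (.e2 fun i => a (τ i)) = ((Equiv.Perm.sign τ : ℤ) : ℝ) • gen (.e2 a) := by
  have h := mkCE_rel (CERel.skew2 a τ)
  rw [map_smul] at h
  exact h

theorem gen_skew5 (a : Fin 5 → Fin 11) (τ : Equiv.Perm (Fin 5)) :
    gen (.e5 fun i => a (τ i)) = ((Equiv.Perm.sign τ : ℤ) : ℝ) • gen (.e5 a) := by
  have h := mkCE_rel (CERel.skew5 a τ)
  rw [map_smul] at h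
  exact h

theorem skewProd_perm (Γ : Fin 11 → Matrix (Fin 32) (Fin 32) ℝ) {p : ℕ} (a : Fin p → Fin 11)
    (τ : Equiv.Perm (Fin p)) :
    skewProd Γ (fun i => a (τ i)) = ((Equiv.Perm.sign τ : ℤ) : ℝ) • skewProd Γ a := by
  unfold skewProd
  rw [smul_comm]
  congr 1
  rw [← Equiv.sum_comp (Equiv.mulLeft τ)
    (fun σ : Equiv.Perm (Fin p) =>
      ((Equiv.Perm.sign σ : ℤ) : ℝ) • (List.ofFn fun i => Γ (a (σ i))).prod), Finset.smul_sum]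
  refine Finset.sum_congr rfl fun σ _ => ?_
  simp only [Equiv.coe_mulLeft, Equiv.Perm.sign_mul, Equiv.Perm.mul_apply, smul_smul]
  congr 1
  rcases Int.units_eq_one_or (Equiv.Perm.sign τ) with h | h <;> simp [h]

theorem psiPsi_smul (S : MajoranaRep) (c : ℝ) (M : Matrix (Fin 32) (Fin 32) ℝ) :
    psiPsi S (c • M) = c • psiPsi S M := by
  simp [psiPsi, Finset.smul_sum, smul_smul]

/-- The elements that commute with the generator `w` as one of bidegree `(2, k)` does. -/
def commSub (k : ℕ) (w : Gen) : Submodule ℝ CE where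
  carrier := {q | q * gen w = ((-1 : ℝ) ^ (k * w.sdeg)) • (gen w * q)}
  add_mem' := by
    intro p q hp hq
    simp only [Set.mem_ofPred_eq] at *
    rw [add_mul, hp, hq, mul_add, smul_add]
  zero_mem' := by simp
  smul_mem' := by
    intro c q hq
    simp only [Set.mem_ofPred_eq] at *
    rw [smul_mul_assoc, hq, mul_smul_comm, smul_comm]

theorem gen_mul_gen_mem (x y w : Gen) : gen x * gen y ∈ commSub (x.sdeg + y.sdeg) w := by
  change gen x * gen y * gen w = _ • (gen w * (gen x * gen y))
  rw [mul_assoc, gen_comm y w, mul_smul_comm, ← mul_assoc, gen_comm x w, smul_mul_assoc, smul_smul,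
    mul_assoc]
  congr 1
  ring

theorem psiPsi_mem (S : MajoranaRep) (M : Matrix (Fin 32) (Fin 32) ℝ) (w : Gen) :
    psiPsi S M ∈ commSub 0 w := by
  have h2 : commSub 2 w = commSub 0 w := by
    ext q
    change _ = _ ↔ _ = _
    simp [pow_mul]
  rw [← h2]
  exact Submodule.sum_mem _ fun α _ => Submodule.sum_mem _ fun β _ =>
    Submodule.smul_mem _ _ (gen_mul_gen_mem (.psi α) (.psi β) w)

theorem actPsi_mul_mem (M : Matrix (Fin 32) (Fin 32) ℝ) (α : Fin 32) (x w : Gen)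
    (hx : x.sdeg = 0) : actPsi M α * gen x ∈ commSub 1 w := by
  unfold actPsi
  rw [Finset.sum_mul]
  refine Submodule.sum_mem _ fun β _ => ?_
  rw [smul_mul_assoc]
  have h := gen_mul_gen_mem (.psi β) x w
  rw [hx] at h
  exact Submodule.smul_mem _ _ h

theorem dGen_mem (S : MajoranaRep) (s : ℝ) (x w : Gen) : dGen S s x ∈ commSub x.sdeg w := by
  cases x with
  | e1 a => exact Submodule.smul_mem _ _ (psiPsi_mem S _ w)
  | e2 a => exact Submodule.neg_mem _ (psiPsi_mem S _ w)
  | e5 a => exact psiPsi_mem S _ w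
  | psi α => exact Submodule.zero_mem _
  | phi α =>
      refine Submodule.add_mem _ (Submodule.add_mem _ ?_ ?_) ?_
      · exact Submodule.smul_mem _ _ (Submodule.sum_mem _ fun a _ =>
          actPsi_mul_mem _ α (.e1 a) w rfl)
      · exact Submodule.smul_mem _ _ (Submodule.sum_mem _ fun a _ =>
          Submodule.smul_mem _ _ (actPsi_mul_mem _ α (.e2 a) w rfl))
      · exact Submodule.smul_mem _ _ (Submodule.sum_mem _ fun a _ =>
          Submodule.smul_mem _ _ (actPsi_mul_mem _ α (.e5 a) w rfl))

theorem dGen_skew2 (S : MajoranaRep) (s : ℝ) (a : Fin 2 → Fin 11) (τ : Equiv.Perm (Fin 2)) :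
    dGen S s (.e2 fun i => a (τ i)) = ((Equiv.Perm.sign τ : ℤ) : ℝ) • dGen S s (.e2 a) := by
  simp only [dGen, MajoranaRep.gam]
  rw [skewProd_perm, psiPsi_smul, smul_neg]

theorem dGen_skew5 (S : MajoranaRep) (s : ℝ) (a : Fin 5 → Fin 11) (τ : Equiv.Perm (Fin 5)) :
    dGen S s (.e5 fun i => a (τ i)) = ((Equiv.Perm.sign τ : ℤ) : ℝ) • dGen S s (.e5 a) := by
  simp only [dGen, MajoranaRep.gam]
  rw [skewProd_perm, psiPsi_smul]

/-- The values on generators of the algebra map `x ↦ !![(-1)^(deg x) x, d x; 0, x]`, whose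
multiplicativity is the graded Leibniz rule. -/
def triGen (S : MajoranaRep) (s : ℝ) (x : Gen) : Matrix (Fin 2) (Fin 2) CE :=
  !![-gen x, dGen S s x; 0, gen x]

theorem triGen_rel (S : MajoranaRep) (s : ℝ) ⦃x y : FreeAlgebra ℝ Gen⦄ (h : CERel x y) :
    FreeAlgebra.lift ℝ (triGen S s) x = FreeAlgebra.lift ℝ (triGen S s) y := by
  cases h with
  | comm x y =>
      have hc := gen_comm x y
      have h1 : dGen S s x * gen y = ((-1 : ℝ) ^ (x.sdeg * y.sdeg)) • (gen y * dGen S s x) :=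
        dGen_mem S s x y
      have h2 : dGen S s y * gen x = ((-1 : ℝ) ^ (y.sdeg * x.sdeg)) • (gen x * dGen S s y) :=
        dGen_mem S s y x
      have hs : ((-1 : ℝ) ^ (x.sdeg * y.sdeg)) * ((-1 : ℝ) ^ (x.sdeg * y.sdeg)) = 1 := by
        rw [← mul_pow]; norm_num
      simp only [map_mul, map_smul, FreeAlgebra.lift_ι_apply, triGen, Matrix.mul_fin_two,
        Matrix.smul_of, Matrix.smul_cons, Matrix.smul_empty, neg_mul, mul_neg, neg_neg, mul_zero,
        zero_mul, add_zero, zero_add]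
      rw [hc, h1, h2, mul_comm y.sdeg x.sdeg, pow_add, smul_add, smul_smul]
      simp only [mul_one, pow_one, neg_mul, one_mul, neg_smul, smul_neg, hs, one_smul, neg_neg,
        neg_zero, smul_zero]
      rw [add_comm (-(gen x * dGen S s y))]
  | skew2 a τ =>
      simp only [map_smul, FreeAlgebra.lift_ι_apply, triGen, gen_skew2, dGen_skew2]
      simp [Matrix.smul_of]
  | skew5 a τ =>
      simp only [map_smul, FreeAlgebra.lift_ι_apply, triGen, gen_skew5, dGen_skew5]
      simp [Matrix.smul_of]

def tri (S : MajoranaRep) (s : ℝ) : CE →ₐ[ℝ] Matrix (Fin 2) (Fin 2) CE :=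
  liftCE (triGen S s) (triGen_rel S s)

/-- The differential of the Chevalley-Eilenberg algebra of the hidden M-algebra at parameter `s`:
the unique graded derivation of degree `(1, even)` with the values `dGen` on generators
(see `d_gen`, `d_mul`). -/
def d (S : MajoranaRep) (s : ℝ) : CE →ₗ[ℝ] CE where
  toFun x := tri S s x 0 1
  map_add' x y := by simp
  map_smul' c x := by simp

theorem tri_gen (S : MajoranaRep) (s : ℝ) (x : Gen) : tri S s (gen x) = triGen S s x := by
  rw [tri, gen, liftCE_mk, FreeAlgebra.lift_ι_apply]

theorem d_gen (S : MajoranaRep) (s : ℝ) (x : Gen) : d S s (gen x) = dGen S s x := by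
  change tri S s (gen x) 0 1 = _
  rw [tri_gen]
  rfl

theorem neg_rel ⦃x y : FreeAlgebra ℝ Gen⦄ (h : CERel x y) :
    FreeAlgebra.lift ℝ (fun x => -gen x) x = FreeAlgebra.lift ℝ (fun x => -gen x) y := by
  cases h with
  | comm x y =>
      simp only [map_mul, map_smul, FreeAlgebra.lift_ι_apply, neg_mul_neg]
      exact gen_comm x y
  | skew2 a τ =>
      simp only [map_smul, FreeAlgebra.lift_ι_apply, gen_skew2, smul_neg]
  | skew5 a τ =>
      simp only [map_smul, FreeAlgebra.lift_ι_apply, gen_skew5, smul_neg]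

/-- The involution `x ↦ (-1)^n x` for `x` of homological degree `n`. -/
def parity : CE →ₐ[ℝ] CE :=
  liftCE (fun x => -gen x) neg_rel

theorem parity_gen (x : Gen) : parity (gen x) = -gen x := by
  rw [parity, gen, liftCE_mk, FreeAlgebra.lift_ι_apply, gen]

theorem tri_eq (S : MajoranaRep) (s : ℝ) (x : CE) :
    tri S s x = !![parity x, d S s x; 0, x] := by
  obtain ⟨y, rfl⟩ := mkCE_surjective x
  have hg : ∀ z : Gen, mkCE (FreeAlgebra.ι ℝ z) = gen z := fun _ => rfl
  suffices h : tri S s (mkCE y) 0 0 = parity (mkCE y) ∧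
      tri S s (mkCE y) 1 0 = 0 ∧
      tri S s (mkCE y) 1 1 = mkCE y by
    ext i j
    fin_cases i <;> fin_cases j
    · exact h.1
    · rfl
    · exact h.2.1
    · exact h.2.2
  induction y using FreeAlgebra.induction with
  | grade0 r => simp [Matrix.algebraMap_matrix_apply]
  | grade1 z => rw [hg, tri_gen, parity_gen]; simp [triGen]
  | mul a b ha hb =>
      simp only [map_mul, Matrix.mul_apply, Fin.sum_univ_two, ha.1, ha.2.1, ha.2.2, hb.1, hb.2.1,
        hb.2.2]
      simp
  | add a b ha hb =>
      simp only [map_add, Matrix.add_apply, ha.1, ha.2.1, ha.2.2, hb.1, hb.2.1, hb.2.2]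
      simp

/-- The graded Leibniz rule `d(xy) = (dx) y + (-1)^(deg x) x (dy)`. -/
theorem d_mul (S : MajoranaRep) (s : ℝ) (x y : CE) :
    d S s (x * y) = d S s x * y + parity x * d S s y := by
  have h : tri S s (x * y) 0 1 = (tri S s x * tri S s y) 0 1 := by rw [map_mul]
  rw [tri_eq S s x, tri_eq S s y] at h
  change d S s (x * y) = _ at h
  rw [h]
  simp [add_comm]

/-! ### The ansatz for the 3-form -/

/-- `e_{a₁a₂} e^{a₁} e^{a₂}` -/
def termA0 : CE := ∑ a : Fin 11, ∑ b : Fin 11, e2 ![a, b] * e1 a * e1 b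

/-- `e^{a₁}_{a₂} e^{a₂}_{a₃} e^{a₃}_{a₁}` -/
def termA1 : CE := ∑ a : Fin 11, ∑ b : Fin 11, ∑ c : Fin 11,
  (mink a * mink b * mink c) • (e2 ![a, b] * e2 ![b, c] * e2 ![c, a])

/-- `e^{a₁⋯a₄b₁} e_{b₁}^{b₂} e_{b₂a₁⋯a₄}` -/
def termA2 : CE := ∑ a : Fin 4 → Fin 11, ∑ b : Fin 11, ∑ c : Fin 11,
  (shift a * mink b * mink c) •
    (e5 ![a 0, a 1, a 2, a 3, b] * e2 ![b, c] * e5 ![c, a 0, a 1, a 2, a 3])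

/-- `ε_{a₁⋯a₅b₁⋯b₅c} e^{a₁⋯a₅} e^{b₁⋯b₅} e^c` -/
def termA3 : CE := ∑ a : Fin 5 → Fin 11, ∑ b : Fin 5 → Fin 11, ∑ c : Fin 11,
  (levi ![a 0, a 1, a 2, a 3, a 4, b 0, b 1, b 2, b 3, b 4, c] * shift a * shift b) •
    (e5 a * e5 b * e1 c)

/-- `ε_{a₁a₂a₃b₁b₂b₃c₁⋯c₅} e^{a₁a₂a₃d₁d₂} e_{d₁d₂}^{b₁b₂b₃} e^{c₁⋯c₅}` -/
def termA4 : CE := ∑ a : Fin 3 → Fin 11, ∑ b : Fin 3 → Fin 11, ∑ c : Fin 5 → Fin 11,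
  ∑ f : Fin 2 → Fin 11,
  (levi ![a 0, a 1, a 2, b 0, b 1, b 2, c 0, c 1, c 2, c 3, c 4]
      * shift a * shift b * shift c * shift f) •
    (e5 ![a 0, a 1, a 2, f 0, f 1] * e5 ![f 0, f 1, b 0, b 1, b 2] * e5 c)

/-- `(ψ̄ Γ_a φ) e^a` -/
def termB1 (S : MajoranaRep) : CE := ∑ a : Fin 11, psiPhi S (S.Γ a) * e1 a

/-- `(ψ̄ Γ_{a₁a₂} φ) e^{a₁a₂}` -/
def termB2 (S : MajoranaRep) : CE :=
  ∑ a : Fin 2 → Fin 11, shift a • (psiPhi S (S.gam a) * e2 a)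

/-- `(ψ̄ Γ_{a₁⋯a₅} φ) e^{a₁⋯a₅}` -/
def termB3 (S : MajoranaRep) : CE :=
  ∑ a : Fin 5 → Fin 11, shift a • (psiPhi S (S.gam a) * e5 a)

/-- The coefficients `((α₀, α₁, α₂, α₃, α₄), (β₁, β₂, β₃))` of the ansatz. -/
abbrev Params : Type := (Fin 5 → ℝ) × (Fin 3 → ℝ)

/-- The 3-form of the ansatz with given coefficients. -/
def ansatz (S : MajoranaRep) : Params →ₗ[ℝ] CE where
  toFun c :=
    c.1 0 • termA0 + c.1 1 • termA1 + c.1 2 • termA2 + c.1 3 • termA3 + c.1 4 • termA4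
      + c.2 0 • termB1 S + c.2 1 • termB2 S + c.2 2 • termB3 S
  map_add' c c' := by
    simp only [Prod.fst_add, Prod.snd_add, Pi.add_apply]
    module
  map_smul' r c := by
    simp only [Prod.smul_fst, Prod.smul_snd, Pi.smul_apply, smul_eq_mul, RingHom.id_apply]
    module

/-- The coefficients of the solutions of `d Ω = 0` within the ansatz. -/
def closedParams (S : MajoranaRep) (s : ℝ) : Submodule ℝ Params :=
  LinearMap.ker (d S s ∘ₗ ansatz S)

/-- The closed 3-forms within the ansatz. -/
def closedForms (S : MajoranaRep) (s : ℝ) : Submodule ℝ CE :=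
  LinearMap.range (ansatz S) ⊓ LinearMap.ker (d S s)

/-- The coefficients of the hidden 3-form `P̂₃` at parameter `s ≠ 0`. -/
def hiddenParams (s : ℝ) : Params :=
  (![1 / 2 * (-1 / 5) * ((6 + 2 * s + s ^ 2) / s ^ 2),
     1 / 2 * (1 / 15) * ((6 + 2 * s) / s ^ 2),
     1 / 2 * (1 / (Nat.factorial 6 : ℝ)) * ((6 + s) ^ 2 / s ^ 2),
     1 / 2 * (1 / (5 * (Nat.factorial 5 : ℝ) * (Nat.factorial 6 : ℝ))) * ((6 + s) ^ 2 / s ^ 2),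
     1 / 2 * (-1 / (9 * (Nat.factorial 5 : ℝ) * (Nat.factorial 6 : ℝ))) * ((6 + s) ^ 2 / s ^ 2)],
   ![-1 * (1 / (10 * coefGamma1 s)) * ((3 - 2 * s) / s ^ 2),
     -1 * (1 / (20 * coefGamma1 s)) * ((3 + s) / s ^ 2),
     -1 * (3 / (10 * (Nat.factorial 6 : ℝ) * coefGamma1 s)) * ((6 + s) / s ^ 2)])

/-- The coefficients of `Ω₃`. -/
def omegaParams : Params :=
  (![-3 / 5,
     1 / 5,
     18 / (Nat.factorial 6 : ℝ),
     18 / (5 * (Nat.factorial 5 : ℝ) * (Nat.factorial 6 : ℝ)),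
     -2 / ((Nat.factorial 5 : ℝ) * (Nat.factorial 6 : ℝ))],
   ![-3 / 10,
     -3 / 20,
     -3 / (10 * (Nat.factorial 5 : ℝ))])

/-- The 3-form `Ω₃`. -/
def Omega3 (S : MajoranaRep) : CE := ansatz S omegaParams

end

end HiddenM

namespace HiddenM

open scoped Matrix symmDiff

/-! ### Products of pairwise anticommuting elements -/

/-! The computation is organised by the Clifford-valued 1-forms ω_p = ∑_{|A|=p} Γ^A e_A for p = 1,
2, 5. Since Γ_0⋯Γ_10 = 1, the trace of Γ_A Γ_B Γ_C vanishes unless C is the symmetric difference A ∆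
B or its complement. Hence each of the five bosonic terms, including the two with an ε, is a
multiple of a single trace tr(ω_p ω_q ω_r) (`termA0_eq` to `termA4_eq`), while the β-terms are
multiples of (ψ̄ ω_p φ).

Because d e_A = ±(ψ̄ Γ_A ψ), the differential of such a trace is a cyclic sum of terms (ψ̄ P_p(ω_q
ω_r) ψ), where P_p is 32 times the projection to degree p. The form dφ has coefficients 2(1+s), 2
and 2(1+s/6) along ω_1, ω_2 and ω_5. The matrices ηΓ_A are symmetric for |A| = 1, 2, 5, so (ψ̄ Γ^B
Γ^C ψ) survives only if Γ_B and Γ_C anticommute. This leaves eight sectors `nForm q r k`, labelled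
by |B|, |C| and |B ∩ C|, on each of which a projection acts as 32 or as 0. The result is `d_ansatz`:
eight linear expressions in the coefficients, and a part cubic in ψ. Algebra maps to 4 × 4 matrices
show that the eight expressions vanish separately (`coefficients_eq_zero`).

Eliminating the α's and then β₁, β₂ gives 400 s² β₃ = 0, which settles s ≠ 0 apart from s = -6.
There the coefficient of ω_5 in dφ vanishes, the elimination degenerates, and the cubic part
supplies the missing equation (`cubicForm_relation`). At s = 0 the bosonic sectors leave a line on
which β₁ = 2β₂ = 120β₃. With these equal weights the cubic part vanishes by the Fierz identity
`sum_cubicForm`, a consequence of the completeness of the Clifford products. That the line does not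
collapse in the algebra is `ansatz_ne_zero`. -/

theorem prod_ofFn_swap {R : Type*} [Ring R] : ∀ {n : ℕ} (x : Fin (n + 1) → R) (i : Fin n),
    x i.castSucc * x i.succ = -(x i.succ * x i.castSucc) →
    (List.ofFn fun j => x (Equiv.swap i.castSucc i.succ j)).prod = -(List.ofFn x).prod := by
  intro n
  induction n with
  | zero => intro x i; exact i.elim0
  | succ n ih =>
    intro x i
    refine Fin.cases ?_ (fun j => ?_) i
    · intro h
      have h2 : ∀ k : Fin n, Equiv.swap (0 : Fin (n + 2)) 1 k.succ.succ = k.succ.succ := fun k =>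
        Equiv.swap_apply_of_ne_of_ne (Fin.succ_ne_zero _)
          (fun h => by simpa using congrArg Fin.val h)
      simp only [Fin.castSucc_zero, Fin.succ_zero_eq_one] at h ⊢
      simp only [List.ofFn_succ, List.prod_cons, Fin.succ_zero_eq_one, Equiv.swap_apply_left,
        Equiv.swap_apply_right, h2]
      rw [← mul_assoc, ← mul_assoc, h, neg_mul, neg_neg]
    · intro h
      have h0 : Equiv.swap j.succ.castSucc j.succ.succ 0 = 0 :=
        Equiv.swap_apply_of_ne_of_ne (fun h => by simpa using congrArg Fin.val h)
          (Fin.succ_ne_zero _).symm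
      have h1 : ∀ k, Equiv.swap j.succ.castSucc j.succ.succ k.succ
          = (Equiv.swap j.castSucc j.succ k).succ := fun k => by
        rw [← Fin.succ_castSucc]
        exact (Function.Injective.swap_apply (Fin.succ_injective _) _ _ _)
      rw [List.ofFn_succ, List.prod_cons, h0, List.ofFn_succ (f := x), List.prod_cons]
      simp only [h1]
      rw [ih (fun k => x k.succ) j (by rw [Fin.succ_castSucc]; exact h), mul_neg]

/-- Adjacent transpositions generate the symmetric group. The family `x` is quantified after σ
because, for a composite στ, the hypothesis on τ is applied to the family already permuted by σ. -/
theorem prod_ofFn_perm {R : Type*} [Ring R] [Algebra ℝ R] {n : ℕ} (σ : Equiv.Perm (Fin n)) :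
    ∀ (x : Fin n → R), (∀ i j, i ≠ j → x i * x j = -(x j * x i)) →
    (List.ofFn fun j => x (σ j)).prod = ((Equiv.Perm.sign σ : ℤ) : ℝ) • (List.ofFn x).prod := by
  cases n with
  | zero => intro x _; simp [Subsingleton.elim σ 1]
  | succ n =>
    have hσ : σ ∈ Submonoid.closure (Set.range fun i : Fin n ↦ Equiv.swap i.castSucc i.succ) := by
      rw [Equiv.Perm.mclosure_swap_castSucc_succ]; trivial
    induction hσ using Submonoid.closure_induction with
    | mem τ hτ =>
      obtain ⟨i, rfl⟩ := hτ
      intro x hx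
      have hi : i.castSucc ≠ i.succ := Fin.castSucc_lt_succ.ne
      rw [prod_ofFn_swap x i (hx _ _ hi), Equiv.Perm.sign_swap hi]
      simp
    | one => intro x _; simp
    | mul σ τ _ _ ihσ ihτ =>
      intro x hx
      have h := ihτ (fun j => x (σ j)) fun i j hij => hx _ _ fun h => hij (σ.injective h)
      simp only [Equiv.Perm.mul_apply]
      rw [h, ihσ x hx, smul_smul, Equiv.Perm.sign_mul, mul_comm]
      push_cast; rfl

/-! ### Clifford products along tuples of indices -/

theorem mink_mul_self (a : Fin 11) : mink a * mink a = 1 := by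
  unfold mink; split_ifs <;> norm_num

theorem shift_mul_self {p : ℕ} (a : Fin p → Fin 11) : shift a * shift a = 1 := by
  simp [shift, ← Finset.prod_mul_distrib, mink_mul_self]

namespace MajoranaRep

variable (S : MajoranaRep)

theorem Γ_anticomm {a b : Fin 11} (h : a ≠ b) : S.Γ a * S.Γ b = -(S.Γ b * S.Γ a) := by
  have := S.clifford a b
  rw [if_neg h] at this
  exact eq_neg_of_add_eq_zero_left this

theorem Γ_mul_self (a : Fin 11) : S.Γ a * S.Γ a = mink a • 1 := by
  have := S.clifford a a
  rw [if_pos rfl, ← two_smul ℝ, mul_smul] at this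
  exact smul_right_injective _ (two_ne_zero (α := ℝ)) this

/-- The ordered product `Γ_{a₁} ⋯ Γ_{aₚ}`. -/
def gT {p : ℕ} (a : Fin p → Fin 11) : Matrix (Fin 32) (Fin 32) ℝ :=
  (List.ofFn fun i => S.Γ (a i)).prod

theorem gT_perm {p : ℕ} {a : Fin p → Fin 11} (ha : Function.Injective a)
    (σ : Equiv.Perm (Fin p)) :
    S.gT (fun i => a (σ i)) = ((Equiv.Perm.sign σ : ℤ) : ℝ) • S.gT a :=
  prod_ofFn_perm σ (fun i => S.Γ (a i)) fun _ _ hij => S.Γ_anticomm fun h => hij (ha h)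

theorem sign_mul_self {p : ℕ} (σ : Equiv.Perm (Fin p)) :
    ((Equiv.Perm.sign σ : ℤ) : ℝ) * ((Equiv.Perm.sign σ : ℤ) : ℝ) = 1 := by
  rcases Int.units_eq_one_or (Equiv.Perm.sign σ) with h | h <;> simp [h]

/-- The factors anticommute pairwise, so all p! summands of the skew-symmetrization coincide. -/
theorem gam_eq_gT {p : ℕ} {a : Fin p → Fin 11} (ha : Function.Injective a) :
    S.gam a = S.gT a := by
  have h : ∀ σ : Equiv.Perm (Fin p), ((Equiv.Perm.sign σ : ℤ) : ℝ) •
      (List.ofFn fun i => S.Γ (a (σ i))).prod = S.gT a := fun σ => by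
    have := S.gT_perm ha σ
    rw [gT] at this
    rw [this, smul_smul, sign_mul_self, one_smul]
  rw [gam, skewProd, Finset.sum_congr rfl fun σ _ => h σ]
  simp only [Finset.sum_const, Finset.card_univ, Fintype.card_perm, Fintype.card_fin]
  rw [← Nat.cast_smul_eq_nsmul ℝ, smul_smul, inv_mul_cancel₀ (by positivity), one_smul]

end MajoranaRep

/-! ### Enumerations of finite sets of indices -/

/-- The increasing enumeration. -/
def enum (A : Finset (Fin 11)) : Fin A.card → Fin 11 := A.orderEmbOfFin rfl

theorem enum_injective (A : Finset (Fin 11)) : Function.Injective (enum A) :=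
  (A.orderEmbOfFin rfl).injective

theorem image_enum (A : Finset (Fin 11)) : Finset.univ.image (enum A) = A := by
  rw [← Finset.coe_inj, Finset.coe_image, Finset.coe_univ, Set.image_univ]
  exact A.range_orderEmbOfFin rfl

theorem exists_perm_enum {A : Finset (Fin 11)} {a : Fin A.card → Fin 11}
    (hA : Finset.univ.image a = A) :
    ∃ σ : Equiv.Perm (Fin A.card), a = fun i => enum A (σ i) := by
  have hc : (Finset.univ.image a).card = (Finset.univ : Finset (Fin A.card)).card := by
    rw [hA]; simp
  have ha : Function.Injective a := by
    simpa using Finset.card_image_iff.1 hc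
  have hm : ∀ i, a i ∈ A := fun i => hA ▸ Finset.mem_image_of_mem a (Finset.mem_univ i)
  have hinj : Function.Injective fun i => (A.orderIsoOfFin rfl).symm ⟨a i, hm i⟩ := by
    intro i j hij
    exact ha (congrArg Subtype.val ((A.orderIsoOfFin rfl).symm.injective hij))
  refine ⟨Equiv.ofBijective _ ((Finite.injective_iff_bijective).1 hinj), funext fun i => ?_⟩
  have := (A.orderIsoOfFin rfl).apply_symm_apply ⟨a i, hm i⟩
  exact (congrArg Subtype.val this).symm

theorem card_image_tuple {p : ℕ} {a : Fin p → Fin 11} (ha : Function.Injective a) :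
    (Finset.univ.image a).card = p := by
  rw [Finset.card_image_of_injective _ ha, Finset.card_univ, Fintype.card_fin]

/-- The product of the metric factors of a set of indices. -/
noncomputable def shS (A : Finset (Fin 11)) : ℝ := ∏ i ∈ A, mink i

theorem shift_eq_shS {p : ℕ} {a : Fin p → Fin 11} (ha : Function.Injective a) :
    shift a = shS (Finset.univ.image a) := by
  rw [shS, Finset.prod_image ha.injOn, shift]

theorem shS_insert {i : Fin 11} {A : Finset (Fin 11)} (hi : i ∉ A) :
    shS (insert i A) = mink i * shS A := Finset.prod_insert hi

theorem shS_mul_self (A : Finset (Fin 11)) : shS A * shS A = 1 := by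
  simp [shS, ← Finset.prod_mul_distrib, mink_mul_self]

/-- The sign `(-1)^{p(p-1)/2}` of the reversal of `p` letters. -/
noncomputable def kap (p : ℕ) : ℝ := (-1) ^ (p.choose 2)

theorem kap_mul_self (p : ℕ) : kap p * kap p = 1 := by
  rw [kap, ← mul_pow]; norm_num

theorem kap_succ (p : ℕ) : kap (p + 1) = (-1) ^ p * kap p := by
  rw [kap, kap, Nat.choose_succ_succ', Nat.choose_one_right, pow_add]

/-! ### Clifford products of index sets: products, commutation, transposes, traces -/

namespace MajoranaRep

variable (S : MajoranaRep)

/-- The ordered Clifford product of a set of indices. -/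
def gS (A : Finset (Fin 11)) : Matrix (Fin 32) (Fin 32) ℝ := S.gT (enum A)

/-- Here and below an ordering sign is remembered only through ε² = 1. Its value is never needed,
because such signs later occur in pairs. -/
theorem exists_sign_of_image_eq {p : ℕ} {A : Finset (Fin 11)} (h : A.card = p)
    {a : Fin p → Fin 11} (hA : Finset.univ.image a = A) :
    ∃ ε : ℝ, ε * ε = 1 ∧ S.gT a = ε • S.gS A := by
  subst h
  obtain ⟨σ, rfl⟩ := exists_perm_enum hA
  exact ⟨_, sign_mul_self σ, S.gT_perm (enum_injective A) σ⟩

theorem gS_empty : S.gS ∅ = 1 := by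
  unfold gS gT
  have : List.ofFn (fun i => S.Γ (enum ∅ i)) = [] := List.eq_nil_of_length_eq_zero (by simp)
  rw [this, List.prod_nil]

theorem gS_insert {i : Fin 11} {A : Finset (Fin 11)} (hi : i ∉ A) :
    ∃ ε : ℝ, ε * ε = 1 ∧ S.gS (insert i A) = ε • (S.Γ i * S.gS A) := by
  have hA : Finset.univ.image (Fin.cons i (enum A) : Fin (A.card + 1) → Fin 11) = insert i A := by
    conv_rhs => rw [← image_enum A]
    ext j
    simp [Fin.exists_fin_succ, eq_comm]
  obtain ⟨ε, hε, h⟩ := S.exists_sign_of_image_eq (Finset.card_insert_of_notMem hi) hA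
  refine ⟨ε, hε, ?_⟩
  have h2 : S.gT (Fin.cons i (enum A) : Fin (A.card + 1) → Fin 11) = S.Γ i * S.gS A := by
    simp [gT, gS, List.ofFn_succ]
  rw [← h2, h, smul_smul, hε, one_smul]

theorem Γ_mul_gS (i : Fin 11) (A : Finset (Fin 11)) :
    ∃ ε : ℝ, ε * ε = 1 ∧ S.Γ i * S.gS A = ε • S.gS (A ∆ {i}) := by
  by_cases hi : i ∈ A
  · obtain ⟨ε, hε, h⟩ := S.gS_insert (Finset.notMem_erase i A)
    have hs : A ∆ {i} = A.erase i := by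
      ext j; simp only [Finset.mem_symmDiff, Finset.mem_singleton, Finset.mem_erase]
      by_cases hj : j = i
      · subst hj; simp [hi]
      · simp [hj]
    rw [Finset.insert_erase hi] at h
    refine ⟨ε * mink i, ?_, ?_⟩
    · rw [mul_mul_mul_comm, hε, mink_mul_self, one_mul]
    · rw [h, mul_smul_comm, ← mul_assoc, Γ_mul_self, smul_mul_assoc, one_mul, smul_smul, hs]
  · obtain ⟨ε, hε, h⟩ := S.gS_insert hi
    have hs : A ∆ {i} = insert i A := by
      ext j; simp only [Finset.mem_symmDiff, Finset.mem_singleton, Finset.mem_insert]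
      by_cases hj : j = i
      · subst hj; simp [hi]
      · simp [hj]
    exact ⟨ε, hε, by rw [hs, h, smul_smul, hε, one_smul]⟩

/-- Letters common to A and B square to ±1 and disappear, up to the sign of bringing them together.
-/
theorem gS_mul_gS (A B : Finset (Fin 11)) :
    ∃ ε : ℝ, ε * ε = 1 ∧ S.gS A * S.gS B = ε • S.gS (A ∆ B) := by
  induction A using Finset.induction_on with
  | empty =>
    exact ⟨1, one_mul 1, by rw [gS_empty, one_mul, one_smul, ← Finset.bot_eq_empty, bot_symmDiff]⟩
  | insert i A hi ih =>
    obtain ⟨ε, hε, h⟩ := ih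
    obtain ⟨ε₁, hε₁, h₁⟩ := S.gS_insert hi
    obtain ⟨ε₂, hε₂, h₂⟩ := S.Γ_mul_gS i (A ∆ B)
    have hs : insert i A ∆ B = (A ∆ B) ∆ {i} := by
      ext j; simp only [Finset.mem_symmDiff, Finset.mem_singleton, Finset.mem_insert]
      by_cases hj : j = i
      · subst hj; simp [hi]
      · simp [hj]
    refine ⟨ε₁ * ε * ε₂, ?_, ?_⟩
    · linear_combination (ε₁ * ε₁ * ε * ε) * hε₂ + ε₁ * ε₁ * hε + hε₁
    · rw [h₁, smul_mul_assoc, mul_assoc, h, mul_smul_comm, h₂, hs, smul_smul, smul_smul, mul_assoc]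

theorem Γ_comm_gS (i : Fin 11) (A : Finset (Fin 11)) :
    S.Γ i * S.gS A = ((-1 : ℝ) ^ (A.card + (A ∩ {i}).card)) • (S.gS A * S.Γ i) := by
  induction A using Finset.induction_on with
  | empty => simp [gS_empty]
  | insert j A hj ih =>
    obtain ⟨ε, hε, h⟩ := S.gS_insert hj
    rw [h, mul_smul_comm, smul_mul_assoc, Finset.card_insert_of_notMem hj, smul_comm]
    congr 1
    by_cases hij : j = i
    · subst hij
      have h1 : A ∩ {j} = ∅ := Finset.inter_singleton_of_notMem hj
      have h2 : insert j A ∩ {j} = {j} := by ext k; simp +contextual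
      rw [h1, Finset.card_empty, add_zero] at ih
      rw [h2, Finset.card_singleton, mul_assoc, ih, mul_smul_comm, ← mul_smul_comm, pow_add, pow_add]
      simp
    · have h2 : insert j A ∩ {i} = A ∩ {i} := by
        ext k; simp only [Finset.mem_inter, Finset.mem_insert, Finset.mem_singleton]
        constructor
        · rintro ⟨rfl | h, rfl⟩
          · exact absurd rfl hij
          · exact ⟨h, rfl⟩
        · rintro ⟨h, rfl⟩
          exact ⟨Or.inr h, rfl⟩
      rw [h2, ← mul_assoc, S.Γ_anticomm (Ne.symm hij), neg_mul, mul_assoc, ih, mul_smul_comm,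
        add_right_comm, pow_succ, mul_neg_one, neg_smul, mul_assoc]

/-- Each of the |A||B| exchanges of letters costs a sign, except for the |A ∩ B| exchanges of equal
letters. -/
theorem gS_comm_gS (A B : Finset (Fin 11)) :
    S.gS A * S.gS B = ((-1 : ℝ) ^ (A.card * B.card + (A ∩ B).card)) • (S.gS B * S.gS A) := by
  induction A using Finset.induction_on with
  | empty => simp [gS_empty]
  | insert i A hi ih =>
    obtain ⟨ε, hε, h⟩ := S.gS_insert hi
    have hc : (insert i A ∩ B).card = (B ∩ {i}).card + (A ∩ B).card := by
      by_cases hB : i ∈ B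
      · rw [Finset.insert_inter_of_mem hB, Finset.card_insert_of_notMem (by simp [hi]),
          Finset.inter_singleton_of_mem hB, Finset.card_singleton, add_comm]
      · rw [Finset.insert_inter_of_notMem hB, Finset.inter_singleton_of_notMem hB]
        simp
    rw [h, smul_mul_assoc, mul_assoc, ih, mul_smul_comm, ← mul_assoc, Γ_comm_gS, hc,
      Finset.card_insert_of_notMem hi]
    simp only [smul_mul_assoc, mul_smul_comm, smul_smul, mul_assoc]
    congr 1
    ring

theorem gS_mul_self (A : Finset (Fin 11)) : S.gS A * S.gS A = (kap A.card * shS A) • 1 := by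
  induction A using Finset.induction_on with
  | empty => simp [gS_empty, kap, shS]
  | insert i A hi ih =>
    obtain ⟨ε, hε, h⟩ := S.gS_insert hi
    have h1 := S.Γ_comm_gS i A
    rw [Finset.inter_singleton_of_notMem hi, Finset.card_empty, add_zero] at h1
    have h2 : S.gS A * S.Γ i = ((-1 : ℝ) ^ A.card) • (S.Γ i * S.gS A) := by
      rw [h1, smul_smul, ← mul_pow]; simp
    rw [h, smul_mul_smul_comm, hε, one_smul, mul_assoc, ← mul_assoc (S.gS A), h2, smul_mul_assoc,
      mul_smul_comm, mul_assoc, ih, ← mul_assoc, Γ_mul_self, smul_mul_smul_comm, one_mul, smul_smul,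
      Finset.card_insert_of_notMem hi, kap_succ, shS_insert hi]
    congr 1
    ring

/-- Each letter moved past η gives -1, and transposition reverses their order, which gives `kap`.
Since η itself is skew, ηΓ_A is symmetric for |A| = 1, 2, 5 and skew for |A| = 0, 3, 4. -/
theorem transpose_gS_mul (A : Finset (Fin 11)) :
    (S.gS A)ᵀ * S.η = ((-1) ^ A.card * kap A.card) • (S.η * S.gS A) := by
  induction A using Finset.induction_on with
  | empty => simp [gS_empty, kap]
  | insert i A hi ih =>
    obtain ⟨ε, hε, h⟩ := S.gS_insert hi
    have h1 := S.Γ_comm_gS i A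
    rw [Finset.inter_singleton_of_notMem hi, Finset.card_empty, add_zero] at h1
    have h2 : S.gS A * S.Γ i = ((-1 : ℝ) ^ A.card) • (S.Γ i * S.gS A) := by
      rw [h1, smul_smul, ← mul_pow]; simp
    rw [h, Matrix.transpose_smul, Matrix.transpose_mul, smul_mul_assoc, mul_assoc, S.skewAdjoint,
      mul_neg, ← mul_assoc, ih, smul_mul_assoc, mul_assoc, h2, Finset.card_insert_of_notMem hi,
      kap_succ]
    simp only [mul_smul_comm, smul_smul, ← neg_smul]
    congr 1
    ring

theorem gS_univ : S.gS Finset.univ = 1 := by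
  have h : (Finset.univ : Finset (Fin 11)).card = 11 := by simp
  have h2 : enum Finset.univ = fun i => Fin.cast h i := by
    symm
    refine Finset.orderEmbOfFin_unique rfl (fun _ => Finset.mem_univ _) ?_
    intro i j hij; exact hij
  rw [gS, gT, h2]
  exact S.volume

theorem trace_eq_zero_of_anticomm {M : Matrix (Fin 32) (Fin 32) ℝ} (i : Fin 11)
    (h : S.Γ i * M = -(M * S.Γ i)) : M.trace = 0 := by
  have h1 : (mink i • M).trace = -(mink i • M).trace := by
    calc (mink i • M).trace = (S.Γ i * S.Γ i * M).trace := by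
          rw [Γ_mul_self, smul_mul_assoc, one_mul]
      _ = -(S.Γ i * (M * S.Γ i)).trace := by rw [mul_assoc, h, mul_neg, Matrix.trace_neg]
      _ = -(mink i • M).trace := by
          rw [Matrix.trace_mul_comm, mul_assoc, Γ_mul_self, mul_smul_comm, mul_one]
  rw [Matrix.trace_smul, smul_eq_mul] at h1
  have h2 : mink i * M.trace = 0 := by linarith
  have := congrArg (mink i * ·) h2
  simpa [← mul_assoc, mink_mul_self] using this

/-- Some Γ_i anticommutes with Γ_A: take i in A if |A| is even, and outside A if it is odd. -/
theorem trace_gS {A : Finset (Fin 11)} (h0 : A ≠ ∅) (h1 : A ≠ Finset.univ) :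
    (S.gS A).trace = 0 := by
  rcases Nat.even_or_odd A.card with hA | hA
  · obtain ⟨i, hi⟩ := Finset.nonempty_iff_ne_empty.2 h0
    refine S.trace_eq_zero_of_anticomm i ?_
    rw [Γ_comm_gS, Finset.inter_singleton_of_mem hi, Finset.card_singleton, hA.add_one.neg_one_pow,
      neg_one_smul]
  · obtain ⟨i, hi⟩ : ∃ i, i ∉ A := by
      by_contra! h
      exact h1 (Finset.eq_univ_iff_forall.2 h)
    refine S.trace_eq_zero_of_anticomm i ?_
    rw [Γ_comm_gS, Finset.inter_singleton_of_notMem hi, Finset.card_empty, add_zero, hA.neg_one_pow,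
      neg_one_smul]

end MajoranaRep

/-! ### Trace orthogonality and projections to a Clifford degree -/

/-- The sets of `p` indices. -/
abbrev idx (p : ℕ) : Finset (Finset (Fin 11)) := Finset.powersetCard p Finset.univ

theorem mem_idx {p : ℕ} {A : Finset (Fin 11)} : A ∈ idx p ↔ A.card = p := by
  simp [Finset.mem_powersetCard]

namespace MajoranaRep

variable (S : MajoranaRep)

/-- The Clifford product of a set of indices, with its indices raised. -/
noncomputable def gU (A : Finset (Fin 11)) : Matrix (Fin 32) (Fin 32) ℝ := shS A • S.gS A

theorem gU_mul_gU (A B : Finset (Fin 11)) :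
    ∃ ε : ℝ, ε * ε = 1 ∧ S.gU A * S.gU B = ε • S.gS (A ∆ B) := by
  obtain ⟨ε, hε, h⟩ := S.gS_mul_gS A B
  refine ⟨shS A * shS B * ε, ?_, ?_⟩
  · linear_combination (shS A * shS A * shS B * shS B) * hε + shS A * shS A * shS_mul_self B
      + shS_mul_self A
  · rw [gU, gU, smul_mul_smul_comm, h, smul_smul]

theorem gS_compl (A : Finset (Fin 11)) : ∃ ε : ℝ, ε * ε = 1 ∧ S.gS Aᶜ = ε • S.gS A := by
  obtain ⟨ε, hε, h⟩ := S.gS_mul_gS A Finset.univ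
  have hs : A ∆ Finset.univ = Aᶜ := by rw [← Finset.top_eq_univ, symmDiff_top]; rfl
  rw [gS_univ, mul_one, hs] at h
  exact ⟨ε, hε, by rw [h, smul_smul, hε, one_smul]⟩

/-- The product of all eleven letters is 1 and has non-zero trace, just like the empty product. The
resulting complement alternative is the source of the ε-terms. -/
theorem symmDiff_of_trace_ne_zero {A B : Finset (Fin 11)}
    (h : (S.gS A * S.gS B).trace ≠ 0) : B = A ∨ B = Aᶜ := by
  obtain ⟨ε, -, h1⟩ := S.gS_mul_gS A B
  rw [h1, Matrix.trace_smul] at h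
  by_contra! hAB
  refine h ?_
  rw [S.trace_gS, smul_zero]
  · intro h0
    exact hAB.1 (symmDiff_eq_bot.1 h0).symm
  · intro h0
    refine hAB.2 ?_
    have := congrArg (A ∆ ·) h0
    simp only [symmDiff_symmDiff_cancel_left] at this
    rw [this, ← Finset.top_eq_univ, symmDiff_top]; rfl

theorem trace_gU_mul_gS_self (A : Finset (Fin 11)) :
    (S.gU A * S.gS A).trace = 32 * kap A.card := by
  rw [gU, smul_mul_assoc, gS_mul_self, Matrix.trace_smul, Matrix.trace_smul, Matrix.trace_one]
  simp only [smul_eq_mul, Fintype.card_fin, Nat.cast_ofNat]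
  linear_combination 32 * kap A.card * shS_mul_self A

/-- The projection of a matrix to the span of the Clifford products of `p` indices, multiplied
by `32`. -/
noncomputable def proj (p : ℕ) (X : Matrix (Fin 32) (Fin 32) ℝ) : Matrix (Fin 32) (Fin 32) ℝ :=
  ∑ A ∈ idx p, (kap p * (S.gU A * X).trace) • S.gS A

theorem proj_smul (p : ℕ) (c : ℝ) (X : Matrix (Fin 32) (Fin 32) ℝ) :
    S.proj p (c • X) = c • S.proj p X := by
  simp only [proj, Finset.smul_sum, mul_smul_comm, Matrix.trace_smul, smul_smul, smul_eq_mul]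
  refine Finset.sum_congr rfl fun A _ => ?_
  congr 1; ring

theorem proj_gS_self (D : Finset (Fin 11)) : S.proj D.card (S.gS D) = (32 : ℝ) • S.gS D := by
  rw [proj, Finset.sum_eq_single_of_mem D (mem_idx.2 rfl)]
  · rw [trace_gU_mul_gS_self]
    congr 1
    linear_combination 32 * kap_mul_self D.card
  · intro A hA hAD
    rw [mem_idx] at hA
    have h : (S.gS A * S.gS D).trace = 0 := by
      by_contra h
      rcases S.symmDiff_of_trace_ne_zero h with h | h
      · exact hAD h.symm
      · have := congrArg Finset.card h
        rw [Finset.card_compl, Fintype.card_fin] at this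
        omega
    rw [gU, smul_mul_assoc, Matrix.trace_smul, h, smul_zero, mul_zero, zero_smul]

/-- Complementary products agree up to sign, so the projection to degree p also fixes degree 11 - p.
The factor 32 is the trace of the identity. -/
theorem proj_gS {p : ℕ} (D : Finset (Fin 11)) :
    S.proj p (S.gS D) = if D.card = p ∨ D.card + p = 11 then (32 : ℝ) • S.gS D else 0 := by
  split_ifs with h
  · rcases h with rfl | h
    · exact S.proj_gS_self D
    · obtain ⟨ε, hε, h1⟩ := S.gS_compl D
      have hc : Dᶜ.card = p := by rw [Finset.card_compl, Fintype.card_fin]; omega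
      have h2 : S.gS D = ε • S.gS Dᶜ := by rw [h1, smul_smul, hε, one_smul]
      rw [h2, proj_smul, ← hc, proj_gS_self, smul_comm]
  · refine Finset.sum_eq_zero fun A hA => ?_
    rw [mem_idx] at hA
    have h : (S.gS A * S.gS D).trace = 0 := by
      by_contra h1
      rcases S.symmDiff_of_trace_ne_zero h1 with h2 | h2
      · exact h (Or.inl (h2 ▸ hA))
      · have := congrArg Finset.card h2
        rw [Finset.card_compl, Fintype.card_fin] at this
        have := Finset.card_le_univ A
        rw [Fintype.card_fin] at this
        omega
    rw [gU, smul_mul_assoc, Matrix.trace_smul, h, smul_zero, mul_zero, zero_smul]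

theorem proj_gU_mul_gU (p : ℕ) (B C : Finset (Fin 11)) :
    S.proj p (S.gU B * S.gU C) =
      if (B ∆ C).card = p ∨ (B ∆ C).card + p = 11 then (32 : ℝ) • (S.gU B * S.gU C) else 0 := by
  obtain ⟨ε, -, h⟩ := S.gU_mul_gU B C
  rw [h, proj_smul, proj_gS]
  split_ifs
  · rw [smul_comm]
  · rw [smul_zero]

end MajoranaRep

theorem card_symmDiff_add (B C : Finset (Fin 11)) :
    (B ∆ C).card + 2 * (B ∩ C).card = B.card + C.card := by
  have h1 := Finset.card_sdiff_add_card_inter B C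
  have h2 := Finset.card_sdiff_add_card_inter C B
  have h3 : (B ∆ C).card = (B \ C).card + (C \ B).card := by
    rw [symmDiff_def, Finset.sup_eq_union, Finset.card_union_of_disjoint disjoint_sdiff_sdiff]
  rw [Finset.inter_comm C B] at h2
  omega

/-! ### The generators indexed by tuples and by sets -/

/-- The generators `e_{a₁⋯aₚ}`, with lower indices. -/
noncomputable def eT : (p : ℕ) → (Fin p → Fin 11) → CE
  | 1, a => mink (a 0) • e1 (a 0)
  | 2, a => e2 a
  | 5, a => e5 a
  | _, _ => 0

theorem eT_perm {p : ℕ} (a : Fin p → Fin 11) (σ : Equiv.Perm (Fin p)) :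
    eT p (fun i => a (σ i)) = ((Equiv.Perm.sign σ : ℤ) : ℝ) • eT p a := by
  match p with
  | 1 => simp [Subsingleton.elim σ 1]
  | 2 => exact gen_skew2 a σ
  | 5 => exact gen_skew5 a σ
  | 0 => exact (smul_zero _).symm
  | 3 => exact (smul_zero _).symm
  | 4 => exact (smul_zero _).symm
  | n + 6 => exact (smul_zero _).symm

theorem eT_eq_zero {p : ℕ} {a : Fin p → Fin 11} (ha : ¬ Function.Injective a) : eT p a = 0 := by
  simp only [Function.Injective, not_forall] at ha
  obtain ⟨i, j, hij, hne⟩ := ha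
  have h := eT_perm a (Equiv.swap i j)
  have h1 : (fun k => a (Equiv.swap i j k)) = a := by
    funext k
    by_cases hk : k = i
    · rw [hk, Equiv.swap_apply_left, hij]
    · by_cases hk' : k = j
      · rw [hk', Equiv.swap_apply_right, hij]
      · rw [Equiv.swap_apply_of_ne_of_ne hk hk']
  rw [h1, Equiv.Perm.sign_swap hne] at h
  simp only [Units.val_neg, Units.val_one, Int.cast_neg, Int.cast_one, neg_smul, one_smul] at h
  have h2 : (2 : ℝ) • eT p a = 0 := by
    rw [two_smul]; nth_rewrite 1 [h]; exact neg_add_cancel _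
  exact (smul_eq_zero_iff_right two_ne_zero).1 h2

/-- The generators with lower indices, labelled by sets of indices. -/
noncomputable def eS (A : Finset (Fin 11)) : CE := eT A.card (enum A)

theorem eS_singleton (i : Fin 11) : eS {i} = mink i • e1 i := by
  -- The cardinality is made a variable so that it can be replaced by the literal 1, on which `eT`
  -- computes.
  have : ∀ (p : ℕ) (h : ({i} : Finset (Fin 11)).card = p), p = 1 →
      eT p (({i} : Finset (Fin 11)).orderEmbOfFin h) = mink i • e1 i := by
    rintro _ h rfl
    have := Finset.orderEmbOfFin_singleton i 0
    simp only [eT]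
    rw [this]
  exact this _ rfl (Finset.card_singleton i)

namespace MajoranaRep

variable (S : MajoranaRep)

theorem gS_singleton (i : Fin 11) : S.gS {i} = S.Γ i := by
  have : ∀ (p : ℕ) (h : ({i} : Finset (Fin 11)).card = p), p = 1 →
      S.gT (({i} : Finset (Fin 11)).orderEmbOfFin h) = S.Γ i := by
    rintro _ h rfl
    simp [gT]
  exact this _ rfl (Finset.card_singleton i)

/-- Reordering the indices changes Γ and e by the same sign, so that Γ^A e_A depends only on the set
A. -/
theorem exists_common_sign {p : ℕ} {A : Finset (Fin 11)} (h : A.card = p)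
    {a : Fin p → Fin 11} (hA : Finset.univ.image a = A) :
    ∃ ε : ℝ, ε * ε = 1 ∧ S.gT a = ε • S.gS A ∧ eT p a = ε • eS A := by
  subst h
  obtain ⟨σ, rfl⟩ := exists_perm_enum hA
  exact ⟨_, sign_mul_self σ, S.gT_perm (enum_injective A) σ, eT_perm (enum A) σ⟩

/-- The summand of the traces of products of three Clifford-valued `1`-forms. -/
noncomputable def tri3 (A B C : Finset (Fin 11)) : CE :=
  (S.gU A * S.gU B * S.gU C).trace • (eS A * eS B * eS C)

theorem tri3_image {p q r : ℕ} {a : Fin p → Fin 11} {b : Fin q → Fin 11} {c : Fin r → Fin 11}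
    (ha : Function.Injective a) (hb : Function.Injective b) (hc : Function.Injective c) :
    S.tri3 (Finset.univ.image a) (Finset.univ.image b) (Finset.univ.image c) =
      (shift a * shift b * shift c * (S.gT a * S.gT b * S.gT c).trace) •
        (eT p a * eT q b * eT r c) := by
  obtain ⟨ε₁, h₁, g₁, e₁⟩ := S.exists_common_sign (card_image_tuple ha) rfl
  obtain ⟨ε₂, h₂, g₂, e₂⟩ := S.exists_common_sign (card_image_tuple hb) rfl
  obtain ⟨ε₃, h₃, g₃, e₃⟩ := S.exists_common_sign (card_image_tuple hc) rfl
  rw [g₁, g₂, g₃, e₁, e₂, e₃, shift_eq_shS ha, shift_eq_shS hb, shift_eq_shS hc, tri3, gU, gU, gU]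
  simp only [smul_mul_assoc, mul_smul_comm, Matrix.trace_smul, smul_smul, smul_eq_mul]
  congr 1
  set x := shS (Finset.univ.image a)
  set y := shS (Finset.univ.image b)
  set z := shS (Finset.univ.image c)
  generalize (S.gS _ * S.gS _ * S.gS _).trace = t
  linear_combination (-(x * y * z * t) : ℝ) * (h₁ + ε₁ * ε₁ * h₂ + ε₁ * ε₁ * ε₂ * ε₂ * h₃)

theorem tri3_support {A B C : Finset (Fin 11)} (h : S.tri3 A B C ≠ 0) :
    C = A ∆ B ∨ C = (A ∆ B)ᶜ := by
  obtain ⟨ε, -, h1⟩ := S.gU_mul_gU A B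
  refine S.symmDiff_of_trace_ne_zero fun h0 => h ?_
  rw [tri3, h1, gU, smul_mul_smul_comm, Matrix.trace_smul, h0, smul_zero, zero_smul]

end MajoranaRep

/-! ### From sums over tuples to sums over sets -/

theorem card_injective_with_image {p : ℕ} {A : Finset (Fin 11)} (hA : A.card = p) :
    (Finset.univ.filter fun a : Fin p → Fin 11 =>
      Function.Injective a ∧ Finset.univ.image a = A).card = p.factorial := by
  subst hA
  have hc : (Finset.univ : Finset (Equiv.Perm (Fin A.card))).card = A.card.factorial := by
    rw [Finset.card_univ, Fintype.card_perm, Fintype.card_fin]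
  rw [← hc]
  symm
  refine Finset.card_bij (fun σ _ i => enum A (σ i)) ?_ ?_ ?_
  · intro σ _
    simp only [Finset.mem_filter_univ]
    refine ⟨(enum_injective A).comp σ.injective, ?_⟩
    conv_rhs => rw [← image_enum A]
    ext j
    simp only [Finset.mem_image, Finset.mem_univ, true_and]
    exact σ.exists_congr_left.trans (by simp)
  · intro σ _ τ _ h
    ext i
    exact congrArg Fin.val (enum_injective A (congrFun h i))
  · intro a ha
    simp only [Finset.mem_filter_univ] at ha
    obtain ⟨σ, rfl⟩ := exists_perm_enum ha.2
    exact ⟨σ, Finset.mem_univ _, rfl⟩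

/-- Every p-element set is the image of exactly p! injective tuples. All factorials that relate the
ansatz to sums over sets come from here. -/
theorem sum_tuple {M : Type*} [AddCommGroup M] [Module ℝ M] {p : ℕ} (f : (Fin p → Fin 11) → M)
    (F : Finset (Fin 11) → M) (h0 : ∀ a, ¬ Function.Injective a → f a = 0)
    (hF : ∀ a, Function.Injective a → f a = F (Finset.univ.image a)) :
    ∑ a, f a = (p.factorial : ℝ) • ∑ A ∈ idx p, F A := by
  classical
  rw [← Finset.sum_filter_of_ne (p := Function.Injective) fun a _ h => by
      by_contra h'; exact h (h0 a h'),
    ← Finset.sum_fiberwise_of_maps_to (t := idx p) (g := fun a => Finset.univ.image a)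
      fun a ha => mem_idx.2 (card_image_tuple (Finset.mem_filter_univ a |>.1 ha)), Finset.smul_sum]
  refine Finset.sum_congr rfl fun A hA => ?_
  rw [Finset.filter_filter, Nat.cast_smul_eq_nsmul, ← card_injective_with_image (mem_idx.1 hA)]
  refine Finset.sum_eq_card_nsmul ?_
  intro a ha
  rw [Finset.mem_filter_univ] at ha
  rw [hF a ha.1, ha.2]

theorem sum_index {M : Type*} [AddCommMonoid M] (f : Fin 11 → M) (F : Finset (Fin 11) → M)
    (hF : ∀ a, f a = F {a}) : ∑ a, f a = ∑ A ∈ idx 1, F A := by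
  rw [idx, Finset.powersetCard_one, Finset.sum_map]
  exact Finset.sum_congr rfl fun a _ => hF a

/-- Turns the support condition of a trace into arithmetic of cardinalities, which then excludes one
of the two alternatives by size or parity. -/
theorem card_eq_of_support {A B C : Finset (Fin 11)} (h : C = A ∆ B ∨ C = (A ∆ B)ᶜ) :
    C.card + 2 * (A ∩ B).card = A.card + B.card ∧ C = A ∆ B ∨
    11 + 2 * (A ∩ B).card = A.card + B.card + C.card ∧ C = (A ∆ B)ᶜ := by
  have h1 := card_symmDiff_add A B
  rcases h with rfl | rfl
  · exact Or.inl ⟨h1, rfl⟩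
  · refine Or.inr ⟨?_, rfl⟩
    have := Finset.card_add_card_compl (A ∆ B)
    rw [Fintype.card_fin] at this
    omega

/-! ### Index contractions as sums over all triples of index sets -/

section Reindex

set_option linter.constructorNameAsVariable false

variable {M : Type*} [AddCommMonoid M] {G : Finset (Fin 11) → Finset (Fin 11) → Finset (Fin 11) → M}

/-- The support forces A = B ∪ C with B, C disjoint. The complement alternative would require 11 +
2|A ∩ B| = 4. -/
theorem sum_reindex_211 (hG : ∀ A B C, G A B C ≠ 0 → C = A ∆ B ∨ C = (A ∆ B)ᶜ) :
    ∑ P ∈ idx 1, ∑ Q ∈ idx 1, (if Disjoint P Q then G (P ∪ Q) P Q else 0) =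
      ∑ A ∈ idx 2, ∑ B ∈ idx 1, ∑ C ∈ idx 1, G A B C := by
  have l : ∑ P ∈ idx 1, ∑ Q ∈ idx 1, (if Disjoint P Q then G (P ∪ Q) P Q else 0) =
      ∑ x ∈ (idx 1 ×ˢ idx 1).filter fun x => Disjoint x.1 x.2, G (x.1 ∪ x.2) x.1 x.2 := by
    rw [Finset.sum_filter, Finset.sum_product]
  have r : ∑ A ∈ idx 2, ∑ B ∈ idx 1, ∑ C ∈ idx 1, G A B C =
      ∑ y ∈ idx 2 ×ˢ idx 1 ×ˢ idx 1, G y.1 y.2.1 y.2.2 := by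
    simp only [Finset.sum_product]
  rw [l, r]
  refine Finset.sum_of_injOn (fun x => (x.1 ∪ x.2, x.1, x.2)) ?_ ?_ ?_ fun _ _ => rfl
  · rintro ⟨a, b⟩ - ⟨a', b'⟩ - h
    grind
  · rintro ⟨a, b⟩ h
    simp only [Finset.coe_filter, Finset.mem_product, mem_idx, Set.mem_ofPred_eq, Finset.coe_product, Set.mem_prod, Finset.mem_coe] at h ⊢
    rw [Finset.card_union_of_disjoint h.2]
    omega
  · rintro ⟨A, B, C⟩ hy hn
    by_contra h
    refine hn ?_
    simp only [Finset.mem_product, mem_idx] at hy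
    obtain ⟨hA, hB, hC⟩ := hy
    rcases card_eq_of_support (hG A B C h) with ⟨hc, hs⟩ | ⟨hc, hs⟩
    · have hi : A ∩ B = B := Finset.eq_of_subset_of_card_le Finset.inter_subset_right (by omega)
      clear hn h l r hG hc
      have h1 : A = B ∪ C := by
        subst hs; grind [Finset.mem_symmDiff]
      have h2 : Disjoint B C := by
        subst hs; rw [Finset.disjoint_left]; grind [Finset.mem_symmDiff]
      refine ⟨(B, C), ?_, by simp [h1]⟩
      simp [hB, hC, h2]
    · have := Finset.card_le_card (Finset.inter_subset_right : A ∩ B ⊆ B)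
      omega

theorem sum_reindex_222 (hG : ∀ A B C, G A B C ≠ 0 → C = A ∆ B ∨ C = (A ∆ B)ᶜ) :
    ∑ P ∈ idx 1, ∑ Q ∈ idx 1, ∑ R ∈ idx 1,
      (if Disjoint P Q ∧ Disjoint Q R ∧ Disjoint R P then G (P ∪ Q) (Q ∪ R) (R ∪ P) else 0) =
      ∑ A ∈ idx 2, ∑ B ∈ idx 2, ∑ C ∈ idx 2, G A B C := by
  have l : ∑ P ∈ idx 1, ∑ Q ∈ idx 1, ∑ R ∈ idx 1,
      (if Disjoint P Q ∧ Disjoint Q R ∧ Disjoint R P then G (P ∪ Q) (Q ∪ R) (R ∪ P) else 0) =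
      ∑ x ∈ (idx 1 ×ˢ idx 1 ×ˢ idx 1).filter fun x =>
        Disjoint x.1 x.2.1 ∧ Disjoint x.2.1 x.2.2 ∧ Disjoint x.2.2 x.1,
        G (x.1 ∪ x.2.1) (x.2.1 ∪ x.2.2) (x.2.2 ∪ x.1) := by
    simp only [Finset.sum_filter, Finset.sum_product]
  have r : ∑ A ∈ idx 2, ∑ B ∈ idx 2, ∑ C ∈ idx 2, G A B C =
      ∑ y ∈ idx 2 ×ˢ idx 2 ×ˢ idx 2, G y.1 y.2.1 y.2.2 := by
    simp only [Finset.sum_product]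
  rw [l, r]
  refine Finset.sum_of_injOn (fun x => (x.1 ∪ x.2.1, x.2.1 ∪ x.2.2, x.2.2 ∪ x.1)) ?_ ?_ ?_
    fun _ _ => rfl
  · rintro ⟨a, b, c⟩ h ⟨a', b', c'⟩ h' hx
    simp only [Finset.coe_filter, Set.mem_ofPred_eq, Finset.disjoint_left] at h h'
    simp only [Prod.mk.injEq, Finset.ext_iff, Finset.mem_union] at hx ⊢
    clear l r hG
    grind
  · rintro ⟨a, b, c⟩ h
    simp only [Finset.coe_filter, Finset.mem_product, mem_idx, Set.mem_ofPred_eq,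
      Finset.coe_product, Set.mem_prod, Finset.mem_coe] at h ⊢
    rw [Finset.card_union_of_disjoint h.2.1, Finset.card_union_of_disjoint h.2.2.1,
      Finset.card_union_of_disjoint h.2.2.2]
    omega
  · rintro ⟨A, B, C⟩ hy hn
    by_contra h
    refine hn ?_
    simp only [Finset.mem_product, mem_idx] at hy
    obtain ⟨hA, hB, hC⟩ := hy
    rcases card_eq_of_support (hG A B C h) with ⟨hc, hs⟩ | ⟨hc, hs⟩
    · have h1 := Finset.card_sdiff_add_card_inter A B
      have h2 := Finset.card_sdiff_add_card_inter B A
      rw [Finset.inter_comm] at h2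
      subst hs
      -- With C = A ∆ B, the three contracted blocks are the pairwise intersections of A, B and C.
      refine ⟨(A \ B, A ∩ B, B \ A), ?_, ?_⟩
      · simp only [Finset.coe_filter, Set.mem_ofPred_eq, Finset.mem_product, mem_idx,
          Finset.disjoint_left]
        refine ⟨by omega, ?_⟩
        clear hn h l r hG hc h1 h2 hA hB hC
        grind [Finset.mem_symmDiff, Finset.mem_compl]
      · simp only [Prod.mk.injEq]
        clear hn h l r hG hc h1 h2 hA hB hC
        simp only [Finset.ext_iff, Finset.mem_symmDiff, Finset.mem_union, Finset.mem_sdiff,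
          Finset.mem_inter]
        grind
    · have := Finset.card_le_card (Finset.inter_subset_right : A ∩ B ⊆ B)
      omega

/-- Same decomposition into pairwise intersections; the complement alternative 11 + 2|A ∩ B| = 12
fails by parity. -/
theorem sum_reindex_525 (hG : ∀ A B C, G A B C ≠ 0 → C = A ∆ B ∨ C = (A ∆ B)ᶜ) :
    ∑ P ∈ idx 4, ∑ Q ∈ idx 1, ∑ R ∈ idx 1,
      (if Disjoint P Q ∧ Disjoint Q R ∧ Disjoint R P then G (P ∪ Q) (Q ∪ R) (R ∪ P) else 0) =
      ∑ A ∈ idx 5, ∑ B ∈ idx 2, ∑ C ∈ idx 5, G A B C := by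
  have l : ∑ P ∈ idx 4, ∑ Q ∈ idx 1, ∑ R ∈ idx 1,
      (if Disjoint P Q ∧ Disjoint Q R ∧ Disjoint R P then G (P ∪ Q) (Q ∪ R) (R ∪ P) else 0) =
      ∑ x ∈ (idx 4 ×ˢ idx 1 ×ˢ idx 1).filter fun x =>
        Disjoint x.1 x.2.1 ∧ Disjoint x.2.1 x.2.2 ∧ Disjoint x.2.2 x.1,
        G (x.1 ∪ x.2.1) (x.2.1 ∪ x.2.2) (x.2.2 ∪ x.1) := by
    simp only [Finset.sum_filter, Finset.sum_product]
  have r : ∑ A ∈ idx 5, ∑ B ∈ idx 2, ∑ C ∈ idx 5, G A B C =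
      ∑ y ∈ idx 5 ×ˢ idx 2 ×ˢ idx 5, G y.1 y.2.1 y.2.2 := by
    simp only [Finset.sum_product]
  rw [l, r]
  refine Finset.sum_of_injOn (fun x => (x.1 ∪ x.2.1, x.2.1 ∪ x.2.2, x.2.2 ∪ x.1)) ?_ ?_ ?_
    fun _ _ => rfl
  · rintro ⟨a, b, c⟩ h ⟨a', b', c'⟩ h' hx
    simp only [Finset.coe_filter, Set.mem_ofPred_eq, Finset.disjoint_left] at h h'
    simp only [Prod.mk.injEq, Finset.ext_iff, Finset.mem_union] at hx ⊢
    clear l r hG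
    grind
  · rintro ⟨a, b, c⟩ h
    simp only [Finset.coe_filter, Finset.mem_product, mem_idx, Set.mem_ofPred_eq,
      Finset.coe_product, Set.mem_prod, Finset.mem_coe] at h ⊢
    rw [Finset.card_union_of_disjoint h.2.1, Finset.card_union_of_disjoint h.2.2.1,
      Finset.card_union_of_disjoint h.2.2.2]
    omega
  · rintro ⟨A, B, C⟩ hy hn
    by_contra h
    refine hn ?_
    simp only [Finset.mem_product, mem_idx] at hy
    obtain ⟨hA, hB, hC⟩ := hy
    rcases card_eq_of_support (hG A B C h) with ⟨hc, hs⟩ | ⟨hc, hs⟩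
    · have h1 := Finset.card_sdiff_add_card_inter A B
      have h2 := Finset.card_sdiff_add_card_inter B A
      rw [Finset.inter_comm] at h2
      subst hs
      refine ⟨(A \ B, A ∩ B, B \ A), ?_, ?_⟩
      · simp only [Finset.coe_filter, Set.mem_ofPred_eq, Finset.mem_product, mem_idx,
          Finset.disjoint_left]
        refine ⟨by omega, ?_⟩
        clear hn h l r hG hc h1 h2 hA hB hC
        grind [Finset.mem_symmDiff, Finset.mem_compl]
      · simp only [Prod.mk.injEq]
        clear hn h l r hG hc h1 h2 hA hB hC
        simp only [Finset.ext_iff, Finset.mem_symmDiff, Finset.mem_union, Finset.mem_sdiff,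
          Finset.mem_inter]
        grind
    · omega

/-- Here |A ∆ B| is even, so the five-element set C must be its complement, and then |A ∩ B| = 2.
The blocks A \ B, B \ A and C exhaust the eleven indices, as the ε symbol demands, and A ∩ B is the
contracted pair. -/
theorem sum_reindex_555 (hG : ∀ A B C, G A B C ≠ 0 → C = A ∆ B ∨ C = (A ∆ B)ᶜ) :
    ∑ A ∈ idx 3, ∑ B ∈ idx 3, ∑ C ∈ idx 5, ∑ D ∈ idx 2,
      (if (Disjoint A B ∧ Disjoint (A ∪ B) C) ∧ Disjoint A D ∧ Disjoint D B
        then G (A ∪ D) (D ∪ B) C else 0) =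
      ∑ A ∈ idx 5, ∑ B ∈ idx 5, ∑ C ∈ idx 5, G A B C := by
  have l : ∑ A ∈ idx 3, ∑ B ∈ idx 3, ∑ C ∈ idx 5, ∑ D ∈ idx 2,
      (if (Disjoint A B ∧ Disjoint (A ∪ B) C) ∧ Disjoint A D ∧ Disjoint D B
        then G (A ∪ D) (D ∪ B) C else 0) =
      ∑ x ∈ (idx 3 ×ˢ idx 3 ×ˢ idx 5 ×ˢ idx 2).filter fun x =>
        (Disjoint x.1 x.2.1 ∧ Disjoint (x.1 ∪ x.2.1) x.2.2.1) ∧ Disjoint x.1 x.2.2.2 ∧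
          Disjoint x.2.2.2 x.2.1,
        G (x.1 ∪ x.2.2.2) (x.2.2.2 ∪ x.2.1) x.2.2.1 := by
    simp only [Finset.sum_filter, Finset.sum_product]
  have r : ∑ A ∈ idx 5, ∑ B ∈ idx 5, ∑ C ∈ idx 5, G A B C =
      ∑ y ∈ idx 5 ×ˢ idx 5 ×ˢ idx 5, G y.1 y.2.1 y.2.2 := by
    simp only [Finset.sum_product]
  rw [l, r]
  refine Finset.sum_of_injOn (fun x => (x.1 ∪ x.2.2.2, x.2.2.2 ∪ x.2.1, x.2.2.1)) ?_ ?_ ?_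
    fun _ _ => rfl
  · rintro ⟨a, b, c, f⟩ h ⟨a', b', c', f'⟩ h' hx
    simp only [Finset.coe_filter, Set.mem_ofPred_eq, Finset.disjoint_left] at h h'
    simp only [Prod.mk.injEq, Finset.ext_iff, Finset.mem_union] at hx ⊢
    clear l r hG
    grind
  · rintro ⟨a, b, c, f⟩ h
    simp only [Finset.coe_filter, Finset.mem_product, mem_idx, Set.mem_ofPred_eq,
      Finset.coe_product, Set.mem_prod, Finset.mem_coe] at h ⊢
    rw [Finset.card_union_of_disjoint h.2.2.1, Finset.card_union_of_disjoint h.2.2.2]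
    omega
  · rintro ⟨A, B, C⟩ hy hn
    by_contra h
    refine hn ?_
    simp only [Finset.mem_product, mem_idx] at hy
    obtain ⟨hA, hB, hC⟩ := hy
    rcases card_eq_of_support (hG A B C h) with ⟨hc, hs⟩ | ⟨hc, hs⟩
    · omega
    · have h1 := Finset.card_sdiff_add_card_inter A B
      have h2 := Finset.card_sdiff_add_card_inter B A
      rw [Finset.inter_comm] at h2
      subst hs
      refine ⟨(A \ B, B \ A, (A ∆ B)ᶜ, A ∩ B), ?_, ?_⟩
      · simp only [Finset.coe_filter, Set.mem_ofPred_eq, Finset.mem_product, mem_idx,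
          Finset.disjoint_left]
        refine ⟨by omega, ?_⟩
        clear hn h l r hG hc h1 h2 hA hB hC
        grind [Finset.mem_symmDiff, Finset.mem_compl]
      · simp only [Prod.mk.injEq, and_true]
        clear hn h l r hG hc h1 h2 hA hB hC
        simp only [Finset.ext_iff, Finset.mem_union, Finset.mem_sdiff,
          Finset.mem_inter]
        grind

end Reindex

/-! ### The bosonic terms of the ansatz as Clifford traces -/

theorem injective_iff_card_image {p : ℕ} {a : Fin p → Fin 11} :
    Function.Injective a ↔ (Finset.univ.image a).card = p := by
  refine ⟨card_image_tuple, fun h => ?_⟩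
  have hc : (Finset.univ.image a).card = (Finset.univ : Finset (Fin p)).card := by
    rw [h]; simp
  simpa using Finset.card_image_iff.1 hc

theorem injective_iff_disjoint {p : ℕ} {t : Fin p → Fin 11} {A B : Finset (Fin 11)}
    (ht : Finset.univ.image t = A ∪ B) (hp : A.card + B.card = p) :
    Function.Injective t ↔ Disjoint A B := by
  rw [injective_iff_card_image, ht, ← hp, Finset.card_union_eq_card_add_card]

theorem levi_eq_zero {a : Fin 11 → Fin 11} (ha : ¬ Function.Injective a) : levi a = 0 := by
  simp only [Function.Injective, not_forall] at ha
  obtain ⟨i, j, hij, hne⟩ := ha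
  exact Matrix.det_zero_of_row_eq hne (funext fun k => by simp [hij])

theorem levi_perm (σ : Equiv.Perm (Fin 11)) : levi σ = ((Equiv.Perm.sign σ : ℤ) : ℝ) := by
  have h : (Matrix.of fun i j => if σ i = j then (1 : ℝ) else 0)
      = (1 : Matrix (Fin 11) (Fin 11) ℝ).submatrix σ id := by
    ext i j; simp [Matrix.one_apply]
  rw [levi, h, Matrix.det_permute, Matrix.det_one, mul_one]

namespace MajoranaRep

variable (S : MajoranaRep)

/-- The volume condition Γ_0⋯Γ_10 = 1 turns a product of eleven distinct letters into a value of the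
ε symbol, so that contractions with ε become traces. -/
theorem gT_eleven (a : Fin 11 → Fin 11) (ha : Function.Injective a) : S.gT a = levi a • 1 := by
  have hσ := (Finite.injective_iff_bijective).1 ha
  have h := S.gT_perm (a := id) Function.injective_id (Equiv.ofBijective a hσ)
  have h2 : S.gT (p := 11) id = 1 := S.volume
  rw [h2, ← levi_perm] at h
  exact h

theorem gT_mul_self {p : ℕ} {a : Fin p → Fin 11} (ha : Function.Injective a) :
    S.gT a * S.gT a = (kap p * shift a) • 1 := by
  obtain ⟨ε, hε, h, -⟩ := S.exists_common_sign (card_image_tuple ha) rfl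
  rw [h, smul_mul_smul_comm, hε, one_smul, gS_mul_self, card_image_tuple ha, shift_eq_shS ha]

/-- The trace of the product of three Clifford-valued `1`-forms. -/
noncomputable def trace3 (p q r : ℕ) : CE :=
  ∑ A ∈ idx p, ∑ B ∈ idx q, ∑ C ∈ idx r, S.tri3 A B C

theorem trace_smul_one (c : ℝ) : (c • (1 : Matrix (Fin 32) (Fin 32) ℝ)).trace = 32 * c := by
  rw [Matrix.trace_smul, Matrix.trace_one]
  simp [mul_comm]

/-- For a ≠ b, bringing the letters of Γ_a Γ_b Γ_a Γ_b together takes one exchange. This gives the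
minus sign, and 32 is the trace of the identity. -/
theorem termA0_eq : termA0 = (-(1 / 32) : ℝ) • S.trace3 2 1 1 := by
  have key : ∀ a b : Fin 11, e2 ![a, b] * e1 a * e1 b =
      if Disjoint ({a} : Finset (Fin 11)) {b} then
        (-(1 / 32) : ℝ) • S.tri3 ({a} ∪ {b}) {a} {b} else 0 := by
    intro a b
    have i1 : Finset.univ.image ![a, b] = {a} ∪ {b} := by
      ext x; simp [Fin.exists_fin_succ, eq_comm]
    have i2 : Function.Injective ![a, b] ↔ Disjoint ({a} : Finset (Fin 11)) {b} :=
      injective_iff_disjoint i1 (by simp)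
    split_ifs with h
    · have hab : a ≠ b := by simpa using h
      have := S.tri3_image (i2.2 h) (a := ![a, b]) (b := ![a]) (c := ![b])
        (Function.injective_of_subsingleton _) (Function.injective_of_subsingleton _)
      rw [i1] at this
      have i3 : ∀ a : Fin 11, Finset.univ.image ![a] = {a} := fun a => by ext x; simp [eq_comm]
      rw [i3, i3] at this
      have ht : S.gT ![a, b] * S.gT ![a] * S.gT ![b] = (-(mink a * mink b)) • 1 := by
        simp only [gT, List.ofFn_succ, List.ofFn_zero, List.prod_cons, List.prod_nil, mul_one,
          Matrix.cons_val_zero, Matrix.cons_val_succ]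
        rw [S.Γ_anticomm hab, neg_mul, neg_mul, mul_assoc (S.Γ b), Γ_mul_self, mul_smul_comm,
          mul_one, smul_mul_assoc, Γ_mul_self, smul_smul, neg_smul]
      rw [this, ht, trace_smul_one]
      simp only [eT, shift, Fin.prod_univ_succ, Fin.prod_univ_zero, smul_mul_assoc, mul_smul_comm,
        smul_smul, Matrix.cons_val_zero, Matrix.cons_val_succ]
      rw [eq_comm]
      convert one_smul ℝ _ using 2
      linear_combination ((mink a * mink a) ^ 2 * ((mink b * mink b) + 1) * (mink_mul_self b) + (mink a * mink a + 1) * mink_mul_self a)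
    · have : e2 ![a, b] = 0 := eT_eq_zero (p := 2) (mt i2.1 h)
      rw [this, zero_mul, zero_mul]
  unfold termA0
  rw [sum_index _ (fun A => ∑ B ∈ idx 1, if Disjoint A B then
    (-(1 / 32) : ℝ) • S.tri3 (A ∪ B) A B else 0) fun a => sum_index _ _ fun b => key a b]
  have h := sum_reindex_211 (G := fun A B C => (-(1 / 32) : ℝ) • S.tri3 A B C)
    fun A B C hG => S.tri3_support fun h0 => hG (by rw [h0, smul_zero])
  rw [h]
  simp only [trace3, Finset.smul_sum]

theorem image_single (a : Fin 11) : Finset.univ.image ![a] = {a} := by ext x; simp [eq_comm]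

theorem image_pair (a b : Fin 11) : Finset.univ.image ![a, b] = {a} ∪ {b} := by
  ext x; simp [Fin.exists_fin_succ, eq_comm]

theorem injective_pair {a b : Fin 11} :
    Function.Injective ![a, b] ↔ Disjoint ({a} : Finset (Fin 11)) {b} :=
  injective_iff_disjoint (image_pair a b) (by simp)

theorem termA1_eq : termA1 = (1 / 32 : ℝ) • S.trace3 2 2 2 := by
  have key : ∀ a b c : Fin 11,
      (mink a * mink b * mink c) • (e2 ![a, b] * e2 ![b, c] * e2 ![c, a]) =
      if Disjoint ({a} : Finset (Fin 11)) {b} ∧ Disjoint ({b} : Finset (Fin 11)) {c} ∧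
          Disjoint ({c} : Finset (Fin 11)) {a} then
        (1 / 32 : ℝ) • S.tri3 ({a} ∪ {b}) ({b} ∪ {c}) ({c} ∪ {a}) else 0 := by
    intro a b c
    split_ifs with h
    · have := S.tri3_image (injective_pair.2 h.1) (injective_pair.2 h.2.1)
        (injective_pair.2 h.2.2)
      rw [image_pair, image_pair, image_pair] at this
      have ht : S.gT ![a, b] * S.gT ![b, c] * S.gT ![c, a] = (mink a * mink b * mink c) • 1 := by
        simp only [gT, List.ofFn_succ, List.ofFn_zero, List.prod_cons, List.prod_nil, mul_one,
          Matrix.cons_val_zero, Matrix.cons_val_succ]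
        rw [mul_assoc (S.Γ a), ← mul_assoc (S.Γ b), Γ_mul_self, smul_mul_assoc, one_mul,
          mul_smul_comm, smul_mul_assoc, mul_assoc (S.Γ a), ← mul_assoc (S.Γ c), Γ_mul_self,
          smul_mul_assoc, one_mul, mul_smul_comm, Γ_mul_self, smul_smul, smul_smul]
        congr 1; ring
      rw [this, ht, trace_smul_one]
      simp only [eT, shift, Fin.prod_univ_succ, Fin.prod_univ_zero, smul_smul,
        Matrix.cons_val_zero, Matrix.cons_val_succ]
      congr 1
      linear_combination -(mink a * mink b * mink c) * ((mink b * mink b) *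
        (mink c * mink c) * mink_mul_self a + (mink c * mink c) * mink_mul_self b +
        mink_mul_self c)
    · have : e2 ![a, b] * e2 ![b, c] * e2 ![c, a] = 0 := by
        by_cases h1 : Disjoint ({a} : Finset (Fin 11)) {b}
        · by_cases h2 : Disjoint ({b} : Finset (Fin 11)) {c}
          · have : e2 ![c, a] = 0 :=
              eT_eq_zero (p := 2) (mt injective_pair.1 fun h3 => h ⟨h1, h2, h3⟩)
            rw [this, mul_zero]
          · have : e2 ![b, c] = 0 := eT_eq_zero (p := 2) (mt injective_pair.1 h2)
            rw [this, mul_zero, zero_mul]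
        · have : e2 ![a, b] = 0 := eT_eq_zero (p := 2) (mt injective_pair.1 h1)
          rw [this, zero_mul, zero_mul]
      rw [this, smul_zero]
  unfold termA1
  refine (sum_index _ (fun A => ∑ B ∈ idx 1, ∑ C ∈ idx 1,
    if Disjoint A B ∧ Disjoint B C ∧ Disjoint C A then
    (1 / 32 : ℝ) • S.tri3 (A ∪ B) (B ∪ C) (C ∪ A) else 0) fun a => sum_index _ (fun B => ∑ C ∈ idx 1,
    if Disjoint {a} B ∧ Disjoint B C ∧ Disjoint C {a} then
    (1 / 32 : ℝ) • S.tri3 ({a} ∪ B) (B ∪ C) (C ∪ {a}) else 0) fun b =>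
    sum_index _ _ fun c => key a b c).trans ?_
  have h := sum_reindex_222 (G := fun A B C => (1 / 32 : ℝ) • S.tri3 A B C)
    fun A B C hG => S.tri3_support fun h0 => hG (by rw [h0, smul_zero])
  rw [h]
  simp only [trace3, Finset.smul_sum]

theorem image_snoc (a : Fin 4 → Fin 11) (b : Fin 11) :
    Finset.univ.image ![a 0, a 1, a 2, a 3, b] = Finset.univ.image a ∪ {b} := by
  ext x; simp [Fin.exists_fin_succ, eq_comm]; tauto

theorem image_cons (a : Fin 4 → Fin 11) (b : Fin 11) :
    Finset.univ.image ![b, a 0, a 1, a 2, a 3] = {b} ∪ Finset.univ.image a := by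
  ext x; simp [Fin.exists_fin_succ, eq_comm]

/-- The factor 24 = 4! counts the orderings of the four contracted letters, whose product squares
with reversal sign +1. -/
theorem termA2_eq : termA2 = (24 / 32 : ℝ) • S.trace3 5 2 5 := by
  have key : ∀ a : Fin 4 → Fin 11, Function.Injective a → ∀ b c : Fin 11,
      (shift a * mink b * mink c) •
        (e5 ![a 0, a 1, a 2, a 3, b] * e2 ![b, c] * e5 ![c, a 0, a 1, a 2, a 3]) =
      if Disjoint (Finset.univ.image a) {b} ∧ Disjoint ({b} : Finset (Fin 11)) {c} ∧
          Disjoint ({c} : Finset (Fin 11)) (Finset.univ.image a) then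
        (1 / 32 : ℝ) • S.tri3 (Finset.univ.image a ∪ {b}) ({b} ∪ {c}) ({c} ∪ Finset.univ.image a)
      else 0 := by
    intro a ha b c
    have i1 : Function.Injective ![a 0, a 1, a 2, a 3, b] ↔
        Disjoint (Finset.univ.image a) {b} :=
      injective_iff_disjoint (image_snoc a b) (by rw [card_image_tuple ha]; rfl)
    have i2 : Function.Injective ![c, a 0, a 1, a 2, a 3] ↔
        Disjoint {c} (Finset.univ.image a) :=
      injective_iff_disjoint (image_cons a c) (by rw [card_image_tuple ha]; rfl)
    split_ifs with h
    · have := S.tri3_image (i1.2 h.1) (injective_pair.2 h.2.1) (i2.2 h.2.2)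
      rw [image_snoc, image_pair, image_cons] at this
      have g1 : S.gT ![a 0, a 1, a 2, a 3, b] = S.gT a * S.Γ b := by
        simp [gT, List.ofFn_succ, mul_assoc]
      have g2 : S.gT ![c, a 0, a 1, a 2, a 3] = S.Γ c * S.gT a := by
        simp [gT, List.ofFn_succ]
      have g3 : S.gT ![b, c] = S.Γ b * S.Γ c := by
        simp [gT, List.ofFn_succ]
      have ht : S.gT ![a 0, a 1, a 2, a 3, b] * S.gT ![b, c] * S.gT ![c, a 0, a 1, a 2, a 3] =
          (shift a * mink b * mink c) • 1 := by
        rw [g1, g2, g3]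
        calc S.gT a * S.Γ b * (S.Γ b * S.Γ c) * (S.Γ c * S.gT a)
            = S.gT a * ((S.Γ b * S.Γ b) * (S.Γ c * S.Γ c)) * S.gT a := by simp only [mul_assoc]
          _ = (mink b * mink c) • (S.gT a * S.gT a) := by
              rw [Γ_mul_self, Γ_mul_self, smul_mul_smul_comm, one_mul, mul_smul_comm, mul_one,
                smul_mul_assoc]
          _ = _ := by
              rw [gT_mul_self _ ha, smul_smul, kap]
              congr 1
              norm_num [Nat.choose]
              ring
      have s1 : shift ![a 0, a 1, a 2, a 3, b] = shift a * mink b := by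
        simp [shift, Fin.prod_univ_succ, mul_assoc]
      have s2 : shift ![c, a 0, a 1, a 2, a 3] = mink c * shift a := by
        simp [shift, Fin.prod_univ_succ]
      have s3 : shift ![b, c] = mink b * mink c := by
        simp [shift, Fin.prod_univ_succ]
      rw [this, ht, trace_smul_one, s1, s2, s3]
      simp only [eT, smul_smul]
      congr 1
      linear_combination -(shift a * mink b * mink c) * ((mink b * mink b) *
        (mink c * mink c) * shift_mul_self a + (mink c * mink c) * mink_mul_self b +
        mink_mul_self c)
    · have : e5 ![a 0, a 1, a 2, a 3, b] * e2 ![b, c] * e5 ![c, a 0, a 1, a 2, a 3] = 0 := by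
        by_cases h1 : Disjoint (Finset.univ.image a) {b}
        · by_cases h2 : Disjoint ({b} : Finset (Fin 11)) {c}
          · have : e5 ![c, a 0, a 1, a 2, a 3] = 0 :=
              eT_eq_zero (p := 5) (mt i2.1 fun h3 => h ⟨h1, h2, h3⟩)
            rw [this, mul_zero]
          · have : e2 ![b, c] = 0 := eT_eq_zero (p := 2) (mt injective_pair.1 h2)
            rw [this, mul_zero, zero_mul]
        · have : e5 ![a 0, a 1, a 2, a 3, b] = 0 := eT_eq_zero (p := 5) (mt i1.1 h1)
          rw [this, zero_mul, zero_mul]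
      rw [this, smul_zero]
  unfold termA2
  refine (sum_tuple _ (fun A => ∑ B ∈ idx 1, ∑ C ∈ idx 1,
    if Disjoint A B ∧ Disjoint B C ∧ Disjoint C A then
    (1 / 32 : ℝ) • S.tri3 (A ∪ B) (B ∪ C) (C ∪ A) else 0) ?_ fun a ha =>
    sum_index _ (fun B => ∑ C ∈ idx 1,
    if Disjoint (Finset.univ.image a) B ∧ Disjoint B C ∧ Disjoint C (Finset.univ.image a) then
    (1 / 32 : ℝ) • S.tri3 (Finset.univ.image a ∪ B) (B ∪ C) (C ∪ Finset.univ.image a)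
    else 0) fun b => sum_index _ _ fun c => key a ha b c).trans ?_
  · intro a ha
    refine Finset.sum_eq_zero fun b _ => Finset.sum_eq_zero fun c _ => ?_
    have h : e5 ![a 0, a 1, a 2, a 3, b] = 0 := by
      refine eT_eq_zero (p := 5) fun hi => ha ?_
      have := hi.comp (Fin.castSucc_injective 4)
      convert this using 1
      funext i; fin_cases i <;> rfl
    rw [h, zero_mul, zero_mul, smul_zero]
  · have h := sum_reindex_525 (G := fun A B C => (1 / 32 : ℝ) • S.tri3 A B C)
      fun A B C hG => S.tri3_support fun h0 => hG (by rw [h0, smul_zero])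
    rw [h]
    simp only [trace3, ← Finset.smul_sum, smul_smul]
    norm_num [Nat.factorial]

theorem image_eleven (a b : Fin 5 → Fin 11) (c : Fin 11) :
    Finset.univ.image ![a 0, a 1, a 2, a 3, a 4, b 0, b 1, b 2, b 3, b 4, c] =
      (Finset.univ.image a ∪ Finset.univ.image b) ∪ {c} := by
  ext x; simp [Fin.exists_fin_succ, eq_comm]; tauto

theorem disjoint_of_support {A B C : Finset (Fin 11)} (hA : A.card = 5) (hB : B.card = 5)
    (hC : C.card = 1) (h : C = A ∆ B ∨ C = (A ∆ B)ᶜ) :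
    Disjoint (A ∪ B) C ∧ (A ∪ B).card + C.card = 11 := by
  rcases card_eq_of_support h with ⟨h1, -⟩ | ⟨h1, hs⟩
  · omega
  · have h2 := Finset.card_union_add_card_inter A B
    have h0 : A ∩ B = ∅ := by rw [← Finset.card_eq_zero]; omega
    refine ⟨?_, by omega⟩
    rw [hs, (Finset.disjoint_iff_inter_eq_empty.2 h0).symmDiff_eq_sup]
    exact disjoint_compl_right

/-- The factor is 14400 = 5!·5!, one factorial for each five-index tuple. -/
theorem termA3_eq : termA3 = (14400 / 32 : ℝ) • S.trace3 5 5 1 := by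
  have key : ∀ a b : Fin 5 → Fin 11, Function.Injective a → Function.Injective b → ∀ c : Fin 11,
      (levi ![a 0, a 1, a 2, a 3, a 4, b 0, b 1, b 2, b 3, b 4, c] * shift a * shift b) •
        (e5 a * e5 b * e1 c) =
      (1 / 32 : ℝ) • S.tri3 (Finset.univ.image a) (Finset.univ.image b) {c} := by
    intro a b ha hb c
    by_cases hi : Function.Injective ![a 0, a 1, a 2, a 3, a 4, b 0, b 1, b 2, b 3, b 4, c]
    · have := S.tri3_image ha hb (c := ![c]) (Function.injective_of_subsingleton _)
      rw [image_single] at this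
      have ht : S.gT a * S.gT b * S.gT ![c] =
          levi ![a 0, a 1, a 2, a 3, a 4, b 0, b 1, b 2, b 3, b 4, c] • 1 := by
        rw [← S.gT_eleven _ hi]
        simp [gT, List.ofFn_succ, mul_assoc]
      rw [this, ht, trace_smul_one]
      simp only [eT, shift, Fin.prod_univ_one, mul_smul_comm, smul_smul, Matrix.cons_val_zero]
      congr 1
      linear_combination (-(levi ![a 0, a 1, a 2, a 3, a 4, b 0, b 1, b 2, b 3, b 4, c] *
        (∏ i, mink (a i)) * ∏ i, mink (b i))) * mink_mul_self c
    -- Where ε vanishes, the trace must vanish too: its support condition would make the eleven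
    -- indices distinct.
    · rw [levi_eq_zero hi, zero_mul, zero_mul, zero_smul]
      by_contra h
      have h1 := disjoint_of_support (card_image_tuple ha) (card_image_tuple hb)
        (Finset.card_singleton c) (S.tri3_support fun h0 => h (by rw [h0, smul_zero]))
      exact hi ((injective_iff_disjoint (image_eleven a b c) h1.2).2 h1.1)
  have h0 : ∀ a b : Fin 5 → Fin 11, ¬ (Function.Injective a ∧ Function.Injective b) → ∀ c,
      (levi ![a 0, a 1, a 2, a 3, a 4, b 0, b 1, b 2, b 3, b 4, c] * shift a * shift b) •
        (e5 a * e5 b * e1 c) = 0 := by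
    intro a b h c
    by_cases ha : Function.Injective a
    · have : e5 b = 0 := eT_eq_zero (p := 5) fun hb => h ⟨ha, hb⟩
      rw [this, mul_zero, zero_mul, smul_zero]
    · have : e5 a = 0 := eT_eq_zero (p := 5) ha
      rw [this, zero_mul, zero_mul, smul_zero]
  unfold termA3
  refine (sum_tuple _ (fun A => (Nat.factorial 5 : ℝ) • ∑ B ∈ idx 5, ∑ C ∈ idx 1,
    (1 / 32 : ℝ) • S.tri3 A B C) ?_ fun a ha => sum_tuple _ (fun B => ∑ C ∈ idx 1,
    (1 / 32 : ℝ) • S.tri3 (Finset.univ.image a) B C) ?_ fun b hb =>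
      sum_index _ _ fun c => key a b ha hb c).trans ?_
  · exact fun a ha => Finset.sum_eq_zero fun b _ => Finset.sum_eq_zero fun c _ =>
      h0 a b (fun h => ha h.1) c
  · exact fun b hb => Finset.sum_eq_zero fun c _ => h0 a b (fun h => hb h.2) c
  · simp only [trace3, ← Finset.smul_sum, smul_smul]
    norm_num [Nat.factorial]

theorem image_eleven' (a b : Fin 3 → Fin 11) (c : Fin 5 → Fin 11) :
    Finset.univ.image ![a 0, a 1, a 2, b 0, b 1, b 2, c 0, c 1, c 2, c 3, c 4] =
      (Finset.univ.image a ∪ Finset.univ.image b) ∪ Finset.univ.image c := by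
  ext x; simp [Fin.exists_fin_succ, eq_comm, or_assoc]

theorem image_three_two (a : Fin 3 → Fin 11) (f : Fin 2 → Fin 11) :
    Finset.univ.image ![a 0, a 1, a 2, f 0, f 1] = Finset.univ.image a ∪ Finset.univ.image f := by
  ext x; simp [Fin.exists_fin_succ, eq_comm, or_assoc]

theorem image_two_three (a : Fin 3 → Fin 11) (f : Fin 2 → Fin 11) :
    Finset.univ.image ![f 0, f 1, a 0, a 1, a 2] = Finset.univ.image f ∪ Finset.univ.image a := by
  ext x; simp [Fin.exists_fin_succ, eq_comm, or_assoc]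

/-- The factor is 8640 = 3!·3!·5!·2!. The minus sign comes from the square of the two-letter product
of the contracted indices. -/
theorem termA4_eq : termA4 = (-(8640 / 32) : ℝ) • S.trace3 5 5 5 := by
  have key : ∀ (a b : Fin 3 → Fin 11) (c : Fin 5 → Fin 11) (f : Fin 2 → Fin 11),
      Function.Injective a → Function.Injective b → Function.Injective c →
      Function.Injective f →
      (levi ![a 0, a 1, a 2, b 0, b 1, b 2, c 0, c 1, c 2, c 3, c 4]
        * shift a * shift b * shift c * shift f) •
        (e5 ![a 0, a 1, a 2, f 0, f 1] * e5 ![f 0, f 1, b 0, b 1, b 2] * e5 c) =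
      if (Disjoint (Finset.univ.image a) (Finset.univ.image b) ∧
          Disjoint (Finset.univ.image a ∪ Finset.univ.image b) (Finset.univ.image c)) ∧
          Disjoint (Finset.univ.image a) (Finset.univ.image f) ∧
          Disjoint (Finset.univ.image f) (Finset.univ.image b) then
      (-(1 / 32) : ℝ) • S.tri3 (Finset.univ.image a ∪ Finset.univ.image f)
        (Finset.univ.image f ∪ Finset.univ.image b) (Finset.univ.image c) else 0 := by
    intro a b c f ha hb hc hf
    have ca := card_image_tuple ha
    have cb := card_image_tuple hb
    have cc := card_image_tuple hc
    have cf := card_image_tuple hf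
    have i1 : Function.Injective ![a 0, a 1, a 2, f 0, f 1] ↔ _ :=
      injective_iff_disjoint (image_three_two a f) (by omega)
    have i2 : Function.Injective ![f 0, f 1, b 0, b 1, b 2] ↔ _ :=
      injective_iff_disjoint (image_two_three b f) (by omega)
    have i3 : Function.Injective ![a 0, a 1, a 2, b 0, b 1, b 2, c 0, c 1, c 2, c 3, c 4] ↔
        Disjoint (Finset.univ.image a) (Finset.univ.image b) ∧
        Disjoint (Finset.univ.image a ∪ Finset.univ.image b) (Finset.univ.image c) := by
      rw [injective_iff_card_image, image_eleven', ← Finset.card_union_eq_card_add_card,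
        ← Finset.card_union_eq_card_add_card]
      have h1 := Finset.card_union_le (Finset.univ.image a) (Finset.univ.image b)
      have h2 := Finset.card_union_le (Finset.univ.image a ∪ Finset.univ.image b)
        (Finset.univ.image c)
      omega
    split_ifs with h
    · have := S.tri3_image (i1.2 h.2.1) (i2.2 h.2.2) hc
      rw [image_three_two, image_two_three] at this
      have g1 : S.gT ![a 0, a 1, a 2, f 0, f 1] = S.gT a * S.gT f := by
        simp [gT, List.ofFn_succ, mul_assoc]
      have g2 : S.gT ![f 0, f 1, b 0, b 1, b 2] = S.gT f * S.gT b := by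
        simp [gT, List.ofFn_succ, mul_assoc]
      have ht : S.gT ![a 0, a 1, a 2, f 0, f 1] * S.gT ![f 0, f 1, b 0, b 1, b 2] * S.gT c =
          (-(shift f * levi ![a 0, a 1, a 2, b 0, b 1, b 2, c 0, c 1, c 2, c 3, c 4])) • 1 := by
        rw [g1, g2]
        calc S.gT a * S.gT f * (S.gT f * S.gT b) * S.gT c
            = S.gT a * ((S.gT f * S.gT f) * (S.gT b * S.gT c)) := by simp only [mul_assoc]
          _ = (-shift f) • (S.gT a * S.gT b * S.gT c) := by
              rw [gT_mul_self _ hf, kap, smul_mul_assoc, one_mul, mul_smul_comm, mul_assoc]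
              simp
          _ = (-shift f) • S.gT ![a 0, a 1, a 2, b 0, b 1, b 2, c 0, c 1, c 2, c 3, c 4] := by
              simp [gT, List.ofFn_succ, mul_assoc]
          _ = _ := by rw [S.gT_eleven _ (i3.2 h.1), smul_smul, neg_mul]
      have s1 : shift ![a 0, a 1, a 2, f 0, f 1] = shift a * shift f := by
        simp [shift, Fin.prod_univ_succ, mul_assoc]
      have s2 : shift ![f 0, f 1, b 0, b 1, b 2] = shift f * shift b := by
        simp [shift, Fin.prod_univ_succ, mul_assoc]
      rw [this, ht, trace_smul_one, s1, s2]
      simp only [eT, smul_smul]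
      congr 1
      linear_combination (-(levi ![a 0, a 1, a 2, b 0, b 1, b 2, c 0, c 1, c 2, c 3, c 4] *
        shift a * shift b * shift c * shift f)) * shift_mul_self f
    · by_cases h1 : Function.Injective ![a 0, a 1, a 2, b 0, b 1, b 2, c 0, c 1, c 2, c 3, c 4]
      · have h2 : e5 ![a 0, a 1, a 2, f 0, f 1] * e5 ![f 0, f 1, b 0, b 1, b 2] = 0 := by
          by_cases h2 : Disjoint (Finset.univ.image a) (Finset.univ.image f)
          · have : e5 ![f 0, f 1, b 0, b 1, b 2] = 0 :=
              eT_eq_zero (p := 5) (mt i2.1 fun h3 => h ⟨i3.1 h1, h2, h3⟩)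
            rw [this, mul_zero]
          · have : e5 ![a 0, a 1, a 2, f 0, f 1] = 0 := eT_eq_zero (p := 5) (mt i1.1 h2)
            rw [this, zero_mul]
        rw [h2, zero_mul, smul_zero]
      · rw [levi_eq_zero h1]
        simp
  have h0 : ∀ (a b : Fin 3 → Fin 11) (c : Fin 5 → Fin 11) (f : Fin 2 → Fin 11),
      ¬ (Function.Injective a ∧ Function.Injective b ∧ Function.Injective c ∧
        Function.Injective f) →
      (levi ![a 0, a 1, a 2, b 0, b 1, b 2, c 0, c 1, c 2, c 3, c 4]
        * shift a * shift b * shift c * shift f) •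
        (e5 ![a 0, a 1, a 2, f 0, f 1] * e5 ![f 0, f 1, b 0, b 1, b 2] * e5 c) = 0 := by
    intro a b c f h
    by_cases h1 : Function.Injective ![a 0, a 1, a 2, f 0, f 1]
    · by_cases h2 : Function.Injective ![f 0, f 1, b 0, b 1, b 2]
      · by_cases h3 : Function.Injective c
        · refine absurd ⟨?_, ?_, h3, ?_⟩ h
          · convert h1.comp (Fin.castAdd_injective 3 2) using 1
            funext i; fin_cases i <;> rfl
          · convert h2.comp (Fin.natAdd_injective 3 2) using 1
            funext i; fin_cases i <;> rfl
          · convert h2.comp (Fin.castAdd_injective 2 3) using 1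
            funext i; fin_cases i <;> rfl
        · have : e5 c = 0 := eT_eq_zero (p := 5) h3
          rw [this, mul_zero, smul_zero]
      · have : e5 ![f 0, f 1, b 0, b 1, b 2] = 0 := eT_eq_zero (p := 5) h2
        rw [this, mul_zero, zero_mul, smul_zero]
    · have : e5 ![a 0, a 1, a 2, f 0, f 1] = 0 := eT_eq_zero (p := 5) h1
      rw [this, zero_mul, zero_mul, smul_zero]
  have h := sum_reindex_555 (G := fun A B C => (-(1 / 32) : ℝ) • S.tri3 A B C)
    fun A B C hG => S.tri3_support fun h0 => hG (by rw [h0, smul_zero])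
  let F : Finset (Fin 11) → Finset (Fin 11) → Finset (Fin 11) → Finset (Fin 11) → CE :=
    fun A B C D => if (Disjoint A B ∧ Disjoint (A ∪ B) C) ∧ Disjoint A D ∧ Disjoint D B
        then (-(1 / 32) : ℝ) • S.tri3 (A ∪ D) (D ∪ B) C else 0
  unfold termA4
  refine (sum_tuple _ (fun A => (Nat.factorial 3 : ℝ) • ∑ B ∈ idx 3, (Nat.factorial 5 : ℝ) •
    ∑ C ∈ idx 5, (Nat.factorial 2 : ℝ) • ∑ D ∈ idx 2, F A B C D) ?_ fun a ha =>
    sum_tuple _ (fun B => (Nat.factorial 5 : ℝ) •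
    ∑ C ∈ idx 5, (Nat.factorial 2 : ℝ) • ∑ D ∈ idx 2, F (Finset.univ.image a) B C D) ?_
    fun b hb => sum_tuple _ (fun C => (Nat.factorial 2 : ℝ) • ∑ D ∈ idx 2,
      F (Finset.univ.image a) (Finset.univ.image b) C D) ?_
    fun c hc => sum_tuple _ (fun D =>
      F (Finset.univ.image a) (Finset.univ.image b) (Finset.univ.image c) D) ?_
    fun f hf => key a b c f ha hb hc hf).trans ?_
  · exact fun a ha => Finset.sum_eq_zero fun b _ => Finset.sum_eq_zero fun c _ =>
      Finset.sum_eq_zero fun f _ => h0 a b c f fun h => ha h.1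
  · exact fun b hb => Finset.sum_eq_zero fun c _ =>
      Finset.sum_eq_zero fun f _ => h0 a b c f fun h => hb h.2.1
  · exact fun c hc => Finset.sum_eq_zero fun f _ => h0 a b c f fun h => hc h.2.2.1
  · exact fun f hf => h0 a b c f fun h => hf h.2.2.2
  · simp only [← Finset.smul_sum, smul_smul, F]
    rw [h]
    simp only [trace3, ← Finset.smul_sum, smul_smul]
    norm_num [Nat.factorial]

end MajoranaRep

/-! ### The differential of the ansatz -/

theorem eT_eq_smul_gen (p : ℕ) (a : Fin p → Fin 11) :
    ∃ (c : ℝ) (x : Gen), x.sdeg = 0 ∧ eT p a = c • gen x := by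
  match p with
  | 1 => exact ⟨_, .e1 (a 0), rfl, rfl⟩
  | 2 => exact ⟨1, .e2 a, rfl, (one_smul _ _).symm⟩
  | 5 => exact ⟨1, .e5 a, rfl, (one_smul _ _).symm⟩
  | 0 => exact ⟨0, .e1 0, rfl, (zero_smul _ _).symm⟩
  | 3 => exact ⟨0, .e1 0, rfl, (zero_smul _ _).symm⟩
  | 4 => exact ⟨0, .e1 0, rfl, (zero_smul _ _).symm⟩
  | n + 6 => exact ⟨0, .e1 0, rfl, (zero_smul _ _).symm⟩

theorem parity_eS (A : Finset (Fin 11)) : parity (eS A) = -eS A := by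
  obtain ⟨c, x, -, h⟩ := eT_eq_smul_gen A.card (enum A)
  rw [eS, h, map_smul, parity_gen, smul_neg]

theorem eS_mul_eS (A B : Finset (Fin 11)) : eS A * eS B = -(eS B * eS A) := by
  obtain ⟨c, x, hx, h⟩ := eT_eq_smul_gen A.card (enum A)
  obtain ⟨c', y, hy, h'⟩ := eT_eq_smul_gen B.card (enum B)
  rw [eS, h, eS, h', smul_mul_smul_comm, smul_mul_smul_comm, gen_comm, hx, hy]
  simp [mul_comm]

theorem sum_rotate {ι κ M : Type*} [AddCommMonoid M] {s : Finset ι} {t u : Finset κ}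
    (f : ι → κ → κ → M) :
    ∑ a ∈ s, ∑ b ∈ t, ∑ c ∈ u, f a b c = ∑ b ∈ t, ∑ c ∈ u, ∑ a ∈ s, f a b c := by
  rw [Finset.sum_comm]
  exact Finset.sum_congr rfl fun b _ => Finset.sum_comm

namespace MajoranaRep

variable (S : MajoranaRep)

/-- `psiPsi` as a linear map. -/
noncomputable def qL : Matrix (Fin 32) (Fin 32) ℝ →ₗ[ℝ] CE where
  toFun := psiPsi S
  map_add' M N := by
    simp [psiPsi, mul_add, add_smul, Finset.sum_add_distrib]
  map_smul' := psiPsi_smul S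

/-- `psiPhi` as a linear map. -/
noncomputable def pL : Matrix (Fin 32) (Fin 32) ℝ →ₗ[ℝ] CE where
  toFun := psiPhi S
  map_add' M N := by
    simp [psiPhi, mul_add, add_smul, Finset.sum_add_distrib]
  map_smul' c M := by
    simp [psiPhi, Finset.smul_sum, smul_smul]

/-- `actPsi` as a linear map. -/
noncomputable def aL (α : Fin 32) : Matrix (Fin 32) (Fin 32) ℝ →ₗ[ℝ] CE where
  toFun M := actPsi M α
  map_add' M N := by
    simp [actPsi, add_smul, Finset.sum_add_distrib]
  map_smul' c M := by
    simp [actPsi, Finset.smul_sum, smul_smul]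

theorem aL_apply (α : Fin 32) (M : Matrix (Fin 32) (Fin 32) ℝ) : aL α M = actPsi M α := rfl

theorem qL_mul_eS (M : Matrix (Fin 32) (Fin 32) ℝ) (A : Finset (Fin 11)) :
    S.qL M * eS A = eS A * S.qL M := by
  obtain ⟨c, x, -, h⟩ := eT_eq_smul_gen A.card (enum A)
  have h1 : psiPsi S M * gen x = ((-1 : ℝ) ^ (0 * x.sdeg)) • (gen x * psiPsi S M) :=
    psiPsi_mem S M x
  rw [zero_mul, pow_zero, one_smul] at h1
  rw [eS, h, mul_smul_comm, smul_mul_assoc]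
  exact congrArg (c • ·) h1

/-- An arbitrary linear map of Γ_A is allowed, to serve both the terms (ψ̄ Γ_A φ) e^A and the
components of Γ^A ψ e_A in dφ. -/
theorem sum_tuple_linear (f : Matrix (Fin 32) (Fin 32) ℝ →ₗ[ℝ] CE) (p : ℕ) :
    ∑ a : Fin p → Fin 11, shift a • (f (S.gam a) * eT p a) =
      (p.factorial : ℝ) • ∑ A ∈ idx p, f (S.gU A) * eS A := by
  refine sum_tuple _ _ (fun a ha => ?_) fun a ha => ?_
  · rw [eT_eq_zero ha, mul_zero, smul_zero]
  · obtain ⟨ε, hε, g, e⟩ := S.exists_common_sign (card_image_tuple ha) rfl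
    rw [S.gam_eq_gT ha, g, e, gU, ← shift_eq_shS ha, map_smul, map_smul, smul_mul_smul_comm, hε,
      one_smul, smul_mul_assoc]

theorem sum_index_linear (f : Matrix (Fin 32) (Fin 32) ℝ →ₗ[ℝ] CE) :
    ∑ a : Fin 11, f (S.Γ a) * e1 a = ∑ A ∈ idx 1, f (S.gU A) * eS A := by
  refine sum_index _ _ fun a => ?_
  rw [gU, gS_singleton, eS_singleton, map_smul, smul_mul_smul_comm, shS, Finset.prod_singleton,
    mink_mul_self, one_smul]

/-- The `2`-forms `∑ (ψ̄ Γ_A φ) e^A` over sets of `p` indices. -/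
noncomputable def betaForm (p : ℕ) : CE := ∑ A ∈ idx p, S.pL (S.gU A) * eS A

theorem termB1_eq : termB1 S = S.betaForm 1 := S.sum_index_linear S.pL

theorem termB2_eq : termB2 S = (2 : ℝ) • S.betaForm 2 := by
  have := S.sum_tuple_linear S.pL 2
  norm_num [Nat.factorial] at this
  exact this

theorem termB3_eq : termB3 S = (120 : ℝ) • S.betaForm 5 := by
  have := S.sum_tuple_linear S.pL 5
  norm_num [Nat.factorial] at this
  exact this

theorem d_phi (s : ℝ) (α : Fin 32) :
    d S s (phi α) = (2 * (1 + s)) • (∑ A ∈ idx 1, aL α (S.gU A) * eS A)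
      + (2 : ℝ) • (∑ A ∈ idx 2, aL α (S.gU A) * eS A)
      + (2 * (1 + s / 6)) • (∑ A ∈ idx 5, aL α (S.gU A) * eS A) := by
  have h1 := S.sum_index_linear (aL α)
  have h2 := S.sum_tuple_linear (aL α) 2
  have h5 := S.sum_tuple_linear (aL α) 5
  have h : dGen S s (.phi α) = coefDelta s • (∑ a, aL α (S.Γ a) * e1 a) +
    coefGamma1 s • (∑ a : Fin 2 → Fin 11, shift a • (aL α (S.gam a) * eT 2 a)) +
    coefGamma2 s • (∑ a : Fin 5 → Fin 11, shift a • (aL α (S.gam a) * eT 5 a)) := by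
    simp only [dGen, aL_apply, eT]
  rw [phi, d_gen, h, h1, h2, h5, smul_smul, smul_smul, coefDelta]
  -- The factorials of the sums over tuples normalise the coefficients to 2 and 2(1 + s/6).
  have e1 : coefGamma1 s * (Nat.factorial 2 : ℝ) = 2 := by simp [coefGamma1, Nat.factorial]
  have e2 : coefGamma2 s * (Nat.factorial 5 : ℝ) = 2 * (1 + s / 6) := by
    norm_num [coefGamma2, Nat.factorial]
    ring
  rw [e1, e2]

/-- The signs +, -, + of the differential in degrees 1, 2, 5 are exactly the reversal signs `kap`.
The same signs occur in `proj`, so the three degrees can be treated uniformly. -/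
theorem d_eS (s : ℝ) {A : Finset (Fin 11)} (hA : A.card = 1 ∨ A.card = 2 ∨ A.card = 5) :
    d S s (eS A) = kap A.card • S.qL (S.gS A) := by
  have key : ∀ (p : ℕ) (a : Fin p → Fin 11), p = 1 ∨ p = 2 ∨ p = 5 → Function.Injective a →
      d S s (eT p a) = kap p • S.qL (S.gT a) := by
    rintro p a (rfl | rfl | rfl) ha
    · have h1 : S.gT a = S.Γ (a 0) := by simp [gT]
      have := d_gen S s (.e1 (a 0))
      change d S s (e1 (a 0)) = mink (a 0) • S.qL (S.Γ (a 0)) at this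
      rw [eT, map_smul, this, smul_smul, mink_mul_self, h1]
      simp [kap]
    · have := d_gen S s (.e2 a)
      rw [← S.gam_eq_gT ha]
      simp only [kap, Nat.choose_self, pow_one, neg_smul, one_smul]
      exact this
    · have := d_gen S s (.e5 a)
      rw [← S.gam_eq_gT ha]
      have h : kap 5 = 1 := by norm_num [kap, Nat.choose]
      rw [h, one_smul]
      exact this
  exact key _ _ hA (enum_injective A)

theorem d_eS_mul (s : ℝ) {A B C : Finset (Fin 11)} (hA : A.card = 1 ∨ A.card = 2 ∨ A.card = 5)
    (hB : B.card = 1 ∨ B.card = 2 ∨ B.card = 5) (hC : C.card = 1 ∨ C.card = 2 ∨ C.card = 5) :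
    d S s (eS A * eS B * eS C) = kap A.card • (S.qL (S.gS A) * (eS B * eS C))
      + kap B.card • (S.qL (S.gS B) * (eS C * eS A))
      + kap C.card • (S.qL (S.gS C) * (eS A * eS B)) := by
  rw [d_mul, d_mul, map_mul, parity_eS, parity_eS, S.d_eS s hA, S.d_eS s hB, S.d_eS s hC,
    neg_mul_neg, eS_mul_eS C A]
  simp only [mul_smul_comm, smul_mul_assoc, add_mul, neg_mul, mul_neg, smul_neg]
  rw [mul_assoc, ← S.qL_mul_eS _ A, mul_assoc, mul_assoc, ← S.qL_mul_eS _ B, ← mul_assoc (eS A),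
    ← S.qL_mul_eS _ A, mul_assoc]

/-- The sum of `(ψ̄ P_p(Γ^B Γ^C) ψ) e_B e_C`, where `P_p` is `proj p`. -/
noncomputable def rForm (p q r : ℕ) : CE :=
  ∑ B ∈ idx q, ∑ C ∈ idx r, S.qL (S.proj p (S.gU B * S.gU C)) * (eS B * eS C)

theorem rForm_eq (p q r : ℕ) : S.rForm p q r = ∑ A ∈ idx p, ∑ B ∈ idx q, ∑ C ∈ idx r,
    (kap A.card * (S.gU A * S.gU B * S.gU C).trace) • (S.qL (S.gS A) * (eS B * eS C)) := by
  have : ∀ B C : Finset (Fin 11), S.qL (S.proj p (S.gU B * S.gU C)) * (eS B * eS C) =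
      ∑ A ∈ idx p, (kap A.card * (S.gU A * S.gU B * S.gU C).trace) •
        (S.qL (S.gS A) * (eS B * eS C)) := by
    intro B C
    rw [proj, map_sum, Finset.sum_mul]
    refine Finset.sum_congr rfl fun A hA => ?_
    rw [map_smul, smul_mul_assoc, mem_idx.1 hA, mul_assoc (S.gU A)]
  simp only [rForm, this]
  exact (sum_rotate _).symm

/-- The Leibniz rule has a cyclic form without signs (`d_eS_mul`), since moving one e past two
others is even. The trace is cyclic as well, so all three terms have the same shape. -/
theorem d_trace3 (s : ℝ) {p q r : ℕ} (hp : p = 1 ∨ p = 2 ∨ p = 5) (hq : q = 1 ∨ q = 2 ∨ q = 5)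
    (hr : r = 1 ∨ r = 2 ∨ r = 5) :
    d S s (S.trace3 p q r) = S.rForm p q r + S.rForm q r p + S.rForm r p q := by
  have e2 : S.rForm q r p = ∑ A ∈ idx p, ∑ B ∈ idx q, ∑ C ∈ idx r,
      (kap B.card * (S.gU A * S.gU B * S.gU C).trace) • (S.qL (S.gS B) * (eS C * eS A)) := by
    rw [rForm_eq, sum_rotate (s := idx p)]
    refine Finset.sum_congr rfl fun B _ => Finset.sum_congr rfl fun C _ =>
      Finset.sum_congr rfl fun A _ => ?_
    rw [Matrix.trace_mul_cycle]
  have e3 : S.rForm r p q = ∑ A ∈ idx p, ∑ B ∈ idx q, ∑ C ∈ idx r,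
      (kap C.card * (S.gU A * S.gU B * S.gU C).trace) • (S.qL (S.gS C) * (eS A * eS B)) := by
    rw [rForm_eq, ← sum_rotate (s := idx r)]
    refine Finset.sum_congr rfl fun C _ => Finset.sum_congr rfl fun A _ =>
      Finset.sum_congr rfl fun B _ => ?_
    rw [Matrix.trace_mul_cycle, Matrix.trace_mul_cycle]
  rw [e2, e3, rForm_eq, trace3]
  simp only [map_sum, ← Finset.sum_add_distrib]
  refine Finset.sum_congr rfl fun A hA => Finset.sum_congr rfl fun B hB =>
    Finset.sum_congr rfl fun C hC => ?_
  rw [mem_idx] at hA hB hC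
  rw [tri3, map_smul, d_eS_mul S s (hA ▸ hp) (hB ▸ hq) (hC ▸ hr)]
  simp only [smul_add, smul_smul, mul_comm]

/-! ### Antisymmetry and the sectors of the differential -/

theorem transpose_eta_mul_gS {A : Finset (Fin 11)}
    (hA : A.card = 1 ∨ A.card = 2 ∨ A.card = 5) : (S.η * S.gS A)ᵀ = S.η * S.gS A := by
  have h := S.transpose_gS_mul A
  have hs : ((-1 : ℝ) ^ A.card * kap A.card) = -1 := by
    rcases hA with h | h | h <;> norm_num [h, kap, Nat.choose]
  rw [hs, neg_one_smul] at h
  rw [Matrix.transpose_mul, S.skew, Matrix.mul_neg, h, neg_neg]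

theorem transpose_eta_mul_gU {A : Finset (Fin 11)}
    (hA : A.card = 1 ∨ A.card = 2 ∨ A.card = 5) : (S.η * S.gU A)ᵀ = S.η * S.gU A := by
  rw [gU, mul_smul_comm, Matrix.transpose_smul, S.transpose_eta_mul_gS hA]

theorem transpose_eta_mul_mul {M N : Matrix (Fin 32) (Fin 32) ℝ} (hM : (S.η * M)ᵀ = S.η * M)
    (hN : (S.η * N)ᵀ = S.η * N) : (S.η * (M * N))ᵀ = -(S.η * (N * M)) := by
  rw [← mul_assoc, Matrix.transpose_mul, hM, ← mul_assoc]
  have : Nᵀ * S.η = -(S.η * N) := by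
    rw [Matrix.transpose_mul, S.skew, Matrix.mul_neg] at hN
    rw [← hN, neg_neg]
  rw [this, neg_mul, mul_assoc]

theorem psi_mul_psi (α β : Fin 32) : psi α * psi β = psi β * psi α := by
  change gen _ * gen _ = gen _ * gen _
  simpa [Gen.sdeg] using gen_comm (.psi α) (.psi β)

theorem qL_transpose {M N : Matrix (Fin 32) (Fin 32) ℝ} (h : (S.η * M)ᵀ = S.η * N) :
    S.qL M = S.qL N := by
  change psiPsi S M = psiPsi S N
  rw [psiPsi, psiPsi, Finset.sum_comm, ← h]
  simp only [Matrix.transpose_apply]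
  exact Finset.sum_congr rfl fun β _ => Finset.sum_congr rfl fun α _ => by rw [psi_mul_psi]

theorem qL_mul_anticomm {A B : Finset (Fin 11)} (hA : A.card = 1 ∨ A.card = 2 ∨ A.card = 5)
    (hB : B.card = 1 ∨ B.card = 2 ∨ B.card = 5) :
    S.qL (S.gU A * S.gU B) = -S.qL (S.gU B * S.gU A) := by
  rw [← map_neg]
  refine S.qL_transpose ?_
  rw [S.transpose_eta_mul_mul (S.transpose_eta_mul_gU hA) (S.transpose_eta_mul_gU hB), mul_neg]

theorem gU_comm_gU (A B : Finset (Fin 11)) :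
    S.gU A * S.gU B = ((-1 : ℝ) ^ (A.card * B.card + (A ∩ B).card)) • (S.gU B * S.gU A) := by
  rw [gU, gU, smul_mul_smul_comm, smul_mul_smul_comm, gS_comm_gS, smul_smul, smul_smul]
  congr 1
  ring

/-- The bilinear is antisymmetric under exchange of A and B because the components of ψ commute and
ηΓ^A, ηΓ^B are symmetric while η is skew. If Γ_A and Γ_B commute, it equals its own negative. -/
theorem qL_mul_eq_zero {A B : Finset (Fin 11)} (hA : A.card = 1 ∨ A.card = 2 ∨ A.card = 5)
    (hB : B.card = 1 ∨ B.card = 2 ∨ B.card = 5) (h : Even (A.card * B.card + (A ∩ B).card)) :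
    S.qL (S.gU A * S.gU B) = 0 := by
  have h1 := S.qL_mul_anticomm hA hB
  have h2 := S.gU_comm_gU A B
  rw [h.neg_one_pow, one_smul] at h2
  rw [← h2] at h1
  have h3 : (2 : ℝ) • S.qL (S.gU A * S.gU B) = 0 := by
    rw [two_smul]; nth_rewrite 1 [h1]; exact neg_add_cancel _
  exact (smul_eq_zero_iff_right two_ne_zero).1 h3

/-- The sum of `(ψ̄ Γ^B Γ^C ψ) e_B e_C` over sets of `q` and `r` indices, `k` of them in common. -/
noncomputable def nForm (q r k : ℕ) : CE :=
  ∑ B ∈ idx q, ∑ C ∈ idx r,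
    if (B ∩ C).card = k then S.qL (S.gU B * S.gU C) * (eS B * eS C) else 0

/-- The bilinear in ψ and the product of the two e's both change sign under the exchange. -/
theorem nForm_symm {q r : ℕ} (k : ℕ) (hq : q = 1 ∨ q = 2 ∨ q = 5) (hr : r = 1 ∨ r = 2 ∨ r = 5) :
    S.nForm q r k = S.nForm r q k := by
  rw [nForm, Finset.sum_comm]
  refine Finset.sum_congr rfl fun C hC => Finset.sum_congr rfl fun B hB => ?_
  rw [mem_idx] at hB hC
  rw [S.qL_mul_anticomm (hB ▸ hq) (hC ▸ hr), eS_mul_eS B C, neg_mul_neg, Finset.inter_comm]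

theorem sum_pairs_eq_nForm {q r : ℕ} (k : ℕ) (hq : q = 1 ∨ q = 2 ∨ q = 5)
    (hr : r = 1 ∨ r = 2 ∨ r = 5)
    (hk : ∀ j, j ≤ q → j ≤ r → (q * r + j) % 2 = 1 → j = k) :
    ∑ B ∈ idx q, ∑ C ∈ idx r, S.qL (S.gU B * S.gU C) * (eS B * eS C) = S.nForm q r k := by
  refine Finset.sum_congr rfl fun B hB => Finset.sum_congr rfl fun C hC => ?_
  rw [mem_idx] at hB hC
  split_ifs with h
  · rfl
  · have h1 := Finset.card_le_card (Finset.inter_subset_left : B ∩ C ⊆ B)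
    have h2 := Finset.card_le_card (Finset.inter_subset_right : B ∩ C ⊆ C)
    rw [S.qL_mul_eq_zero (hB ▸ hq) (hC ▸ hr), zero_mul]
    rw [Nat.even_iff, hB, hC]
    by_contra h3
    exact h (hk _ (hB ▸ h1) (hC ▸ h2) (by omega))

/-- Without a projection every even intersection size survives, so β₃ couples to three sectors at
once, whereas α₂, α₃ and α₄ each reach only one of them. -/
theorem sum_pairs_five :
    ∑ B ∈ idx 5, ∑ C ∈ idx 5, S.qL (S.gU B * S.gU C) * (eS B * eS C) =
      S.nForm 5 5 0 + S.nForm 5 5 2 + S.nForm 5 5 4 := by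
  simp only [nForm, ← Finset.sum_add_distrib]
  refine Finset.sum_congr rfl fun B hB => Finset.sum_congr rfl fun C hC => ?_
  rw [mem_idx] at hB hC
  have h1 := Finset.card_le_card (Finset.inter_subset_left : B ∩ C ⊆ B)
  rw [hB] at h1
  by_cases h : Even (B.card * C.card + (B ∩ C).card)
  · rw [S.qL_mul_eq_zero (by simp [hB]) (by simp [hC]) h]
    simp
  · rw [Nat.even_iff, hB, hC] at h
    have : (B ∩ C).card = 0 ∨ (B ∩ C).card = 2 ∨ (B ∩ C).card = 4 := by omega
    rcases this with h | h | h <;> simp [h]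

/-- By `hk`, among the intersection sizes j with surviving bilinear, the degree m = q + r - 2j is p
or 11 - p precisely for j = k. There the projection is multiplication by 32, elsewhere it is 0. -/
theorem rForm_eq_nForm {p q r : ℕ} (k : ℕ) (hq : q = 1 ∨ q = 2 ∨ q = 5)
    (hr : r = 1 ∨ r = 2 ∨ r = 5)
    (hk : ∀ m j, m + 2 * j = q + r → j ≤ q → j ≤ r → (q * r + j) % 2 = 1 →
      (j = k ↔ m = p ∨ m + p = 11)) :
    S.rForm p q r = (32 : ℝ) • S.nForm q r k := by
  simp only [rForm, nForm, Finset.smul_sum]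
  refine Finset.sum_congr rfl fun B hB => Finset.sum_congr rfl fun C hC => ?_
  rw [mem_idx] at hB hC
  rw [proj_gU_mul_gU]
  by_cases h : Even (B.card * C.card + (B ∩ C).card)
  · have h0 := S.qL_mul_eq_zero (hB ▸ hq) (hC ▸ hr) h
    split_ifs <;> simp [h0]
  · have h1 := Finset.card_le_card (Finset.inter_subset_left : B ∩ C ⊆ B)
    have h2 := Finset.card_le_card (Finset.inter_subset_right : B ∩ C ⊆ C)
    have h3 := card_symmDiff_add B C
    rw [Nat.even_iff, hB, hC] at h
    rw [hB] at h1
    rw [hC] at h2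
    rw [hB, hC] at h3
    have := hk _ _ h3 h1 h2 (by omega)
    simp only [← this]
    split_ifs
    · rw [map_smul, smul_mul_assoc]
    · rw [map_zero, zero_mul, smul_zero]

/-- The part of the differential of `betaForm p` that is cubic in `ψ`. -/
noncomputable def cubicForm (p : ℕ) : CE :=
  ∑ A ∈ idx p, kap p • (S.pL (S.gU A) * S.qL (S.gS A))

theorem parity_pL (M : Matrix (Fin 32) (Fin 32) ℝ) : parity (S.pL M) = S.pL M := by
  change parity (psiPhi S M) = psiPhi S M
  simp [psiPhi, psi, phi, parity_gen]

theorem psiPsi_mul (M N : Matrix (Fin 32) (Fin 32) ℝ) :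
    ∑ α, ∑ β, ((S.η * M) α β) • (psi α * aL β N) = S.qL (M * N) := by
  change _ = psiPsi S (M * N)
  simp only [psiPsi, aL_apply, actPsi, Finset.mul_sum, Finset.smul_sum, mul_smul_comm, smul_smul,
    ← mul_assoc S.η, Matrix.mul_apply (M := S.η * M), Finset.sum_smul]
  exact Finset.sum_congr rfl fun α _ => Finset.sum_comm

theorem d_pL (s : ℝ) (M : Matrix (Fin 32) (Fin 32) ℝ) :
    d S s (S.pL M) = -((2 * (1 + s)) • (∑ B ∈ idx 1, S.qL (M * S.gU B) * eS B)
      + (2 : ℝ) • (∑ B ∈ idx 2, S.qL (M * S.gU B) * eS B)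
      + (2 * (1 + s / 6)) • (∑ B ∈ idx 5, S.qL (M * S.gU B) * eS B)) := by
  -- The inner sums are hidden behind an opaque X, so that the final rearrangement does not expand
  -- them.
  have key : ∀ p, ∃ X : Fin 32 → CE, (∀ β, ∑ B ∈ idx p, aL β (S.gU B) * eS B = X β) ∧
      ∑ B ∈ idx p, S.qL (M * S.gU B) * eS B = ∑ α, ∑ β, ((S.η * M) α β) • (psi α * X β) := by
    intro p
    refine ⟨_, fun β => rfl, ?_⟩
    simp only [← psiPsi_mul, Finset.sum_mul, Finset.mul_sum, Finset.smul_sum]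
    rw [sum_rotate]
    simp only [smul_mul_assoc, mul_assoc]
  obtain ⟨X₁, h₁, k₁⟩ := key 1
  obtain ⟨X₂, h₂, k₂⟩ := key 2
  obtain ⟨X₅, h₅, k₅⟩ := key 5
  change d S s (psiPhi S M) = _
  have h : ∀ α β, d S s (psi α * phi β) = -(psi α * d S s (phi β)) := by
    intro α β
    have h2 : d S s (psi α) = 0 := d_gen S s (.psi α)
    have h3 : parity (psi α) = -psi α := parity_gen (.psi α)
    rw [d_mul, h2, h3, zero_mul, zero_add, neg_mul]
  simp only [psiPhi, map_sum, map_smul, h, d_phi, h₁, h₂, h₅, k₁, k₂, k₅]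
  generalize 2 * (1 + s) = c
  generalize 2 * (1 + s / 6) = c'
  simp only [mul_add, smul_add, Finset.sum_add_distrib, smul_neg, Finset.sum_neg_distrib,
    mul_smul_comm, Finset.smul_sum, smul_comm ((S.η * M) _ _)]

theorem d_betaForm (s : ℝ) {p : ℕ} (hp : p = 1 ∨ p = 2 ∨ p = 5) :
    d S s (S.betaForm p) =
      (2 * (1 + s)) • (∑ A ∈ idx p, ∑ B ∈ idx 1, S.qL (S.gU A * S.gU B) * (eS A * eS B))
      + (2 : ℝ) • (∑ A ∈ idx p, ∑ B ∈ idx 2, S.qL (S.gU A * S.gU B) * (eS A * eS B))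
      + (2 * (1 + s / 6)) • (∑ A ∈ idx p, ∑ B ∈ idx 5, S.qL (S.gU A * S.gU B) * (eS A * eS B))
      + S.cubicForm p := by
  simp only [betaForm, cubicForm, map_sum, Finset.smul_sum, ← Finset.sum_add_distrib]
  refine Finset.sum_congr rfl fun A hA => ?_
  rw [mem_idx] at hA
  -- The sign from reordering e_B e_A cancels the one that d picks up in passing ψ.
  have h : ∀ q, (∑ B ∈ idx q, S.qL (S.gU A * S.gU B) * eS B) * eS A =
      -∑ B ∈ idx q, S.qL (S.gU A * S.gU B) * (eS A * eS B) := by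
    intro q
    rw [Finset.sum_mul, ← Finset.sum_neg_distrib]
    refine Finset.sum_congr rfl fun B _ => ?_
    rw [mul_assoc, eS_mul_eS B A, mul_neg]
  rw [d_mul, parity_pL, S.d_eS s (hA ▸ hp), d_pL, neg_mul, add_mul, add_mul, smul_mul_assoc,
    smul_mul_assoc, smul_mul_assoc, h, h, h, hA]
  simp only [Finset.smul_sum, smul_neg, neg_add, neg_neg, mul_smul_comm]

theorem d_trace3_211 (s : ℝ) : d S s (S.trace3 2 1 1) =
    (32 : ℝ) • S.nForm 1 1 0 + (64 : ℝ) • S.nForm 1 2 1 := by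
  rw [S.d_trace3 s (by simp) (by simp) (by simp),
    S.rForm_eq_nForm (p := 2) (q := 1) (r := 1) 0 (by simp) (by simp) (by intros; omega),
    S.rForm_eq_nForm (p := 1) (q := 1) (r := 2) 1 (by simp) (by simp) (by intros; omega),
    S.rForm_eq_nForm (p := 1) (q := 2) (r := 1) 1 (by simp) (by simp) (by intros; omega),
    S.nForm_symm (q := 2) (r := 1) 1 (by simp) (by simp)]
  module

theorem d_trace3_222 (s : ℝ) : d S s (S.trace3 2 2 2) = (96 : ℝ) • S.nForm 2 2 1 := by
  rw [S.d_trace3 s (by simp) (by simp) (by simp),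
    S.rForm_eq_nForm (p := 2) (q := 2) (r := 2) 1 (by simp) (by simp) (by intros; omega)]
  module

theorem d_trace3_525 (s : ℝ) : d S s (S.trace3 5 2 5) =
    (64 : ℝ) • S.nForm 2 5 1 + (32 : ℝ) • S.nForm 5 5 4 := by
  rw [S.d_trace3 s (by simp) (by simp) (by simp),
    S.rForm_eq_nForm (p := 5) (q := 2) (r := 5) 1 (by simp) (by simp) (by intros; omega),
    S.rForm_eq_nForm (p := 2) (q := 5) (r := 5) 4 (by simp) (by simp) (by intros; omega),
    S.rForm_eq_nForm (p := 5) (q := 5) (r := 2) 1 (by simp) (by simp) (by intros; omega),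
    S.nForm_symm (q := 5) (r := 2) 1 (by simp) (by simp)]
  module

theorem d_trace3_551 (s : ℝ) : d S s (S.trace3 5 5 1) =
    (64 : ℝ) • S.nForm 1 5 0 + (32 : ℝ) • S.nForm 5 5 0 := by
  rw [S.d_trace3 s (by simp) (by simp) (by simp),
    S.rForm_eq_nForm (p := 5) (q := 5) (r := 1) 0 (by simp) (by simp) (by intros; omega),
    S.rForm_eq_nForm (p := 5) (q := 1) (r := 5) 0 (by simp) (by simp) (by intros; omega),
    S.rForm_eq_nForm (p := 1) (q := 5) (r := 5) 0 (by simp) (by simp) (by intros; omega),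
    S.nForm_symm (q := 5) (r := 1) 0 (by simp) (by simp)]
  module

theorem d_trace3_555 (s : ℝ) : d S s (S.trace3 5 5 5) = (96 : ℝ) • S.nForm 5 5 2 := by
  rw [S.d_trace3 s (by simp) (by simp) (by simp),
    S.rForm_eq_nForm (p := 5) (q := 5) (r := 5) 2 (by simp) (by simp) (by intros; omega)]
  module

theorem d_betaForm_one (s : ℝ) : d S s (S.betaForm 1) =
    (2 * (1 + s)) • S.nForm 1 1 0 + (2 : ℝ) • S.nForm 1 2 1 + (2 * (1 + s / 6)) • S.nForm 1 5 0
      + S.cubicForm 1 := by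
  rw [S.d_betaForm s (by simp),
    S.sum_pairs_eq_nForm (q := 1) (r := 1) 0 (by simp) (by simp) (by intros; omega),
    S.sum_pairs_eq_nForm (q := 1) (r := 2) 1 (by simp) (by simp) (by intros; omega),
    S.sum_pairs_eq_nForm (q := 1) (r := 5) 0 (by simp) (by simp) (by intros; omega)]

theorem d_betaForm_two (s : ℝ) : d S s (S.betaForm 2) =
    (2 * (1 + s)) • S.nForm 1 2 1 + (2 : ℝ) • S.nForm 2 2 1 + (2 * (1 + s / 6)) • S.nForm 2 5 1
      + S.cubicForm 2 := by
  rw [S.d_betaForm s (by simp),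
    S.sum_pairs_eq_nForm (q := 2) (r := 1) 1 (by simp) (by simp) (by intros; omega),
    S.sum_pairs_eq_nForm (q := 2) (r := 2) 1 (by simp) (by simp) (by intros; omega),
    S.sum_pairs_eq_nForm (q := 2) (r := 5) 1 (by simp) (by simp) (by intros; omega),
    S.nForm_symm (q := 2) (r := 1) 1 (by simp) (by simp)]

theorem d_betaForm_five (s : ℝ) : d S s (S.betaForm 5) =
    (2 * (1 + s)) • S.nForm 1 5 0 + (2 : ℝ) • S.nForm 2 5 1
      + (2 * (1 + s / 6)) • (S.nForm 5 5 0 + S.nForm 5 5 2 + S.nForm 5 5 4)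
      + S.cubicForm 5 := by
  rw [S.d_betaForm s (by simp),
    S.sum_pairs_eq_nForm (q := 5) (r := 1) 0 (by simp) (by simp) (by intros; omega),
    S.sum_pairs_eq_nForm (q := 5) (r := 2) 1 (by simp) (by simp) (by intros; omega),
    S.sum_pairs_five, S.nForm_symm (q := 5) (r := 1) 0 (by simp) (by simp),
    S.nForm_symm (q := 5) (r := 2) 1 (by simp) (by simp)]

/-- The differential of the ansatz, sorted by the exterior monomials in the bosonic generators. -/
theorem d_ansatz (s : ℝ) (c : Params) : d S s (ansatz S c) =
    (-c.1 0 + 2 * (1 + s) * c.2 0) • S.nForm 1 1 0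
    + (-2 * c.1 0 + 2 * c.2 0 + 4 * (1 + s) * c.2 1) • S.nForm 1 2 1
    + (3 * c.1 1 + 4 * c.2 1) • S.nForm 2 2 1
    + (28800 * c.1 3 + 2 * (1 + s / 6) * c.2 0 + 240 * (1 + s) * c.2 2) • S.nForm 1 5 0
    + (48 * c.1 2 + 4 * (1 + s / 6) * c.2 1 + 240 * c.2 2) • S.nForm 2 5 1
    + (14400 * c.1 3 + 240 * (1 + s / 6) * c.2 2) • S.nForm 5 5 0
    + (-25920 * c.1 4 + 240 * (1 + s / 6) * c.2 2) • S.nForm 5 5 2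
    + (24 * c.1 2 + 240 * (1 + s / 6) * c.2 2) • S.nForm 5 5 4
    + (c.2 0 • S.cubicForm 1 + (2 * c.2 1) • S.cubicForm 2 + (120 * c.2 2) • S.cubicForm 5) := by
  change d S s (c.1 0 • termA0 + c.1 1 • termA1 + c.1 2 • termA2 + c.1 3 • termA3
    + c.1 4 • termA4 + c.2 0 • termB1 S + c.2 1 • termB2 S + c.2 2 • termB3 S) = _
  rw [S.termA0_eq, S.termA1_eq, S.termA2_eq, S.termA3_eq, S.termA4_eq, S.termB1_eq, S.termB2_eq,
    S.termB3_eq]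
  simp only [map_add, map_smul, d_trace3_211, d_trace3_222, d_trace3_525, d_trace3_551,
    d_trace3_555, d_betaForm_one, d_betaForm_two, d_betaForm_five]
  module

end MajoranaRep

/-! ### Completeness of the Clifford products and the cubic Fierz identity -/

theorem card_sets_le_five : Fintype.card {A : Finset (Fin 11) // A.card ≤ 5} = 1024 := by
  have h : (Finset.univ.filter fun A : Finset (Fin 11) => A.card ≤ 5)
      = (Finset.range 6).biUnion idx := by
    ext A
    simp only [Finset.mem_filter_univ, Finset.mem_biUnion, Finset.mem_range, mem_idx]
    exact ⟨fun h => ⟨_, Nat.lt_succ_of_le h, rfl⟩, fun ⟨p, hp, h⟩ => h ▸ Nat.le_of_lt_succ hp⟩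
  rw [Fintype.card_subtype, h, Finset.card_biUnion]
  · simp only [Finset.card_powersetCard, Finset.card_univ, Fintype.card_fin]
    rfl
  · intro p _ q _ hpq
    refine Finset.disjoint_left.2 fun A hA hA' => ?_
    exact hpq ((mem_idx.1 hA).symm.trans (mem_idx.1 hA'))

theorem psi_mul_phi (α β : Fin 32) : psi α * phi β = phi β * psi α := by
  change gen _ * gen _ = gen _ * gen _
  simpa [Gen.sdeg] using gen_comm (.psi α) (.phi β)

namespace MajoranaRep

variable (S : MajoranaRep)

/-- `proj` as a linear map. -/
noncomputable def projL (p : ℕ) :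
    Matrix (Fin 32) (Fin 32) ℝ →ₗ[ℝ] Matrix (Fin 32) (Fin 32) ℝ where
  toFun := S.proj p
  map_add' X Y := by
    simp [proj, mul_add, add_smul, Finset.sum_add_distrib]
  map_smul' := S.proj_smul p

/-- Trace orthogonality. The bound |A| ≤ 5 selects one set from each complementary pair, as
complementary products are proportional; there are 1024 = 32² such sets, hence a basis in `span_gS`.
-/
theorem linearIndependent_gS :
    LinearIndependent ℝ fun A : {A : Finset (Fin 11) // A.card ≤ 5} => S.gS A := by
  rw [Fintype.linearIndependent_iff]
  intro g hg B
  have h := congrArg (fun X => (S.gU B * X).trace) hg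
  simp only [Finset.mul_sum, Matrix.trace_sum, mul_smul_comm, Matrix.trace_smul, mul_zero,
    Matrix.trace_zero] at h
  rw [Finset.sum_eq_single_of_mem B (Finset.mem_univ _), trace_gU_mul_gS_self] at h
  · have h1 : (32 * kap B.1.card) ≠ 0 := by simp [kap]
    exact (smul_eq_zero.1 h).resolve_right h1
  · intro A _ hAB
    have h1 : (S.gS B * S.gS A).trace = 0 := by
      by_contra h
      rcases S.symmDiff_of_trace_ne_zero h with h | h
      · exact hAB (Subtype.ext h)
      · have := congrArg Finset.card h
        rw [Finset.card_compl, Fintype.card_fin] at this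
        have := A.2
        have := B.2
        omega
    rw [gU, smul_mul_assoc, Matrix.trace_smul, h1, smul_zero, smul_zero]

theorem span_gS :
    Submodule.span ℝ (Set.range fun A : {A : Finset (Fin 11) // A.card ≤ 5} => S.gS A) = ⊤ := by
  refine S.linearIndependent_gS.span_eq_top_of_card_eq_finrank' ?_
  rw [card_sets_le_five, Module.finrank_matrix]
  simp

/-- Completeness of the Clifford products. -/
theorem sum_proj (X : Matrix (Fin 32) (Fin 32) ℝ) :
    ∑ p ∈ Finset.range 6, S.proj p X = (32 : ℝ) • X := by
  have h : ∑ p ∈ Finset.range 6, S.projL p = (32 : ℝ) • LinearMap.id := by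
    refine LinearMap.ext_on_range S.span_gS fun A => ?_
    rw [LinearMap.sum_apply, LinearMap.smul_apply, LinearMap.id_apply]
    have hA := A.2
    rw [Finset.sum_eq_single_of_mem A.1.card (by simp; omega)]
    · exact S.proj_gS_self A
    · intro p hp hpA
      rw [Finset.mem_range] at hp
      have h1 : ¬ (A.1.card = p ∨ A.1.card + p = 11) := by omega
      exact (S.proj_gS A.1).trans (if_neg h1)
  have := LinearMap.congr_fun h X
  rw [LinearMap.sum_apply] at this
  exact this

theorem qL_eq_zero_of_skew {M : Matrix (Fin 32) (Fin 32) ℝ} (h : (S.η * M)ᵀ = -(S.η * M)) :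
    S.qL M = 0 := by
  have h1 := S.qL_transpose (N := -M) (by rw [h, mul_neg])
  rw [map_neg] at h1
  have h3 : (2 : ℝ) • S.qL M = 0 := by
    rw [two_smul]; nth_rewrite 1 [h1]; exact neg_add_cancel _
  exact (smul_eq_zero_iff_right two_ne_zero).1 h3

theorem qL_gS_eq_zero {A : Finset (Fin 11)} (hA : A.card = 0 ∨ A.card = 3 ∨ A.card = 4) :
    S.qL (S.gS A) = 0 := by
  refine S.qL_eq_zero_of_skew ?_
  have h := S.transpose_gS_mul A
  have hs : ((-1 : ℝ) ^ A.card * kap A.card) = 1 := by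
    rcases hA with h | h | h <;> norm_num [h, kap, Nat.choose]
  rw [hs, one_smul] at h
  rw [Matrix.transpose_mul, S.skew, Matrix.mul_neg, h]

/-- Degrees 0, 3 and 4 contribute nothing because there ηΓ_A is skew. Adding them makes completeness
applicable. -/
theorem sum_cubicForm_eq : S.cubicForm 1 + S.cubicForm 2 + S.cubicForm 5 =
    ∑ p ∈ Finset.range 6, S.cubicForm p := by
  have h : ∀ p, p = 0 ∨ p = 3 ∨ p = 4 → S.cubicForm p = 0 := fun p hp =>
    Finset.sum_eq_zero fun A hA => by
      rw [S.qL_gS_eq_zero ((mem_idx.1 hA).symm ▸ hp), mul_zero, smul_zero]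
  simp [Finset.sum_range_succ, h 0, h 3, h 4]

theorem entry_eq_trace (M : Matrix (Fin 32) (Fin 32) ℝ) (α β : Fin 32) :
    (S.η * M) α β = (M * (Matrix.single β α 1 * S.η)).trace := by
  rw [Matrix.trace_mul_comm, mul_assoc, Matrix.trace_single_mul, one_smul]

/-- An entry of ηΓ^A is a trace against a matrix unit times η, so summing over A applies `proj` to
that matrix. -/
theorem cubicForm_eq (p : ℕ) : S.cubicForm p =
    ∑ α, ∑ β, (psi α * phi β) * S.qL (S.proj p (Matrix.single β α 1 * S.η)) := by
  have h : ∀ A, S.pL (S.gU A) * S.qL (S.gS A) = ∑ α, ∑ β,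
      (psi α * phi β) * (S.η * S.gU A) α β • S.qL (S.gS A) := by
    intro A
    change psiPhi S (S.gU A) * _ = _
    simp only [psiPhi, Finset.sum_mul, smul_mul_assoc, mul_smul_comm]
  simp only [cubicForm, h, proj, map_sum, map_smul, Finset.mul_sum, Finset.smul_sum]
  rw [sum_rotate]
  refine Finset.sum_congr rfl fun α _ => Finset.sum_congr rfl fun β _ =>
    Finset.sum_congr rfl fun A _ => ?_
  rw [entry_eq_trace, mul_smul_comm, mul_smul_comm, smul_smul]

/-- The cubic Fierz identity. -/
theorem sum_cubicForm : S.cubicForm 1 + S.cubicForm 2 + S.cubicForm 5 = 0 := by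
  have h1 : S.qL 1 = 0 := S.qL_eq_zero_of_skew (by rw [mul_one, S.skew])
  -- A matrix unit times η has rank one, so its quadratic form in ψ factors.
  have h2 : ∀ α β, S.qL (Matrix.single β α 1 * S.η) =
      (∑ γ, S.η γ β • psi γ) * ∑ δ, S.η α δ • psi δ := by
    intro α β
    change psiPsi S _ = _
    rw [psiPsi, Finset.sum_mul_sum]
    refine Finset.sum_congr rfl fun γ _ => Finset.sum_congr rfl fun δ _ => ?_
    rw [smul_mul_smul_comm, ← mul_assoc]
    congr 1
    rw [Matrix.mul_apply, Finset.sum_eq_single_of_mem α (Finset.mem_univ _)]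
    · simp
    · intro j _ hj
      rw [Matrix.mul_single_apply_of_ne (hbj := hj), zero_mul]
  have h3 : S.qL 1 = ∑ α, psi α * ∑ δ, S.η α δ • psi δ := by
    change psiPsi S _ = _
    simp only [psiPsi, mul_one, Finset.mul_sum, mul_smul_comm]
  rw [sum_cubicForm_eq]
  simp only [cubicForm_eq]
  rw [sum_rotate]
  simp only [← Finset.mul_sum, ← map_sum, sum_proj, map_smul, h2]
  rw [Finset.sum_comm]
  have h4 : ∀ α β, psi α * phi β * ((32 : ℝ) • ((∑ γ, S.η γ β • psi γ) * ∑ δ, S.η α δ • psi δ)) =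
      ((32 : ℝ) • (phi β * ∑ γ, S.η γ β • psi γ)) * (psi α * ∑ δ, S.η α δ • psi δ) := by
    intro α β
    have h5 : psi α * (∑ γ, S.η γ β • psi γ) = (∑ γ, S.η γ β • psi γ) * psi α := by
      simp only [Finset.mul_sum, Finset.sum_mul, mul_smul_comm, smul_mul_assoc, psi_mul_psi α]
    rw [mul_smul_comm, smul_mul_assoc, psi_mul_phi, mul_assoc, ← mul_assoc (psi α), h5]
    simp only [mul_assoc]
  -- The sum over α reassembles (ψ̄ψ), which is zero because η is skew and the components of ψ
  -- commute.
  simp only [h4, ← Finset.mul_sum, ← h3, h1, mul_zero, Finset.sum_const_zero]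

end MajoranaRep

/-! ### Evaluation of the Chevalley-Eilenberg algebra in a matrix algebra -/

/-- Multiplication by the first generator of the exterior algebra of `ℝ²`. -/
def extX : Matrix (Fin 4) (Fin 4) ℝ := !![0, 0, 0, 0; 1, 0, 0, 0; 0, 0, 0, 0; 0, 0, 1, 0]

/-- Multiplication by the second generator of the exterior algebra of `ℝ²`. -/
def extY : Matrix (Fin 4) (Fin 4) ℝ := !![0, 0, 0, 0; 0, 0, 0, 0; 1, 0, 0, 0; 0, -1, 0, 0]

/-- The parity of the exterior algebra of `ℝ²`. -/
def extT : Matrix (Fin 4) (Fin 4) ℝ := !![1, 0, 0, 0; 0, -1, 0, 0; 0, 0, -1, 0; 0, 0, 0, 1]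

theorem extX_mul_extX : extX * extX = 0 := by
  ext i j; fin_cases i <;> fin_cases j <;> simp [extX, Matrix.mul_apply, Fin.sum_univ_four]

theorem extY_mul_extY : extY * extY = 0 := by
  ext i j; fin_cases i <;> fin_cases j <;> simp [extY, Matrix.mul_apply, Fin.sum_univ_four]

theorem extT_mul_extT : extT * extT = 1 := by
  ext i j; fin_cases i <;> fin_cases j <;> simp [extT, Matrix.mul_apply, Fin.sum_univ_four]

theorem extY_mul_extX : extY * extX = -(extX * extY) := by
  ext i j; fin_cases i <;> fin_cases j <;> simp [extX, extY, Matrix.mul_apply, Fin.sum_univ_four]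

theorem extT_mul_extX : extT * extX = -(extX * extT) := by
  ext i j; fin_cases i <;> fin_cases j <;> simp [extX, extT, Matrix.mul_apply, Fin.sum_univ_four]

theorem extT_mul_extY : extT * extY = -(extY * extT) := by
  ext i j; fin_cases i <;> fin_cases j <;> simp [extT, extY, Matrix.mul_apply, Fin.sum_univ_four]

/-- In the basis 1, x, y, xy the first column is the image of 1, so the entry (3, 0) reads off the
coefficient of xy. -/
theorem extX_mul_extY_apply : (extX * extY) 3 0 = 1 ∧ (extX * extY) 0 0 = 0 := by
  constructor <;> simp [extX, extY, Matrix.mul_apply, Fin.sum_univ_four]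

/-- The coefficient of `e_A` in `e_{a₁⋯aₚ}`. -/
noncomputable def coef (A : Finset (Fin 11)) {p : ℕ} (a : Fin p → Fin 11) : ℝ :=
  if h : A.card = p then
    Matrix.det (Matrix.of fun i j => if a i = A.orderEmbOfFin h j then (1 : ℝ) else 0) else 0

theorem coef_perm (A : Finset (Fin 11)) {p : ℕ} (a : Fin p → Fin 11) (σ : Equiv.Perm (Fin p)) :
    coef A (fun i => a (σ i)) = ((Equiv.Perm.sign σ : ℤ) : ℝ) * coef A a := by
  unfold coef
  split_ifs with h
  · rw [← Matrix.det_permute]; rfl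
  · rw [mul_zero]

theorem coef_enum (A B : Finset (Fin 11)) : coef A (enum B) = if B = A then 1 else 0 := by
  split_ifs with hAB
  · subst hAB
    rw [coef, dif_pos rfl]
    have h : (Matrix.of fun i j => if enum B i = B.orderEmbOfFin rfl j then (1 : ℝ) else 0) = 1 := by
      ext i j
      simp [Matrix.one_apply, enum]
    rw [h, Matrix.det_one]
  · unfold coef
    split_ifs with h
    · obtain ⟨x, hx, hxA⟩ : ∃ x ∈ B, x ∉ A := by
        by_contra! h1
        exact hAB (Finset.eq_of_subset_of_card_le h1 h.le)
      rw [← image_enum B, Finset.mem_image] at hx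
      obtain ⟨i, -, rfl⟩ := hx
      refine Matrix.det_eq_zero_of_row_eq_zero i fun j => ?_
      rw [Matrix.of_apply, if_neg]
      intro h2
      exact hxA (h2 ▸ A.orderEmbOfFin_mem h j)
    · rfl

/-- The image of `e_{a₁⋯aₚ}` under `evalCE`. -/
noncomputable def evalBos (A B : Finset (Fin 11)) {p : ℕ} (a : Fin p → Fin 11) :
    Matrix (Fin 4) (Fin 4) ℝ := coef A a • extX + coef B a • extY

/-- The images of the generators under `evalCE`. -/
noncomputable def evalGen (A B : Finset (Fin 11)) (v w : Fin 32 → ℝ) :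
    Gen → Matrix (Fin 4) (Fin 4) ℝ
  | .e1 a => mink a • evalBos A B ![a]
  | .e2 a => evalBos A B a
  | .e5 a => evalBos A B a
  | .psi α => v α • extT
  | .phi α => w α • extT

theorem evalGen_even (A B : Finset (Fin 11)) (v w : Fin 32 → ℝ) {g : Gen} (hg : g.sdeg = 0) :
    ∃ x y : ℝ, evalGen A B v w g = x • extX + y • extY := by
  cases g with
  | e1 a => exact ⟨_, _, by rw [evalGen, evalBos, smul_add, smul_smul, smul_smul]⟩
  | e2 a => exact ⟨_, _, rfl⟩
  | e5 a => exact ⟨_, _, rfl⟩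
  | psi α => exact absurd hg one_ne_zero
  | phi α => exact absurd hg one_ne_zero

theorem evalGen_odd (A B : Finset (Fin 11)) (v w : Fin 32 → ℝ) {g : Gen} (hg : g.sdeg = 1) :
    ∃ x : ℝ, evalGen A B v w g = x • extT := by
  cases g with
  | e1 a => exact absurd hg zero_ne_one
  | e2 a => exact absurd hg zero_ne_one
  | e5 a => exact absurd hg zero_ne_one
  | psi α => exact ⟨_, rfl⟩
  | phi α => exact ⟨_, rfl⟩

theorem sdeg_cases (g : Gen) : g.sdeg = 0 ∨ g.sdeg = 1 := by
  cases g <;> simp [Gen.sdeg]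

/-- Bosonic generators go to the span of the anticommuting x, y, and spinors go to multiples of the
parity. The parity anticommutes with x and y and commutes with itself, exactly as the sign rule
asks. -/
theorem evalGen_comm (A B : Finset (Fin 11)) (v w : Fin 32 → ℝ) (g h : Gen) :
    evalGen A B v w g * evalGen A B v w h =
      ((-1 : ℝ) ^ (1 * 1 + g.sdeg * h.sdeg)) • (evalGen A B v w h * evalGen A B v w g) := by
  rcases sdeg_cases g with hg | hg <;> rcases sdeg_cases h with hh | hh
  · obtain ⟨x, y, e⟩ := evalGen_even A B v w hg
    obtain ⟨x', y', e'⟩ := evalGen_even A B v w hh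
    rw [e, e', hg, hh]
    simp only [mul_add, add_mul, smul_mul_smul_comm, extX_mul_extX, extY_mul_extY, extY_mul_extX,
      smul_zero]
    module
  · obtain ⟨x, y, e⟩ := evalGen_even A B v w hg
    obtain ⟨x', e'⟩ := evalGen_odd A B v w hh
    rw [e, e', hg, hh]
    simp only [mul_add, add_mul, smul_mul_smul_comm, extT_mul_extX, extT_mul_extY]
    module
  · obtain ⟨x, e⟩ := evalGen_odd A B v w hg
    obtain ⟨x', y', e'⟩ := evalGen_even A B v w hh
    rw [e, e', hg, hh]
    simp only [mul_add, add_mul, smul_mul_smul_comm, extT_mul_extX, extT_mul_extY]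
    module
  · obtain ⟨x, e⟩ := evalGen_odd A B v w hg
    obtain ⟨x', e'⟩ := evalGen_odd A B v w hh
    rw [e, e', hg, hh]
    simp only [smul_mul_smul_comm]
    module

theorem evalBos_perm (A B : Finset (Fin 11)) {p : ℕ} (a : Fin p → Fin 11)
    (σ : Equiv.Perm (Fin p)) : evalBos A B (fun i => a (σ i)) =
      ((Equiv.Perm.sign σ : ℤ) : ℝ) • evalBos A B a := by
  rw [evalBos, evalBos, coef_perm, coef_perm, smul_add, smul_smul, smul_smul]

theorem evalGen_rel (A B : Finset (Fin 11)) (v w : Fin 32 → ℝ) ⦃x y : FreeAlgebra ℝ Gen⦄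
    (h : CERel x y) :
    FreeAlgebra.lift ℝ (evalGen A B v w) x = FreeAlgebra.lift ℝ (evalGen A B v w) y := by
  cases h with
  | comm x y =>
    simp only [map_mul, map_smul, FreeAlgebra.lift_ι_apply]
    exact evalGen_comm A B v w x y
  | skew2 a τ =>
    simp only [map_smul, FreeAlgebra.lift_ι_apply]
    exact evalBos_perm A B a τ
  | skew5 a τ =>
    simp only [map_smul, FreeAlgebra.lift_ι_apply]
    exact evalBos_perm A B a τ

/-- The algebra map that keeps the generators `e_A` and `e_B` as exterior variables, discards the
other `e`, and replaces `ψ`, `φ` by multiples of the parity with coefficients `v`, `w`. -/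
noncomputable def evalCE (A B : Finset (Fin 11)) (v w : Fin 32 → ℝ) :
    CE →ₐ[ℝ] Matrix (Fin 4) (Fin 4) ℝ :=
  liftCE (evalGen A B v w) (evalGen_rel A B v w)

theorem evalCE_gen (A B : Finset (Fin 11)) (v w : Fin 32 → ℝ) (g : Gen) :
    evalCE A B v w (gen g) = evalGen A B v w g := by
  rw [evalCE, gen, liftCE_mk, FreeAlgebra.lift_ι_apply]

theorem evalCE_eS (A B : Finset (Fin 11)) (v w : Fin 32 → ℝ) {C : Finset (Fin 11)}
    (hC : C.card = 1 ∨ C.card = 2 ∨ C.card = 5) :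
    evalCE A B v w (eS C) = (if C = A then (1 : ℝ) else 0) • extX
      + (if C = B then (1 : ℝ) else 0) • extY := by
  have key : ∀ (p : ℕ) (a : Fin p → Fin 11), p = 1 ∨ p = 2 ∨ p = 5 →
      evalCE A B v w (eT p a) = evalBos A B a := by
    rintro p a (rfl | rfl | rfl)
    · have : a = ![a 0] := by funext i; fin_cases i; rfl
      rw [eT, map_smul, e1, evalCE_gen, evalGen, smul_smul, mink_mul_self, one_smul, ← this]
    · exact evalCE_gen A B v w (.e2 a)
    · exact evalCE_gen A B v w (.e5 a)
  rw [eS, key _ _ hC, evalBos, coef_enum, coef_enum]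

theorem sum_ite_pair {ι M : Type*} [DecidableEq ι] [AddCommMonoid M] (s t : Finset ι) (A B : ι)
    (g : ι → ι → M) :
    ∑ C ∈ s, ∑ D ∈ t, (if C = A then if D = B then g C D else 0 else 0) =
      if A ∈ s ∧ B ∈ t then g A B else 0 := by
  by_cases hA : A ∈ s
  · rw [Finset.sum_eq_single_of_mem A hA fun C _ hC => by simp [hC]]
    simp [hA]
  · rw [Finset.sum_eq_zero, if_neg fun h => hA h.1]
    intro C hC
    have : C ≠ A := fun h => hA (h ▸ hC)
    simp [this]

/-! ### Independence of the bosonic sectors -/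

namespace MajoranaRep

variable (S : MajoranaRep)

/-- The real bilinear form `v̄ M w`. -/
noncomputable def bil (M : Matrix (Fin 32) (Fin 32) ℝ) (v w : Fin 32 → ℝ) : ℝ :=
  v ⬝ᵥ (S.η * M) *ᵥ w

theorem bil_eq_sum (M : Matrix (Fin 32) (Fin 32) ℝ) (v w : Fin 32 → ℝ) :
    S.bil M v w = ∑ α, ∑ β, (S.η * M) α β * (v α * w β) := by
  simp only [bil, dotProduct, Matrix.mulVec, Finset.mul_sum]
  exact Finset.sum_congr rfl fun α _ => Finset.sum_congr rfl fun β _ => by ring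

theorem bil_smul (c : ℝ) (M : Matrix (Fin 32) (Fin 32) ℝ) (v w : Fin 32 → ℝ) :
    S.bil (c • M) v w = c * S.bil M v w := by
  rw [bil, mul_smul_comm, Matrix.smul_mulVec, dotProduct_smul, smul_eq_mul, bil]

theorem evalCE_qL (A B : Finset (Fin 11)) (v w : Fin 32 → ℝ) (M : Matrix (Fin 32) (Fin 32) ℝ) :
    evalCE A B v w (S.qL M) = S.bil M v v • 1 := by
  change evalCE A B v w (psiPsi S M) = _
  simp only [psiPsi, psi, map_sum, map_smul, map_mul, evalCE_gen, evalGen, smul_mul_smul_comm,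
    extT_mul_extT, bil_eq_sum, Finset.sum_smul, smul_smul]

theorem evalCE_pL (A B : Finset (Fin 11)) (v w : Fin 32 → ℝ) (M : Matrix (Fin 32) (Fin 32) ℝ) :
    evalCE A B v w (S.pL M) = S.bil M v w • 1 := by
  change evalCE A B v w (psiPhi S M) = _
  simp only [psiPhi, psi, phi, map_sum, map_smul, map_mul, evalCE_gen, evalGen,
    smul_mul_smul_comm, extT_mul_extT, bil_eq_sum, Finset.sum_smul, smul_smul]

theorem bil_swap {M N : Matrix (Fin 32) (Fin 32) ℝ} (h : (S.η * M)ᵀ = S.η * N)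
    (v w : Fin 32 → ℝ) : S.bil M v w = S.bil N w v := by
  rw [bil, bil, ← h, Matrix.mulVec_transpose, Matrix.dotProduct_mulVec, dotProduct_comm]

theorem bil_mul_anticomm {A B : Finset (Fin 11)} (hA : A.card = 1 ∨ A.card = 2 ∨ A.card = 5)
    (hB : B.card = 1 ∨ B.card = 2 ∨ B.card = 5) (v : Fin 32 → ℝ) :
    S.bil (S.gU B * S.gU A) v v = -S.bil (S.gU A * S.gU B) v v := by
  rw [← neg_one_mul, ← bil_smul]
  refine S.bil_swap ?_ v v
  rw [S.transpose_eta_mul_mul (S.transpose_eta_mul_gU hB) (S.transpose_eta_mul_gU hA),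
    neg_one_smul, mul_neg]

/-- The chosen pair can occur in the sum in either order. The antisymmetry of the bilinear cancels
that of xy, so the two contributions add. -/
theorem evalCE_nForm {A B : Finset (Fin 11)} (hA : A.card = 1 ∨ A.card = 2 ∨ A.card = 5)
    (hB : B.card = 1 ∨ B.card = 2 ∨ B.card = 5) (v w : Fin 32 → ℝ)
    {q r : ℕ} (k : ℕ) (hq : q = 1 ∨ q = 2 ∨ q = 5) (hr : r = 1 ∨ r = 2 ∨ r = 5) :
    evalCE A B v w (S.nForm q r k) =
      (((if A.card = q ∧ B.card = r ∧ (A ∩ B).card = k then 1 else 0) +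
        (if B.card = q ∧ A.card = r ∧ (A ∩ B).card = k then 1 else 0)) *
        S.bil (S.gU A * S.gU B) v v) • (extX * extY) := by
  have h : ∀ C ∈ idx q, ∀ D ∈ idx r,
      evalCE A B v w (if (C ∩ D).card = k then S.qL (S.gU C * S.gU D) * (eS C * eS D) else 0) =
      (if C = A then if D = B then if (C ∩ D).card = k then
        S.bil (S.gU C * S.gU D) v v • (extX * extY) else 0 else 0 else 0) +
      (if C = B then if D = A then if (C ∩ D).card = k then
        -S.bil (S.gU C * S.gU D) v v • (extX * extY) else 0 else 0 else 0) := by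
    intro C hC D hD
    rw [mem_idx] at hC hD
    by_cases hk : (C ∩ D).card = k
    · simp only [hk, if_true]
      rw [map_mul (evalCE A B v w), map_mul (evalCE A B v w), evalCE_qL, evalCE_eS A B v w (hC ▸ hq), evalCE_eS A B v w (hD ▸ hr)]
      simp only [mul_add, add_mul, smul_mul_smul_comm, extX_mul_extX, extY_mul_extY,
        extY_mul_extX, smul_zero, zero_add, add_zero, one_mul]
      split_ifs <;> simp
    · simp [hk]
  rw [nForm]
  simp only [map_sum]
  rw [Finset.sum_congr rfl fun C hC => Finset.sum_congr rfl fun D hD => h C hC D hD]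
  simp only [Finset.sum_add_distrib]
  rw [add_mul, add_smul]
  rw [sum_ite_pair (idx q) (idx r) A B fun C D => if (C ∩ D).card = k then
      S.bil (S.gU C * S.gU D) v v • (extX * extY) else 0,
    sum_ite_pair (idx q) (idx r) B A fun C D => if (C ∩ D).card = k then
      -S.bil (S.gU C * S.gU D) v v • (extX * extY) else 0]
  rw [S.bil_mul_anticomm hA hB, Finset.inter_comm B A]
  simp only [mem_idx]
  congr 1 <;> split_ifs <;> simp_all

theorem evalCE_cubicForm (A B : Finset (Fin 11)) (v w : Fin 32 → ℝ) (p : ℕ) :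
    evalCE A B v w (S.cubicForm p) =
      (∑ C ∈ idx p, kap p * (S.bil (S.gU C) v w * S.bil (S.gS C) v v)) • 1 := by
  rw [cubicForm, map_sum, Finset.sum_smul]
  refine Finset.sum_congr rfl fun C _ => ?_
  rw [map_smul, map_mul (evalCE A B v w), evalCE_qL, evalCE_pL, smul_mul_smul_comm, one_mul,
    smul_smul]

theorem gS_ne_zero (A : Finset (Fin 11)) : S.gS A ≠ 0 := by
  intro h
  have := S.trace_gU_mul_gS_self A
  rw [h, mul_zero, Matrix.trace_zero] at this
  have h1 : (32 * kap A.card) ≠ 0 := by simp [kap]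
  exact h1 this.symm

theorem eta_mul_ne_zero {M : Matrix (Fin 32) (Fin 32) ℝ} (hM : M ≠ 0) : S.η * M ≠ 0 := by
  intro h
  refine hM ?_
  have := congrArg (S.η⁻¹ * ·) h
  simpa [← mul_assoc, Matrix.nonsing_inv_mul _ (isUnit_iff_ne_zero.2 S.nondeg)] using this

theorem bil_single (M : Matrix (Fin 32) (Fin 32) ℝ) (i j : Fin 32) :
    S.bil M (Pi.single i 1) (Pi.single j 1) = (S.η * M) i j := by
  simp [bil]

theorem bil_add_left (M : Matrix (Fin 32) (Fin 32) ℝ) (u v w : Fin 32 → ℝ) :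
    S.bil M (u + v) w = S.bil M u w + S.bil M v w := by
  simp [bil, add_dotProduct]

theorem bil_add_right (M : Matrix (Fin 32) (Fin 32) ℝ) (u v w : Fin 32 → ℝ) :
    S.bil M u (v + w) = S.bil M u v + S.bil M u w := by
  simp [bil, Matrix.mulVec_add, dotProduct_add]

theorem exists_bil_ne_zero {M : Matrix (Fin 32) (Fin 32) ℝ} (hM : M ≠ 0) :
    ∃ v w, S.bil M v w ≠ 0 := by
  by_contra! h
  refine S.eta_mul_ne_zero hM ?_
  ext i j
  rw [← bil_single, h]
  rfl

theorem exists_bil_self_ne_zero {M : Matrix (Fin 32) (Fin 32) ℝ} (hM : M ≠ 0)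
    (hs : (S.η * M)ᵀ = S.η * M) : ∃ v, S.bil M v v ≠ 0 := by
  by_contra! h
  obtain ⟨v, w, hvw⟩ := S.exists_bil_ne_zero hM
  have h1 := h (v + w)
  rw [bil_add_left, bil_add_right, bil_add_right, h, h, S.bil_swap hs w v] at h1
  exact hvw (by linarith)

/-- Oddness means that Γ_A and Γ_B anticommute. This makes ηΓ^AΓ^B symmetric, and a non-zero
symmetric form is non-zero somewhere on the diagonal. -/
theorem exists_bil_mul_ne_zero {A B : Finset (Fin 11)} (hA : A.card = 1 ∨ A.card = 2 ∨ A.card = 5)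
    (hB : B.card = 1 ∨ B.card = 2 ∨ B.card = 5) (h : Odd (A.card * B.card + (A ∩ B).card)) :
    ∃ v, S.bil (S.gU A * S.gU B) v v ≠ 0 := by
  refine S.exists_bil_self_ne_zero ?_ ?_
  · obtain ⟨ε, hε, h1⟩ := S.gU_mul_gU A B
    rw [h1]
    refine smul_ne_zero (fun h0 => ?_) (S.gS_ne_zero _)
    rw [h0, zero_mul] at hε
    exact zero_ne_one hε
  · rw [S.transpose_eta_mul_mul (S.transpose_eta_mul_gU hA) (S.transpose_eta_mul_gU hB),
      S.gU_comm_gU A B, h.neg_one_pow, neg_one_smul, mul_neg]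

/-- The multiplicity of `e_A e_B` in `nForm q' r' k'`, where `q`, `r` and `k` are the numbers of
elements of `A`, `B` and `A ∩ B`. -/
noncomputable def pairCoef (q r k q' r' k' : ℕ) : ℝ :=
  (if q = q' ∧ r = r' ∧ k = k' then 1 else 0) + (if r = q' ∧ q = r' ∧ k = k' then 1 else 0)

theorem sum_pairCoef_eq_zero {A B : Finset (Fin 11)}
    (hA : A.card = 1 ∨ A.card = 2 ∨ A.card = 5) (hB : B.card = 1 ∨ B.card = 2 ∨ B.card = 5)
    (h : Odd (A.card * B.card + (A ∩ B).card))
    {x₁ x₂ x₃ x₄ x₅ x₆ x₇ x₈ y₁ y₂ y₃ : ℝ}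
    (h0 : x₁ • S.nForm 1 1 0 + x₂ • S.nForm 1 2 1 + x₃ • S.nForm 2 2 1 + x₄ • S.nForm 1 5 0
      + x₅ • S.nForm 2 5 1 + x₆ • S.nForm 5 5 0 + x₇ • S.nForm 5 5 2 + x₈ • S.nForm 5 5 4
      + (y₁ • S.cubicForm 1 + y₂ • S.cubicForm 2 + y₃ • S.cubicForm 5) = 0) :
    x₁ * pairCoef A.card B.card (A ∩ B).card 1 1 0 + x₂ * pairCoef A.card B.card (A ∩ B).card 1 2 1 + x₃ * pairCoef A.card B.card (A ∩ B).card 2 2 1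
      + x₄ * pairCoef A.card B.card (A ∩ B).card 1 5 0 + x₅ * pairCoef A.card B.card (A ∩ B).card 2 5 1 + x₆ * pairCoef A.card B.card (A ∩ B).card 5 5 0
      + x₇ * pairCoef A.card B.card (A ∩ B).card 5 5 2 + x₈ * pairCoef A.card B.card (A ∩ B).card 5 5 4 = 0 := by
  obtain ⟨v, hv⟩ := S.exists_bil_mul_ne_zero hA hB h
  have hz : ∀ M, S.bil M v 0 = 0 := fun M => by simp [bil]
  have hn : ∀ (q r k : ℕ), q = 1 ∨ q = 2 ∨ q = 5 → r = 1 ∨ r = 2 ∨ r = 5 →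
      evalCE A B v 0 (S.nForm q r k) =
        (pairCoef A.card B.card (A ∩ B).card q r k * S.bil (S.gU A * S.gU B) v v) • (extX * extY) :=
    fun q r k hq hr => S.evalCE_nForm hA hB v 0 k hq hr
  -- Sending φ to 0 removes the cubic forms, which are linear in φ.
  have h1 := congrArg (fun x => evalCE A B v 0 x 3 0) h0
  simp only [map_add, map_smul, evalCE_cubicForm, hz, zero_mul, mul_zero, Finset.sum_const_zero,
    zero_smul, smul_zero, add_zero, map_zero, Matrix.zero_apply, Matrix.add_apply,
    Matrix.smul_apply] at h1
  rw [hn 1 1 0 (by simp) (by simp), hn 1 2 1 (by simp) (by simp), hn 2 2 1 (by simp) (by simp),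
    hn 1 5 0 (by simp) (by simp), hn 2 5 1 (by simp) (by simp), hn 5 5 0 (by simp) (by simp),
    hn 5 5 2 (by simp) (by simp), hn 5 5 4 (by simp) (by simp)] at h1
  simp only [Matrix.smul_apply, extX_mul_extY_apply.1, smul_eq_mul, mul_one] at h1
  refine (mul_eq_zero.1 ?_).resolve_right hv
  linear_combination h1

/-- The bosonic sectors of the differential of the ansatz are linearly independent. -/
theorem coefficients_eq_zero {x₁ x₂ x₃ x₄ x₅ x₆ x₇ x₈ y₁ y₂ y₃ : ℝ}
    (h0 : x₁ • S.nForm 1 1 0 + x₂ • S.nForm 1 2 1 + x₃ • S.nForm 2 2 1 + x₄ • S.nForm 1 5 0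
      + x₅ • S.nForm 2 5 1 + x₆ • S.nForm 5 5 0 + x₇ • S.nForm 5 5 2 + x₈ • S.nForm 5 5 4
      + (y₁ • S.cubicForm 1 + y₂ • S.cubicForm 2 + y₃ • S.cubicForm 5) = 0) :
    (x₁ = 0 ∧ x₂ = 0 ∧ x₃ = 0 ∧ x₄ = 0) ∧ x₅ = 0 ∧ x₆ = 0 ∧ x₇ = 0 ∧ x₈ = 0 := by
  have key : ∀ (A B : Finset (Fin 11)) (q r k : ℕ), A.card = q → B.card = r → (A ∩ B).card = k →
      (q = 1 ∨ q = 2 ∨ q = 5) → (r = 1 ∨ r = 2 ∨ r = 5) → Odd (q * r + k) →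
      x₁ * pairCoef q r k 1 1 0 + x₂ * pairCoef q r k 1 2 1 + x₃ * pairCoef q r k 2 2 1
      + x₄ * pairCoef q r k 1 5 0 + x₅ * pairCoef q r k 2 5 1 + x₆ * pairCoef q r k 5 5 0
      + x₇ * pairCoef q r k 5 5 2 + x₈ * pairCoef q r k 5 5 4 = 0 := by
    rintro A B q r k rfl rfl rfl hq hr hk
    exact S.sum_pairCoef_eq_zero hq hr hk h0
  -- One pair of sets per sector: its sizes and intersection match that sector only, with
  -- multiplicity 1 or 2.
  refine ⟨⟨?_, ?_, ?_, ?_⟩, ?_, ?_, ?_, ?_⟩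
  · simpa [pairCoef] using key {0} {1} 1 1 0 rfl rfl rfl (by simp) (by simp) (by decide)
  · simpa [pairCoef] using key {0} {0, 1} 1 2 1 rfl rfl rfl (by simp) (by simp) (by decide)
  · simpa [pairCoef] using key {0, 1} {1, 2} 2 2 1 rfl rfl rfl (by simp) (by simp) (by decide)
  · simpa [pairCoef] using
      key {0} {1, 2, 3, 4, 5} 1 5 0 rfl rfl rfl (by simp) (by simp) (by decide)
  · simpa [pairCoef] using
      key {0, 1} {1, 2, 3, 4, 5} 2 5 1 rfl rfl rfl (by simp) (by simp) (by decide)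
  · simpa [pairCoef] using
      key {0, 1, 2, 3, 4} {5, 6, 7, 8, 9} 5 5 0 rfl rfl rfl (by simp) (by simp) (by decide)
  · simpa [pairCoef] using
      key {0, 1, 2, 3, 4} {3, 4, 5, 6, 7} 5 5 2 rfl rfl rfl (by simp) (by simp) (by decide)
  · simpa [pairCoef] using
      key {0, 1, 2, 3, 4} {1, 2, 3, 4, 5} 5 5 4 rfl rfl rfl (by simp) (by simp) (by decide)

end MajoranaRep

/-! ### A necessary condition from the cubic part -/

theorem sum_polarized (H P Q : Matrix (Fin 32) (Fin 32) ℝ) (i l : Fin 32) :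
    ∑ j, ∑ k, H k j * (P i l * Q j k + P j l * Q i k + P k l * Q i j) =
      P i l * (Q * H).trace + (Q * H * P) i l + (Q * Hᵀ * P) i l := by
  simp only [mul_add, Finset.sum_add_distrib, Matrix.trace, Matrix.diag, Matrix.mul_apply,
    Matrix.transpose_apply, Finset.sum_mul, Finset.mul_sum]
  congr 1
  · congr 1
    · exact Finset.sum_congr rfl fun _ _ => Finset.sum_congr rfl fun _ _ => by ring
    · exact Finset.sum_congr rfl fun _ _ => Finset.sum_congr rfl fun _ _ => by ring
  · rw [Finset.sum_comm]
    exact Finset.sum_congr rfl fun _ _ => Finset.sum_congr rfl fun _ _ => by ring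

/-- The set {0} contributes +1 and the ten other singletons -1. In degree two, the 45 pairs avoiding
0 contribute +1 and the ten containing it -1. -/
theorem sum_sign_one :
    ∑ C ∈ idx 1, (-1 : ℝ) ^ (C.card * ({0} : Finset (Fin 11)).card + (C ∩ {0}).card) = -9 := by
  have : ∑ C ∈ idx 1, (-1 : ℤ) ^ (C.card * ({0} : Finset (Fin 11)).card + (C ∩ {0}).card) = -9 := by
    decide +kernel
  exact_mod_cast this

theorem sum_sign_two :
    ∑ C ∈ idx 2, (-1 : ℝ) ^ (C.card * ({0} : Finset (Fin 11)).card + (C ∩ {0}).card) = 35 := by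
  have : ∑ C ∈ idx 2, (-1 : ℤ) ^ (C.card * ({0} : Finset (Fin 11)).card + (C ∩ {0}).card) = 35 := by
    decide +kernel
  exact_mod_cast this

theorem polarize {V : Type*} [AddCommGroup V] (F : V → V → V → ℝ)
    (h₁ : ∀ a b c d, F (a + b) c d = F a c d + F b c d)
    (h₂ : ∀ a b c d, F a (b + c) d = F a b d + F a c d)
    (h₃ : ∀ a b c d, F a b (c + d) = F a b c + F a b d)
    (hs : ∀ a b c, F a b c = F a c b) (h : ∀ a, F a a a = 0) (a b c : V) :
    F a b c + F b a c + F c a b = 0 := by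
  have e1 := h (a + b + c)
  have e2 := h (a + b)
  have e3 := h (a + c)
  have e4 := h (b + c)
  simp only [h₁, h₂, h₃, h] at e1 e2 e3 e4
  have s1 := hs a b c
  have s2 := hs b a c
  have s3 := hs c a b
  linarith

namespace MajoranaRep

variable (S : MajoranaRep)

/-- The trilinear form in `ψ` that underlies `cubicForm p`. -/
noncomputable def cub (p : ℕ) (w a b c : Fin 32 → ℝ) : ℝ :=
  ∑ C ∈ idx p, kap p * (S.bil (S.gU C) a w * S.bil (S.gS C) b c)

theorem cub_symm {p : ℕ} (hp : p = 1 ∨ p = 2 ∨ p = 5) (w a b c : Fin 32 → ℝ) :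
    S.cub p w a b c = S.cub p w a c b :=
  Finset.sum_congr rfl fun C hC => by
    rw [S.bil_swap (S.transpose_eta_mul_gS ((mem_idx.1 hC).symm ▸ hp)) b c]

theorem gS_mul_gU_self (A : Finset (Fin 11)) : kap A.card • (S.gS A * S.gU A) = 1 := by
  rw [gU, mul_smul_comm, gS_mul_self, smul_smul, smul_smul]
  have : kap A.card * shS A * (kap A.card * shS A) = 1 := by
    linear_combination kap A.card * kap A.card * shS_mul_self A + kap_mul_self A.card
  rw [this, one_smul]

/-- The polarized cubic form is contracted in two ψ-slots with H = Γ_0 η⁻¹. When both slots lie in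
the same bilinear, a trace arises and the sum over C is the projection of Γ_0. The other two
arrangements give Γ_C Γ_0 Γ^C = ±Γ_0, and they are equal since H is symmetric. -/
theorem sum_cub (p : ℕ) (i l : Fin 32) :
    ∑ j, ∑ k, (S.gS {0} * S.η⁻¹) k j *
      (S.cub p (Pi.single l 1) (Pi.single i 1) (Pi.single j 1) (Pi.single k 1)
        + S.cub p (Pi.single l 1) (Pi.single j 1) (Pi.single i 1) (Pi.single k 1)
        + S.cub p (Pi.single l 1) (Pi.single k 1) (Pi.single i 1) (Pi.single j 1)) =
    (S.η * (S.proj p (S.gS {0}) + (2 * ∑ C ∈ idx p,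
      (-1 : ℝ) ^ (C.card * ({0} : Finset (Fin 11)).card + (C ∩ {0}).card)) • S.gS {0})) i l := by
  have hη : S.η⁻¹ * S.η = 1 := Matrix.nonsing_inv_mul _ (isUnit_iff_ne_zero.2 S.nondeg)
  have hη' : S.η * S.η⁻¹ = 1 := Matrix.mul_nonsing_inv _ (isUnit_iff_ne_zero.2 S.nondeg)
  set H := S.gS {0} * S.η⁻¹ with hH
  have hHη : H * S.η = S.gS {0} := by rw [hH, mul_assoc, hη, mul_one]
  have hHt : Hᵀ = H := by
    have h1 : (S.η * S.gS {0})ᵀ = S.η * S.gS {0} := S.transpose_eta_mul_gS (by simp)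
    have h2 : (S.η * (H * S.η))ᵀ = S.η * (H * S.η) := by rw [hHη, h1]
    rw [Matrix.transpose_mul, Matrix.transpose_mul, S.skew] at h2
    simp only [neg_mul, mul_neg, neg_neg] at h2
    calc Hᵀ = S.η⁻¹ * (S.η * Hᵀ * S.η) * S.η⁻¹ := by
          rw [mul_assoc S.η, ← mul_assoc S.η⁻¹, hη, one_mul, mul_assoc, hη', mul_one]
      _ = S.η⁻¹ * (S.η * (H * S.η)) * S.η⁻¹ := by rw [h2]
      _ = H := by rw [← mul_assoc S.η⁻¹, hη, one_mul, mul_assoc, hη', mul_one]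
  have key : ∀ C ∈ idx p, ∑ j, ∑ k, H k j *
      (kap p * ((S.η * S.gU C) i l * (S.η * S.gS C) j k)
        + kap p * ((S.η * S.gU C) j l * (S.η * S.gS C) i k)
        + kap p * ((S.η * S.gU C) k l * (S.η * S.gS C) i j)) =
      (S.η * ((kap p * (S.gU C * S.gS {0}).trace) • S.gS C + (2 * (-1 : ℝ) ^
        (C.card * ({0} : Finset (Fin 11)).card + (C ∩ {0}).card)) • S.gS {0})) i l := by
    intro C hC
    rw [mem_idx] at hC
    have h1 := sum_polarized H (S.η * S.gU C) (S.η * S.gS C) i l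
    have h2 : (S.η * S.gS C * H).trace = (S.gS C * S.gS {0}).trace := by
      rw [mul_assoc, Matrix.trace_mul_comm, mul_assoc, hHη]
    have h3 : kap p • (S.η * S.gS C * H * (S.η * S.gU C)) = ((-1 : ℝ) ^
        (C.card * ({0} : Finset (Fin 11)).card + (C ∩ {0}).card)) • (S.η * S.gS {0}) := by
      rw [mul_assoc _ H, ← mul_assoc H, hHη, mul_assoc S.η, ← mul_assoc (S.gS C), gS_comm_gS,
        smul_mul_assoc, mul_assoc, mul_smul_comm, smul_comm, ← hC, ← mul_smul_comm (kap C.card),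
        ← mul_smul_comm (kap C.card), gS_mul_gU_self, mul_one]
    have h4 := congrFun (congrFun h3 i) l
    rw [hHt, h2] at h1
    simp only [Matrix.smul_apply, smul_eq_mul] at h4
    have h5 : ∑ j, ∑ k, H k j *
      (kap p * ((S.η * S.gU C) i l * (S.η * S.gS C) j k)
        + kap p * ((S.η * S.gU C) j l * (S.η * S.gS C) i k)
        + kap p * ((S.η * S.gU C) k l * (S.η * S.gS C) i j)) = kap p * ∑ j, ∑ k, H k j *
      ((S.η * S.gU C) i l * (S.η * S.gS C) j k + (S.η * S.gU C) j l * (S.η * S.gS C) i k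
        + (S.η * S.gU C) k l * (S.η * S.gS C) i j) := by
      simp only [Finset.mul_sum]
      exact Finset.sum_congr rfl fun _ _ => Finset.sum_congr rfl fun _ _ => by ring
    rw [h5, h1]
    simp only [gU, mul_add, mul_smul_comm, smul_mul_assoc, Matrix.add_apply, Matrix.smul_apply,
      smul_eq_mul, Matrix.trace_smul] at h4 ⊢
    linear_combination 2 * h4
  simp only [cub, bil_single, ← Finset.sum_add_distrib, Finset.mul_sum (idx p)]
  rw [← sum_rotate (s := idx p), Finset.sum_congr rfl key, proj, Finset.sum_smul,
    ← Finset.sum_add_distrib, Finset.mul_sum, Matrix.sum_apply]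

/-- Contracting as in `sum_cub` leaves multiples of Γ_0: 32 - 2·9 = 14 in degree one and 0 + 2·35 =
70 in degree two, hence 14x + 70y = 0. This is needed only for s = -6. -/
theorem cubicForm_relation {x y : ℝ} (h : x • S.cubicForm 1 + y • S.cubicForm 2 = 0) :
    x + 5 * y = 0 := by
  have h0 : ∀ v w, x * S.cub 1 w v v v + y * S.cub 2 w v v v = 0 := by
    intro v w
    -- The cubic forms contain no e, so they evaluate to scalar matrices and one diagonal entry
    -- suffices.
    have h1 := congrArg (fun z => evalCE ∅ ∅ v w z 0 0) h
    simpa [evalCE_cubicForm, cub] using h1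
  have h1 : ∀ w a b c, (x * S.cub 1 w a b c + y * S.cub 2 w a b c)
      + (x * S.cub 1 w b a c + y * S.cub 2 w b a c)
      + (x * S.cub 1 w c a b + y * S.cub 2 w c a b) = 0 := by
    intro w a b c
    refine polarize (fun a b c => x * S.cub 1 w a b c + y * S.cub 2 w a b c) ?_ ?_ ?_ ?_
      (fun a => h0 a w) a b c
    · intro a b c e
      simp only [cub, bil_add_left, add_mul, mul_add, Finset.sum_add_distrib]
      ring
    · intro a b c e
      simp only [cub, bil_add_left, mul_add, Finset.sum_add_distrib]
      ring
    · intro a b c e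
      simp only [cub, bil_add_right, mul_add, Finset.sum_add_distrib]
      ring
    · intro a b c
      rw [S.cub_symm (p := 1) (by simp) w a b c, S.cub_symm (p := 2) (by simp) w a b c]
  have h2 : S.η * ((14 * x + 70 * y) • S.gS {0}) = 0 := by
    ext i l
    have e1 := S.sum_cub 1 i l
    have e2 := S.sum_cub 2 i l
    have p1 : S.proj 1 (S.gS {0}) = (32 : ℝ) • S.gS {0} := by rw [proj_gS]; simp
    have p2 : S.proj 2 (S.gS {0}) = 0 := by rw [proj_gS]; simp
    rw [p1, sum_sign_one, ← add_smul, mul_smul_comm, Matrix.smul_apply, smul_eq_mul] at e1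
    rw [p2, sum_sign_two, zero_add, mul_smul_comm, Matrix.smul_apply, smul_eq_mul] at e2
    rw [mul_smul_comm, Matrix.smul_apply, smul_eq_mul, Matrix.zero_apply]
    have e3 : x * ((32 + 2 * -9) * (S.η * S.gS {0}) i l) + y * (2 * 35 * (S.η * S.gS {0}) i l) = 0 := by
      rw [← e1, ← e2]
      simp only [Finset.mul_sum, ← Finset.sum_add_distrib]
      refine Finset.sum_eq_zero fun j _ => Finset.sum_eq_zero fun k _ => ?_
      linear_combination (S.gS {0} * S.η⁻¹) k j *
        h1 (Pi.single l 1) (Pi.single i 1) (Pi.single j 1) (Pi.single k 1)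
    linear_combination e3
  have h3 : (14 * x + 70 * y) = 0 := by
    by_contra h4
    exact S.eta_mul_ne_zero (smul_ne_zero h4 (S.gS_ne_zero _)) h2
  linarith

/-- No generator is labelled by ∅, so every e goes to a multiple of the single element x, and x² =
0. -/
theorem evalCE_trace3 (i : Fin 11) (v w : Fin 32 → ℝ) {p q r : ℕ} (hp : p = 1 ∨ p = 2 ∨ p = 5)
    (hq : q = 1 ∨ q = 2 ∨ q = 5) : evalCE {i} ∅ v w (S.trace3 p q r) = 0 := by
  have h : ∀ C : Finset (Fin 11), C.card = 1 ∨ C.card = 2 ∨ C.card = 5 → C ≠ ∅ := by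
    rintro C hC rfl
    simp at hC
  simp only [trace3, map_sum]
  refine Finset.sum_eq_zero fun A hA => Finset.sum_eq_zero fun B hB =>
    Finset.sum_eq_zero fun C _ => ?_
  rw [mem_idx] at hA hB
  have hA' := hA.symm ▸ hp
  have hB' := hB.symm ▸ hq
  rw [tri3, map_smul, map_mul (evalCE _ _ v w), map_mul (evalCE _ _ v w), evalCE_eS _ _ v w hA',
    evalCE_eS _ _ v w hB', if_neg (h A hA'), if_neg (h B hB'), zero_smul, add_zero, add_zero,
    smul_mul_smul_comm, extX_mul_extX, smul_zero, zero_mul, smul_zero]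

theorem evalCE_betaForm (i : Fin 11) (v w : Fin 32 → ℝ) {p : ℕ} (hp : p = 1 ∨ p = 2 ∨ p = 5) :
    evalCE {i} ∅ v w (S.betaForm p) = if p = 1 then S.bil (S.gU {i}) v w • extX else 0 := by
  have h : ∀ C ∈ idx p, evalCE {i} ∅ v w (S.pL (S.gU C) * eS C) =
      if C = {i} then S.bil (S.gU C) v w • extX else 0 := by
    intro C hC
    rw [mem_idx] at hC
    have hC' := hC.symm ▸ hp
    have h0 : C ≠ ∅ := by
      rintro rfl
      simp at hC'
    rw [map_mul (evalCE _ _ v w), evalCE_pL, evalCE_eS _ _ v w hC', if_neg h0]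
    split_ifs <;> simp
  rw [betaForm, map_sum, Finset.sum_congr rfl h, Finset.sum_ite_eq' (idx p)]
  simp only [mem_idx, Finset.card_singleton, eq_comm]

/-- Keeping only e_0 kills everything except β₁ (ψ̄ Γ^0 φ) e_0, and ψ, φ can be chosen with non-zero
pairing. It ensures that the closed forms at s = 0, not only their coefficients, are
one-dimensional. -/
theorem ansatz_ne_zero {c : Params} (hc : c.2 0 ≠ 0) : ansatz S c ≠ 0 := by
  intro h
  obtain ⟨v, w, hvw⟩ := S.exists_bil_ne_zero (M := S.gU {0})
    (smul_ne_zero (fun h => by simpa [h] using shS_mul_self {0}) (S.gS_ne_zero {0}))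
  change c.1 0 • termA0 + c.1 1 • termA1 + c.1 2 • termA2 + c.1 3 • termA3
    + c.1 4 • termA4 + c.2 0 • termB1 S + c.2 1 • termB2 S + c.2 2 • termB3 S = 0 at h
  rw [S.termA0_eq, S.termA1_eq, S.termA2_eq, S.termA3_eq, S.termA4_eq, S.termB1_eq, S.termB2_eq,
    S.termB3_eq] at h
  have h1 := congrArg (fun z => evalCE {0} ∅ v w z 1 0) h
  simp [evalCE_trace3, evalCE_betaForm, extX, hc, hvw] at h1

end MajoranaRep

/-! ### Solving the linear system, and the limit -/

theorem Params.ext {c c' : Params} (h0 : c.1 0 = c'.1 0) (h1 : c.1 1 = c'.1 1)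
    (h2 : c.1 2 = c'.1 2) (h3 : c.1 3 = c'.1 3) (h4 : c.1 4 = c'.1 4) (k0 : c.2 0 = c'.2 0)
    (k1 : c.2 1 = c'.2 1) (k2 : c.2 2 = c'.2 2) : c = c' := by
  refine Prod.ext (funext fun i => ?_) (funext fun i => ?_)
  · fin_cases i <;> assumption
  · fin_cases i <;> assumption

theorem omegaParams_coefficients :
    (omegaParams.1 0 = -3 / 5 ∧ omegaParams.1 1 = 1 / 5 ∧ omegaParams.1 2 = 1 / 40 ∧
      omegaParams.1 3 = 1 / 24000 ∧ omegaParams.1 4 = -1 / 43200) ∧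
    omegaParams.2 0 = -3 / 10 ∧ omegaParams.2 1 = -3 / 20 ∧ omegaParams.2 2 = -1 / 400 := by
  refine ⟨⟨rfl, rfl, ?_, ?_, ?_⟩, rfl, rfl, ?_⟩
  · change 18 / (Nat.factorial 6 : ℝ) = _
    norm_num [Nat.factorial]
  · change 18 / (5 * (Nat.factorial 5 : ℝ) * (Nat.factorial 6 : ℝ)) = _
    norm_num [Nat.factorial]
  · change -2 / ((Nat.factorial 5 : ℝ) * (Nat.factorial 6 : ℝ)) = _
    norm_num [Nat.factorial]
  · change -3 / (10 * (Nat.factorial 5 : ℝ)) = _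
    norm_num [Nat.factorial]

namespace MajoranaRep

variable (S : MajoranaRep)

theorem eq_zero_of_closed {s : ℝ} (hs : s ≠ 0) {c : Params} (hc : d S s (ansatz S c) = 0) :
    c = 0 := by
  rw [S.d_ansatz] at hc
  obtain ⟨⟨h1, h2, h3, h4⟩, h5, h6, h7, h8⟩ := S.coefficients_eq_zero hc
  rw [h1, h2, h3, h4, h5, h6, h7, h8] at hc
  simp only [zero_smul, zero_add] at hc
  have hb : c.2 0 = 0 ∧ c.2 1 = 0 ∧ c.2 2 = 0 := by
    -- At s = -6 the bosonic sectors give β₃ = 0 and only 22β₁ = 20β₂ for the other two. The cubic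
    -- part adds β₁ + 10β₂ = 0.
    by_cases hg : 1 + s / 6 = 0
    · have hs6 : s = -6 := by linarith
      subst hs6
      have b2 : c.2 2 = 0 := by linarith
      rw [b2, mul_zero, zero_smul, add_zero] at hc
      have h := S.cubicForm_relation hc
      exact ⟨by linarith, by linarith, b2⟩
    · have e0 : (1 + s / 6) * c.2 0 = 120 * (1 - 2 * s / 3) * c.2 2 := by
        linear_combination h4 / 2 - h6
      have e1 : (1 + s / 6) * c.2 1 = 60 * (1 + s / 3) * c.2 2 := by
        linear_combination h5 / 4 - h8 / 2
      -- The sectors (1,1,0) and (1,2,1) give (2 + 4s)β₁ = 4(1 + s)β₂. After multiplication by 1 +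
      -- s/6 and insertion of `e0` and `e1`, the constant and linear terms in s cancel, leaving 400
      -- s² β₃ = 0.
      have e2 : s ^ 2 * c.2 2 = 0 := by
        linear_combination (1 / 400) * ((1 + s / 6) * (h2 - 2 * h1)
          + (2 + 4 * s) * e0 - 4 * (1 + s) * e1)
      have b2 : c.2 2 = 0 := (mul_eq_zero.1 e2).resolve_left (pow_ne_zero 2 hs)
      rw [b2, mul_zero] at e0 e1
      exact ⟨(mul_eq_zero.1 e0).resolve_left hg, (mul_eq_zero.1 e1).resolve_left hg, b2⟩
  obtain ⟨b0, b1, b2⟩ := hb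
  rw [b0] at h1 h4
  rw [b1] at h3
  rw [b2] at h6 h7 h8
  simp only [mul_zero, add_zero] at h1 h3 h6 h7 h8
  apply Params.ext <;> simp only [Prod.fst_zero, Prod.snd_zero, Pi.zero_apply] <;> linarith

/-- The bosonic sectors alone cut out a line parametrised by β₃. The factor -400 normalises it,
since β₃ = -1/400 for Ω₃. -/
theorem eq_smul_omegaParams_of_closed {c : Params} (hc : d S 0 (ansatz S c) = 0) :
    c = (-400 * c.2 2) • omegaParams := by
  rw [S.d_ansatz] at hc
  obtain ⟨⟨h1, h2, h3, h4⟩, h5, h6, h7, h8⟩ := S.coefficients_eq_zero hc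
  obtain ⟨⟨o0, o1, o2, o3, o4⟩, p0, p1, p2⟩ := omegaParams_coefficients
  apply Params.ext <;> simp only [Prod.smul_fst, Prod.smul_snd, Pi.smul_apply, smul_eq_mul, o0, o1,
    o2, o3, o4, p0, p1, p2] <;> linarith

theorem d_ansatz_omegaParams : d S 0 (ansatz S omegaParams) = 0 := by
  rw [S.d_ansatz]
  -- For Ω₃ the weights β₁, 2β₂ and 120β₃ of the cubic forms are all -3/10.
  have h : (-3 / 10 : ℝ) • S.cubicForm 1 + (-3 / 10 : ℝ) • S.cubicForm 2
      + (-3 / 10 : ℝ) • S.cubicForm 5 = 0 := by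
    rw [← smul_add, ← smul_add, S.sum_cubicForm, smul_zero]
  obtain ⟨⟨o0, o1, o2, o3, o4⟩, p0, p1, p2⟩ := omegaParams_coefficients
  rw [o0, o1, o2, o3, o4, p0, p1, p2, ← h]
  module

theorem closedParams_eq_bot {s : ℝ} (hs : s ≠ 0) : closedParams S s = ⊥ :=
  (Submodule.eq_bot_iff _).2 fun _ hc => S.eq_zero_of_closed hs hc

theorem closedForms_eq_map (s : ℝ) :
    closedForms S s = (closedParams S s).map (ansatz S) := by
  rw [closedForms, closedParams, LinearMap.ker_comp, Submodule.map_comap_eq]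

theorem closedParams_zero : closedParams S 0 = Submodule.span ℝ {omegaParams} := by
  refine le_antisymm (fun c hc => ?_) ?_
  · exact Submodule.mem_span_singleton.2 ⟨_, (S.eq_smul_omegaParams_of_closed hc).symm⟩
  · exact (Submodule.span_singleton_le_iff_mem _ _).2 S.d_ansatz_omegaParams

theorem closedForms_zero : closedForms S 0 = Submodule.span ℝ {Omega3 S} := by
  rw [closedForms_eq_map, closedParams_zero, Submodule.map_span, Set.image_singleton, Omega3]

theorem Omega3_ne_zero : Omega3 S ≠ 0 :=
  S.ansatz_ne_zero (by norm_num [omegaParams_coefficients])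

end MajoranaRep

theorem omegaParams_ne_zero : omegaParams ≠ 0 := fun h => by
  have h1 := congrArg (fun c : Params => c.2 0) h
  norm_num [omegaParams_coefficients] at h1

theorem tendsto_hiddenParams :
    Filter.Tendsto (fun s : ℝ => s ^ 2 • hiddenParams s) (nhdsWithin 0 {0}ᶜ)
      (nhds omegaParams) := by
  -- The coefficients after cancelling s²: polynomials in s, equal to the given function away from 0
  -- and continuous at 0.
  let f : ℝ → Params := fun s =>
    (![-1 / 10 * (6 + 2 * s + s ^ 2), 1 / 30 * (6 + 2 * s), 1 / 1440 * (6 + s) ^ 2,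
       1 / 864000 * (6 + s) ^ 2, -1 / 1555200 * (6 + s) ^ 2],
     ![-1 / 10 * (3 - 2 * s), -1 / 20 * (3 + s), -3 / 7200 * (6 + s)])
  have hf : Continuous f := by
    refine Continuous.prodMk (continuous_pi fun i => ?_) (continuous_pi fun i => ?_)
    · fin_cases i <;> simp <;> fun_prop
    · fin_cases i <;> simp <;> fun_prop
  have h0 : f 0 = omegaParams := by
    obtain ⟨⟨o0, o1, o2, o3, o4⟩, p0, p1, p2⟩ := omegaParams_coefficients
    apply Params.ext <;> simp only [o0, o1, o2, o3, o4, p0, p1, p2] <;> simp [f] <;> norm_num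
  rw [← h0]
  refine ((hf.tendsto 0).mono_left nhdsWithin_le_nhds).congr' ?_
  filter_upwards [self_mem_nhdsWithin] with s hs
  have hs : s ≠ 0 := hs
  apply Params.ext <;> simp [f, hiddenParams, Nat.factorial, coefGamma1] <;> field_simp <;>
    norm_num <;> ring

end HiddenM

theorem mainTheorem6 (S : HiddenM.MajoranaRep) :
    (∀ s : ℝ, s ≠ 0 →
      HiddenM.closedParams S s = ⊥ ∧ HiddenM.closedForms S s = ⊥) ∧
    (HiddenM.closedParams S 0 = Submodule.span ℝ {HiddenM.omegaParams} ∧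
      Module.finrank ℝ (HiddenM.closedParams S 0) = 1) ∧
    (HiddenM.closedForms S 0 = Submodule.span ℝ {HiddenM.Omega3 S} ∧
      Module.finrank ℝ (HiddenM.closedForms S 0) = 1) ∧
    Filter.Tendsto (fun s : ℝ => s ^ 2 • HiddenM.hiddenParams s)
      (nhdsWithin 0 {0}ᶜ) (nhds HiddenM.omegaParams) := by
  refine ⟨fun s hs => ⟨S.closedParams_eq_bot hs, ?_⟩, ⟨S.closedParams_zero, ?_⟩,
    ⟨S.closedForms_zero, ?_⟩, HiddenM.tendsto_hiddenParams⟩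
  · rw [S.closedForms_eq_map, S.closedParams_eq_bot hs, Submodule.map_bot]
  · rw [S.closedParams_zero, finrank_span_singleton HiddenM.omegaParams_ne_zero]
  · rw [S.closedForms_zero, finrank_span_singleton S.Omega3_ne_zero]
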